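/- **Conventions.** Cube complexes are complexes obtained by gluing unit cubes along faces by isometries; cube complexes and their covers are connected. A cube complex is *nonpositively curved* if the link of each vertex is a flag simplicial complex. Paths are edge paths. A *local isometry* $\phi: Y\to X$ of nonpositively curved cube complexes is a combinatorial map such that, for each vertex $y$ of $Y$, the induced map $\operatorname{link}(y)\to\operatorname{link}(\phi(y))$ is an embedding onto a full subcomplex. A nonpositively curved cube complex is *virtually special* if it has a finite-sheeted cover that admits a local isometry to the Salvetti complex of the right-angled Artin group of some (possibly infinite) simplicial graph. Let $X$ be a nonpositively curved cube complex. * A *route of length $n$ in $X$* is a tuple $\mathfrak R=(y_0,Y_1,y_1,Y_2,\dots,Y_n,y_n)$, where the $y_i$ are vertices of $X$, each $Y_i$ is a nonpositively curved cube complex equipped with a local isometry $\phi_i: Y_i\to X$, and each $Y_i$ has two marked vertices $y^i_{i-1},y^i_i$ with $\phi_i(y^i_{i-1})=y_{i-1}$ and $\phi_i(y^i_i)=y_i$. It is *closed* if $y_0=y_n$, and *finite* if every $Y_i$ is a finite complex. * A *path along $\mathfrak R$* is a tuple $(\delta_1,\dots,\delta_n)$ where $\delta_i$ is the image under $\phi_i$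 of a path in $Y_i$ from $y^i_{i-1}$ to $y^i_i$. A closed route is *essential* if for every path $(\delta_1,\dots,\delta_n)$ along it the closed path $\delta_1\delta_2\cdots\delta_n$ is not null-homotopic in $X$. * Let $\mu:\hat X\to X$ be a cover. An *elevation of $\mathfrak R$ to $\hat X$* is a route $\hat{\mathfrak R}=(\hat y_0,\hat Y_1,\hat y_1,\dots,\hat Y_n,\hat y_n)$ in $\hat X$, with local isometries $\hat\phi_i:\hat Y_i\to\hat X$ and marked vertices $\hat y^i_{i-1},\hat y^i_i$, such that $\mu(\hat y_i)=y_i$ for all $i$ and such that for each $i$ there is a covering $\nu_i:\hat Y_i\to Y_i$ with $\phi_i\nu_i=\mu\hat\phi_i$, $\nu_i(\hat y^i_{i-1})=y^i_{i-1}$, $\nu_i(\hat y^i_i)=y^i_i$, for which a path in $\hat Y_i$ closes up if and only if its projections to $Y_i$ and to $\hat X$ both close up. * Let $G=\pi_1(X)$, acting by deck transformations on the universal cover $\tilde X$. A subgroup $K<G$ is *convex-cocompact* if it stabilizes, and acts cocompactly on, a (nonempty) convex subcomplex of $\tilde X$, i.e. a connected subcomplex whose inclusion is a local isometry. * A subset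 $S$ of a group $G$ is *separable* if for every $g\in G\setminus S$ there is a homomorphism $\theta: G\to F$ to a finite group with $\theta(g)\notin\theta(S)$. **Proposition 4.10.** Let $X$ be a nonpositively curved cube complex which is either locally finite or virtually special, and let $n\ge 1$ be an integer. The following are equivalent: 1. For every finite essential closed route $\mathfrak R$ of length $n$ in $X$, there exists a finite-sheeted cover $\hat X\to X$ such that $\mathfrak R$ has no closed elevation to $\hat X$. 2. For all convex-cocompact subgroups $K_1,\dots,K_n$ of $G=\pi_1(X)$, the product $K_1K_2\cdots K_n=\{k_1k_2\cdots k_n : k_i\in K_i\}$ is separable in $G$. -/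

import Mathlib

open scoped Pointwise

universe u

/-! ## The category of cubes -/

/-- An isometric embedding of the cube `[0,1]^m` onto a face of the cube `[0,1]^n`: `dir` says in
which coordinate direction of `[0,1]^n` each coordinate direction of `[0,1]^m` is sent, and `base`
is the vertex of `[0,1]^n` that is the image of the origin. For `m = n` these are exactly the
symmetries of the `n`-cube. -/
@[ext]
structure FaceMap (m n : ℕ) where
  dir : Fin m ↪ Fin n
  base : Fin n → Bool

namespace FaceMap

/-- The action of a face embedding on vertices of cubes: the coordinate `dir i` of the image is
`base (dir i)`, flipped if the `i`-th coordinate of the argument is `1`; all other coordinates are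
those of `base`. -/
noncomputable def app {m n : ℕ} (σ : FaceMap m n) (a : Fin m → Bool) : Fin n → Bool :=
  fun j => xor (σ.base j) (Function.extend σ.dir a (fun _ => false) j)

/-- The identity of the `n`-cube. -/
protected def id (n : ℕ) : FaceMap n n := ⟨Function.Embedding.refl _, fun _ => false⟩

/-- Composition: first `τ`, then `σ`. -/
noncomputable def comp {l m n : ℕ} (σ : FaceMap m n) (τ : FaceMap l m) : FaceMap l n :=
  ⟨τ.dir.trans σ.dir, σ.app τ.base⟩

/-- The inclusion of the vertex `a` into the `n`-cube. -/
def vertex {n : ℕ} (a : Fin n → Bool) : FaceMap 0 n := ⟨⟨Fin.elim0, fun i => i.elim0⟩, a⟩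

/-- The inclusion of the edge of the `n`-cube that starts at the vertex `a` and goes in the
direction `i`. -/
def edge {n : ℕ} (i : Fin n) (a : Fin n → Bool) : FaceMap 1 n :=
  ⟨⟨fun _ => i, fun _ _ _ => Subsingleton.elim _ _⟩, a⟩

theorem app_dir {m n : ℕ} (σ : FaceMap m n) (a : Fin m → Bool) (i : Fin m) :
    σ.app a (σ.dir i) = xor (σ.base (σ.dir i)) (a i) := by
  simp [app, σ.dir.injective.extend_apply]

theorem app_of_forall_ne {m n : ℕ} (σ : FaceMap m n) (a : Fin m → Bool) (j : Fin n)
    (h : ∀ i, σ.dir i ≠ j) : σ.app a j = σ.base j := by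
  have : ¬ ∃ i, σ.dir i = j := fun ⟨i, hi⟩ => h i hi
  simp [app, Function.extend_apply' _ _ _ this]

theorem comp_app {l m n : ℕ} (σ : FaceMap m n) (τ : FaceMap l m) (a : Fin l → Bool) :
    (σ.comp τ).app a = σ.app (τ.app a) := by
  funext j
  by_cases hj : ∃ i, σ.dir i = j
  · obtain ⟨i, rfl⟩ := hj
    by_cases hi : ∃ k, τ.dir k = i
    · obtain ⟨k, rfl⟩ := hi
      have h := app_dir (σ.comp τ) a k
      simp only [comp, Function.Embedding.trans_apply] at h
      simp only [comp, h, app_dir, Bool.xor_assoc]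
    · have hi' : ∀ k, τ.dir k ≠ i := fun k hk => hi ⟨k, hk⟩
      rw [app_of_forall_ne (σ.comp τ) a _
        (fun k hk => hi' k (σ.dir.injective hk)), app_dir, app_of_forall_ne τ a i hi']
      simp only [comp, app_dir]
  · have hj' : ∀ i, σ.dir i ≠ j := fun i hi => hj ⟨i, hi⟩
    rw [app_of_forall_ne (σ.comp τ) a _ (fun k => hj' _), app_of_forall_ne σ _ _ hj']
    simp only [comp, app_of_forall_ne σ _ _ hj']

theorem id_app {n : ℕ} (a : Fin n → Bool) : (FaceMap.id n).app a = a := by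
  funext j
  have h := app_dir (FaceMap.id n) a j
  simpa [FaceMap.id] using h

theorem comp_vertex {m n : ℕ} (σ : FaceMap m n) (a : Fin m → Bool) :
    σ.comp (vertex a) = vertex (σ.app a) := by
  ext i
  · exact i.elim0
  · rfl

end FaceMap

/-! ## Cube complexes -/

/-- A cube complex, i.e. a complex obtained by gluing unit cubes along faces via isometries.
`Cube n` is the set of *parametrised* `n`-cubes, i.e. of characteristic maps `[0,1]^n → X` of
`n`-cubes, an `n`-cube having one such map for each of the `2^n n!` symmetries of `[0,1]^n`.
They can be restricted to faces, and precomposed with symmetries (`face`).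
The axiom `free` says that the characteristic maps are injective on the interiors of cubes.
(Different faces of the same cube may be identified.) -/
structure CubeComplex where
  Cube : ℕ → Type u
  face : ∀ {m n : ℕ}, FaceMap m n → Cube n → Cube m
  face_id : ∀ {n : ℕ} (c : Cube n), face (FaceMap.id n) c = c
  face_comp : ∀ {l m n : ℕ} (σ : FaceMap m n) (τ : FaceMap l m) (c : Cube n),
    face (σ.comp τ) c = face τ (face σ c)
  free : ∀ {n : ℕ} (σ : FaceMap n n) (c : Cube n), face σ c = c → σ = FaceMap.id n

namespace CubeComplex

/-- The vertices of a cube complex. -/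
abbrev Vert (X : CubeComplex.{u}) : Type u := X.Cube 0

/-- The oriented edges of a cube complex. -/
abbrev Edge (X : CubeComplex.{u}) : Type u := X.Cube 1

/-- The vertex of the parametrised cube `c` with coordinates `a`. -/
def vertex (X : CubeComplex.{u}) {n : ℕ} (c : X.Cube n) (a : Fin n → Bool) : X.Vert :=
  X.face (FaceMap.vertex a) c

/-- The vertex of the parametrised cube `c` at the origin. -/
def origin (X : CubeComplex.{u}) {n : ℕ} (c : X.Cube n) : X.Vert :=
  X.vertex c fun _ => false

/-- The oriented edge of the parametrised cube `c` from its vertex `a` in the direction `i`. -/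
def edge (X : CubeComplex.{u}) {n : ℕ} (c : X.Cube n) (i : Fin n) (a : Fin n → Bool) : X.Edge :=
  X.face (FaceMap.edge i a) c

/-- The oriented edge of the parametrised cube `c` from the origin in the direction `i`. -/
def axis (X : CubeComplex.{u}) {n : ℕ} (c : X.Cube n) (i : Fin n) : X.Edge :=
  X.edge c i fun _ => false

/-- Start vertex of an oriented edge. -/
def source (X : CubeComplex.{u}) (e : X.Edge) : X.Vert := X.vertex e fun _ => false

/-- End vertex of an oriented edge. -/
def target (X : CubeComplex.{u}) (e : X.Edge) : X.Vert := X.vertex e fun _ => true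

/-- The same edge with the opposite orientation. -/
def rev (X : CubeComplex.{u}) (e : X.Edge) : X.Edge := X.edge e 0 fun _ => true

theorem vertex_face (X : CubeComplex.{u}) {m n : ℕ} (σ : FaceMap m n) (c : X.Cube n)
    (a : Fin m → Bool) : X.vertex (X.face σ c) a = X.vertex c (σ.app a) := by
  rw [vertex, vertex, ← FaceMap.comp_vertex, face_comp]

theorem source_rev (X : CubeComplex.{u}) (e : X.Edge) : X.source (X.rev e) = X.target e := by
  rw [source, rev, edge, vertex_face]
  congr 1
  funext j
  obtain rfl := Subsingleton.elim j ((FaceMap.edge (0 : Fin 1) fun _ => true).dir 0)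
  rw [FaceMap.app_dir]; rfl

theorem target_rev (X : CubeComplex.{u}) (e : X.Edge) : X.target (X.rev e) = X.source e := by
  rw [target, rev, edge, vertex_face]
  congr 1
  funext j
  obtain rfl := Subsingleton.elim j ((FaceMap.edge (0 : Fin 1) fun _ => true).dir 0)
  rw [FaceMap.app_dir]; rfl

theorem rev_rev (X : CubeComplex.{u}) (e : X.Edge) : X.rev (X.rev e) = e := by
  rw [rev, rev, edge, edge, ← face_comp]
  convert X.face_id e using 2
  ext j
  · simp
  · obtain rfl := Subsingleton.elim j ((FaceMap.edge (0 : Fin 1) fun _ => true).dir 0)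
    simp only [FaceMap.comp, FaceMap.app_dir]; rfl

/-! ## Edge paths and connectedness -/

/-- The 1-skeleton of `X`; paths in this quiver are the edge paths of `X`. -/
instance (X : CubeComplex.{u}) : Quiver.{u, u} (X.Cube 0) where
  Hom v w := {e : X.Edge // X.source e = v ∧ X.target e = w}

instance (X : CubeComplex.{u}) : Quiver.HasInvolutiveReverse (X.Cube 0) where
  reverse' e := ⟨X.rev e.1, (X.source_rev _).trans e.2.2, (X.target_rev _).trans e.2.1⟩
  inv' e := Subtype.ext (X.rev_rev e.1)

/-- Edge paths. -/
abbrev EdgePath (X : CubeComplex.{u}) (v w : X.Vert) : Type u := Quiver.Path v w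

/-- `X` is connected (in particular nonempty). -/
def Connected (X : CubeComplex.{u}) : Prop :=
  Nonempty X.Vert ∧ ∀ v w : X.Vert, Nonempty (X.EdgePath v w)

/-- `X` has only finitely many cubes. -/
def IsFinite (X : CubeComplex.{u}) : Prop := Finite (Σ n, X.Cube n)

/-- Every vertex of `X` lies in only finitely many cubes. -/
def LocallyFinite (X : CubeComplex.{u}) : Prop :=
  ∀ v : X.Vert, {c : Σ n, X.Cube n | X.origin c.2 = v}.Finite

/-! ## Nonpositive curvature

The simplices of dimension `n - 1` of the link of a vertex `v`, with an ordering of their vertices,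
are the parametrised `n`-cubes `c` with origin `v`; the vertices of this simplex are the edges
`axis c i`. -/

/-- The link of each vertex is a flag simplicial complex. -/
structure NonpositivelyCurved (X : CubeComplex.{u}) : Prop where
  /-- The vertices of each simplex of a link are pairwise distinct. -/
  axis_injective : ∀ {n : ℕ} (c : X.Cube n), Function.Injective (X.axis c)
  /-- A simplex of a link is determined by its vertices. -/
  eq_of_axis_eq : ∀ {n : ℕ} (c c' : X.Cube n), X.origin c = X.origin c' →
    X.axis c = X.axis c' → c = c'
  /-- Finitely many pairwise adjacent vertices of a link span a simplex. -/
  flag : ∀ (v : X.Vert) {n : ℕ} (e : Fin n → X.Edge), Function.Injective e →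
    (∀ i, X.source (e i) = v) →
    (∀ i j, i ≠ j → ∃ s : X.Cube 2, X.axis s 0 = e i ∧ X.axis s 1 = e j) →
    ∃ c : X.Cube n, X.origin c = v ∧ X.axis c = e

/-! ## Combinatorial maps, local isometries, covers -/

/-- Combinatorial maps: they send each cube isometrically onto a cube. -/
structure Map (Y X : CubeComplex.{u}) where
  toFun : ∀ {n : ℕ}, Y.Cube n → X.Cube n
  map_face : ∀ {m n : ℕ} (σ : FaceMap m n) (c : Y.Cube n),
    toFun (Y.face σ c) = X.face σ (toFun c)

instance (Y X : CubeComplex.{u}) : CoeFun (Map Y X) fun _ => ∀ {n : ℕ}, Y.Cube n → X.Cube n :=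
  ⟨fun f {_} c => f.toFun c⟩

/-- The effect of a combinatorial map on the 1-skeleton. -/
def Map.skel {Y X : CubeComplex.{u}} (f : Map Y X) : Y.Cube 0 ⥤q X.Cube 0 where
  obj v := f v
  map e := ⟨f e.1, (f.map_face _ _).symm.trans (congrArg (fun v => f v) e.2.1),
    (f.map_face _ _).symm.trans (congrArg (fun v => f v) e.2.2)⟩

/-- The image of an edge path under a combinatorial map. -/
def Map.path {Y X : CubeComplex.{u}} (f : Map Y X) {v w : Y.Vert} (p : Y.EdgePath v w) :
    X.EdgePath (f v) (f w) :=
  f.skel.mapPath p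

/-- Local isometries: the induced maps on links of vertices are embeddings with full image. -/
structure Map.IsLocalIsometry {Y X : CubeComplex.{u}} (f : Map Y X) : Prop where
  /-- The maps on links are injective. -/
  link_injective : ∀ {n : ℕ} (c c' : Y.Cube n), Y.origin c = Y.origin c' → f c = f c' → c = c'
  /-- The images of links are full: a simplex of the link of `f y` whose vertices are in the image
  of the link of `y` is itself in that image. -/
  link_full : ∀ (y : Y.Vert) {n : ℕ} (c : X.Cube n), X.origin c = f y →
    (∀ i, ∃ e : Y.Edge, Y.source e = y ∧ f e = X.axis c i) →
    ∃ c' : Y.Cube n, Y.origin c' = y ∧ f c' = c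

/-- Covers, by a connected cube complex: the induced maps on links of vertices are isomorphisms. -/
structure Map.IsCover {Y X : CubeComplex.{u}} (f : Map Y X) : Prop where
  connected : Y.Connected
  surjective : ∀ x : X.Vert, ∃ y : Y.Vert, f y = x
  lift : ∀ (y : Y.Vert) {n : ℕ} (c : X.Cube n), X.origin c = f y →
    ∃! c' : Y.Cube n, Y.origin c' = y ∧ f c' = c

/-- Finite-sheeted covers. -/
def Map.IsFiniteCover {Y X : CubeComplex.{u}} (f : Map Y X) : Prop :=
  f.IsCover ∧ ∀ x : X.Vert, {y : Y.Vert | f y = x}.Finite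

/-! ## Subcomplexes -/

/-- A subcomplex: a set of cubes that is closed under passing to faces (and under
reparametrisation). -/
structure Subcomplex (X : CubeComplex.{u}) where
  cubes : ∀ n : ℕ, Set (X.Cube n)
  face_mem : ∀ {m n : ℕ} (σ : FaceMap m n) (c : X.Cube n), c ∈ cubes n → X.face σ c ∈ cubes m

/-- A subcomplex as a cube complex. -/
def Subcomplex.toCubeComplex {X : CubeComplex.{u}} (Y : X.Subcomplex) : CubeComplex.{u} where
  Cube n := Y.cubes n
  face σ c := ⟨X.face σ c.1, Y.face_mem σ c.1 c.2⟩
  face_id c := Subtype.ext (X.face_id c.1)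
  face_comp σ τ c := Subtype.ext (X.face_comp σ τ c.1)
  free σ c h := X.free σ c.1 (congrArg Subtype.val h)

/-- The inclusion of a subcomplex. -/
def Subcomplex.incl {X : CubeComplex.{u}} (Y : X.Subcomplex) : Map Y.toCubeComplex X where
  toFun c := c.1
  map_face _ _ := rfl

/-- Locally convex connected subcomplexes. In a CAT(0) cube complex these are called convex
subcomplexes. -/
def Subcomplex.IsConvex {X : CubeComplex.{u}} (Y : X.Subcomplex) : Prop :=
  Y.toCubeComplex.Connected ∧ Y.incl.IsLocalIsometry

/-! ## Salvetti complexes and special cube complexes -/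

/-- The Salvetti complex of the right-angled Artin group of a simplicial graph `Γ`. It has one
vertex, one oriented edge for each vertex of `Γ`, and one `n`-cube for each `n`-clique of `Γ`, with
opposite faces glued. A parametrised `n`-cube is an ordered `n`-clique (`label`) together with, for
each direction of the cube, the information whether the edges in this direction are traversed
backwards (`back`). -/
@[ext]
structure SalvettiCube {V : Type u} (Γ : SimpleGraph V) (n : ℕ) where
  label : Fin n → V
  adj : ∀ i j, i ≠ j → Γ.Adj (label i) (label j)
  back : Fin n → Bool

/-- The Salvetti complex, see `SalvettiCube`. -/
noncomputable def salvetti {V : Type u} (Γ : SimpleGraph V) : CubeComplex.{u} where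
  Cube n := SalvettiCube Γ n
  face σ c :=
    { label := fun i => c.label (σ.dir i)
      adj := fun _ _ hij => c.adj _ _ (σ.dir.injective.ne hij)
      back := fun i => xor (c.back (σ.dir i)) (σ.base (σ.dir i)) }
  face_id c := by
    ext i
    · rfl
    · simp [FaceMap.id]
  face_comp σ τ c := by
    ext i
    · rfl
    · simp [FaceMap.comp, FaceMap.app_dir]
  free σ c h := by
    have hlab : Function.Injective c.label := fun i j hij => by
      by_contra hne
      exact (c.adj i j hne).ne hij
    have hdir : ∀ i, σ.dir i = i := fun i =>
      hlab (congrFun (congrArg SalvettiCube.label h) i)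
    ext i
    · simp [FaceMap.id, hdir]
    · have := congrFun (congrArg SalvettiCube.back h) i
      simp only [hdir] at this
      change σ.base i = false
      revert this
      cases c.back i <;> cases σ.base i <;> simp

/-- `X` admits a local isometry to the Salvetti complex of some right-angled Artin group. -/
def Special (X : CubeComplex.{u}) : Prop :=
  ∃ (V : Type u) (Γ : SimpleGraph V) (f : Map X (salvetti Γ)), f.IsLocalIsometry

/-- `X` has a finite-sheeted special cover. -/
def VirtuallySpecial (X : CubeComplex.{u}) : Prop :=
  ∃ (X' : CubeComplex.{u}) (f : Map X' X), f.IsFiniteCover ∧ X'.Special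

/-! ## Homotopy classes of edge paths and the fundamental group -/

/-- Homotopy rel endpoints of edge paths: the congruence generated by `e ē ≃ 1` for each oriented
edge `e` and by `a b ≃ c d` whenever `a b` and `c d` are the two paths of length two from the
vertex `(0,0)` to the vertex `(1,1)` of a square. -/
inductive Homotopic (X : CubeComplex.{u}) : ∀ {v w : X.Vert}, X.EdgePath v w → X.EdgePath v w → Prop
  | refl {v w : X.Vert} (p : X.EdgePath v w) : Homotopic X p p
  | symm {v w : X.Vert} {p q : X.EdgePath v w} : Homotopic X p q → Homotopic X q p
  | trans {v w : X.Vert} {p q r : X.EdgePath v w} :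
      Homotopic X p q → Homotopic X q r → Homotopic X p r
  | comp {u v w : X.Vert} {p p' : X.EdgePath u v} {q q' : X.EdgePath v w} :
      Homotopic X p p' → Homotopic X q q' → Homotopic X (p.comp q) (p'.comp q')
  | backtrack {v w : X.Vert} (e : v ⟶ w) :
      Homotopic X (e.toPath.comp (Quiver.reverse e).toPath) Quiver.Path.nil
  | square (s : X.Cube 2) {v x y w : X.Vert} (a : v ⟶ x) (b : x ⟶ w) (c : v ⟶ y) (d : y ⟶ w) :
      a.1 = X.edge s 0 ![false, false] → b.1 = X.edge s 1 ![true, false] →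
      c.1 = X.edge s 1 ![false, false] → d.1 = X.edge s 0 ![false, true] →
      Homotopic X (a.toPath.comp b.toPath) (c.toPath.comp d.toPath)

/-- The setoid of homotopy rel endpoints. -/
def homotopySetoid (X : CubeComplex.{u}) (v w : X.Vert) : Setoid (X.EdgePath v w) where
  r := X.Homotopic
  iseqv := ⟨.refl, .symm, .trans⟩

/-- Homotopy classes rel endpoints of edge paths from `v` to `w`. -/
def PathClass (X : CubeComplex.{u}) (v w : X.Vert) : Type u := Quotient (X.homotopySetoid v w)

/-- The homotopy class of an edge path. -/
def PathClass.mk {X : CubeComplex.{u}} {v w : X.Vert} (p : X.EdgePath v w) : X.PathClass v w :=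
  Quotient.mk _ p

/-- Concatenation of homotopy classes. -/
def PathClass.comp {X : CubeComplex.{u}} {v w z : X.Vert} :
    X.PathClass v w → X.PathClass w z → X.PathClass v z :=
  Quotient.map₂ Quiver.Path.comp fun _ _ hp _ _ hq => Homotopic.comp hp hq

theorem PathClass.comp_assoc {X : CubeComplex.{u}} {v w y z : X.Vert} (a : X.PathClass v w)
    (b : X.PathClass w y) (c : X.PathClass y z) : (a.comp b).comp c = a.comp (b.comp c) := by
  induction a using Quotient.inductionOn
  induction b using Quotient.inductionOn
  induction c using Quotient.inductionOn
  exact congrArg (Quotient.mk _) (Quiver.Path.comp_assoc _ _ _)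

theorem PathClass.nil_comp {X : CubeComplex.{u}} {v w : X.Vert} (a : X.PathClass v w) :
    PathClass.comp (PathClass.mk Quiver.Path.nil) a = a := by
  induction a using Quotient.inductionOn
  exact congrArg (Quotient.mk _) (Quiver.Path.nil_comp _)

/-- A path followed by its reverse is null-homotopic. -/
theorem Homotopic.comp_reverse {X : CubeComplex.{u}} {v w : X.Vert} (p : X.EdgePath v w) :
    X.Homotopic (p.comp p.reverse) Quiver.Path.nil := by
  induction p with
  | nil => exact .refl _
  | cons p e ih =>
    have h : (p.cons e).comp (p.cons e).reverse =
        p.comp ((e.toPath.comp (Quiver.reverse e).toPath).comp p.reverse) := by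
      change (p.comp e.toPath).comp ((Quiver.reverse e).toPath.comp p.reverse) = _
      simp only [Quiver.Path.comp_assoc]
    rw [h]
    have h2 := Homotopic.comp (Homotopic.refl p)
      (Homotopic.comp (Homotopic.backtrack e) (Homotopic.refl p.reverse))
    rw [Quiver.Path.nil_comp] at h2
    exact h2.trans ih

/-- Reversal respects homotopy. -/
theorem Homotopic.reverse {X : CubeComplex.{u}} {v w : X.Vert} {p q : X.EdgePath v w}
    (h : X.Homotopic p q) : X.Homotopic p.reverse q.reverse := by
  have h1 : X.Homotopic (p.reverse.comp (q.comp q.reverse)) p.reverse := by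
    simpa using Homotopic.comp (Homotopic.refl p.reverse) (Homotopic.comp_reverse q)
  have h2 : X.Homotopic ((p.reverse.comp p).comp q.reverse) q.reverse := by
    have h3 := Homotopic.comp_reverse p.reverse
    rw [Quiver.Path.reverse_reverse] at h3
    simpa using Homotopic.comp h3 (Homotopic.refl q.reverse)
  have h3 : X.Homotopic ((p.reverse.comp p).comp q.reverse) (p.reverse.comp (q.comp q.reverse)) := by
    rw [← Quiver.Path.comp_assoc]
    exact Homotopic.comp (Homotopic.comp (.refl _) h) (.refl _)
  exact (h1.symm.trans h3.symm).trans h2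

/-- The fundamental group `π₁(X, x)`: homotopy classes of closed edge paths based at `x`. -/
abbrev Pi1 (X : CubeComplex.{u}) (x : X.Vert) : Type u := X.PathClass x x

/-- Multiplication in the fundamental group is concatenation. -/
instance (X : CubeComplex.{u}) (x : X.Vert) : Group (X.PathClass x x) where
  mul a b := a.comp b
  one := PathClass.mk Quiver.Path.nil
  inv := Quotient.map Quiver.Path.reverse fun _ _ h => Homotopic.reverse h
  mul_assoc := PathClass.comp_assoc
  one_mul a := PathClass.nil_comp a
  mul_one a := by
    induction a using Quotient.inductionOn
    exact congrArg (Quotient.mk _) (Quiver.Path.comp_nil _)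
  inv_mul_cancel a := by
    induction a using Quotient.inductionOn with | _ p =>
    have h := Homotopic.comp_reverse p.reverse
    rw [Quiver.Path.reverse_reverse] at h
    exact Quotient.sound h

/-- An edge path is null-homotopic if it is closed and homotopic rel endpoints to a constant path;
a closed edge path that is not null-homotopic is called essential. -/
def NullHomotopic {X : CubeComplex.{u}} {v w : X.Vert} (p : X.EdgePath v w) : Prop :=
  ∃ h : w = v, X.Homotopic (p.cast rfl h) Quiver.Path.nil

/-! ## The universal cover and the action of the fundamental group -/

/-- The vertices of the universal cover: homotopy classes of edge paths that start at the base
vertex `x`, together with their end vertex. -/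
abbrev UVert (X : CubeComplex.{u}) (x : X.Vert) : Type u := Σ v : X.Vert, X.PathClass x v

/-- The class `Q` is obtained from the class `P` by appending the oriented edge `e`. -/
def UVert.Step {X : CubeComplex.{u}} {x : X.Vert} (P : X.UVert x) (e : X.Edge) (Q : X.UVert x) :
    Prop :=
  ∃ f : P.1 ⟶ Q.1, f.1 = e ∧ Q.2 = P.2.comp (PathClass.mk f.toPath)

/-- The parametrised `n`-cubes of the universal cover: a parametrised `n`-cube of `X` together with
a lift of each of its vertices, such that the lifts of adjacent vertices differ by appending the
edge of the cube that joins these vertices. -/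
@[ext]
structure UCube (X : CubeComplex.{u}) (x : X.Vert) (n : ℕ) where
  cube : X.Cube n
  pt : (Fin n → Bool) → X.UVert x
  pt_fst : ∀ a, (pt a).1 = X.vertex cube a
  step : ∀ σ : FaceMap 1 n,
    (pt (σ.app fun _ => false)).Step (X.face σ cube) (pt (σ.app fun _ => true))

/-- The universal cover of `X` with base vertex `x`. -/
noncomputable def universalCover (X : CubeComplex.{u}) (x : X.Vert) : CubeComplex.{u} where
  Cube n := X.UCube x n
  face σ c :=
    { cube := X.face σ c.cube
      pt := fun a => c.pt (σ.app a)
      pt_fst := fun a => by rw [c.pt_fst, vertex_face]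
      step := fun τ => by
        rw [← FaceMap.comp_app, ← FaceMap.comp_app, ← X.face_comp]
        exact c.step _ }
  face_id c := by
    ext1
    · exact X.face_id _
    · funext a
      simp only [FaceMap.id_app]
  face_comp σ τ c := by
    ext1
    · exact X.face_comp _ _ _
    · funext a
      simp only [FaceMap.comp_app]
  free σ c h := X.free σ c.cube (congrArg UCube.cube h)

/-- The fundamental group acts on the universal cover by deck transformations: the class of a loop
`γ` acts by prepending `γ`. -/
instance (X : CubeComplex.{u}) (x : X.Vert) (n : ℕ) :
    MulAction (X.PathClass x x) ((X.universalCover x).Cube n) where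
  smul g c :=
    { cube := c.cube
      pt := fun a => ⟨(c.pt a).1, g.comp (c.pt a).2⟩
      pt_fst := c.pt_fst
      step := fun σ => by
        obtain ⟨f, hf, h⟩ := c.step σ
        exact ⟨f, hf, by rw [h]; exact (PathClass.comp_assoc _ _ _).symm⟩ }
  one_smul c := by
    apply UCube.ext
    · rfl
    · funext a
      exact Sigma.ext rfl (heq_of_eq (PathClass.nil_comp _))
  mul_smul g h c := by
    apply UCube.ext
    · rfl
    · funext a
      exact Sigma.ext rfl (heq_of_eq (PathClass.comp_assoc _ _ _))

/-- A subgroup `K` of the fundamental group is convex-cocompact if it stabilises some convex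
subcomplex of the universal cover and acts cocompactly on it, i.e. with finitely many orbits of
cubes. -/
def ConvexCocompact {X : CubeComplex.{u}} {x : X.Vert} (K : Subgroup (X.Pi1 x)) : Prop :=
  ∃ Y : (X.universalCover x).Subcomplex, Y.IsConvex ∧
    (∀ k ∈ K, ∀ (n : ℕ), ∀ c ∈ Y.cubes n, k • c ∈ Y.cubes n) ∧
    ∃ F : Set (Σ n, (X.universalCover x).Cube n), F.Finite ∧
      ∀ (n : ℕ), ∀ c ∈ Y.cubes n, ∃ k ∈ K, ∃ d : (X.universalCover x).Cube n,
        ⟨n, d⟩ ∈ F ∧ c = k • d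

/-! ## Routes -/

/-- A route of length `n` in `X`: vertices `y_0, …, y_n` of `X` and local isometries
`φ_i : Y_i → X` of (connected) nonpositively curved cube complexes, where `Y_i` has two marked
vertices that are sent to `y_{i-1}` and `y_i`. (The index `i` is shifted by one.) -/
structure Route (X : CubeComplex.{u}) (n : ℕ) where
  vert : Fin (n + 1) → X.Vert
  Y : Fin n → CubeComplex.{u}
  connected : ∀ i, (Y i).Connected
  npc : ∀ i, (Y i).NonpositivelyCurved
  φ : ∀ i, Map (Y i) X
  isom : ∀ i, (φ i).IsLocalIsometry
  start : ∀ i, (Y i).Vert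
  fin : ∀ i, (Y i).Vert
  map_start : ∀ i, φ i (start i) = vert i.castSucc
  map_fin : ∀ i, φ i (fin i) = vert i.succ

/-- The route is closed: its initial and terminal vertices agree. -/
def Route.Closed {X : CubeComplex.{u}} {n : ℕ} (R : X.Route n) : Prop :=
  R.vert 0 = R.vert (Fin.last n)

/-- The route is finite: all its complexes are finite. -/
def Route.IsFinite {X : CubeComplex.{u}} {n : ℕ} (R : X.Route n) : Prop :=
  ∀ i, (R.Y i).IsFinite

/-- A segmented path of length `n` whose segments run between consecutive vertices of the
sequence `v`. -/
abbrev SegmentedPath (X : CubeComplex.{u}) {n : ℕ} (v : Fin (n + 1) → X.Vert) : Type u :=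
  ∀ i : Fin n, X.EdgePath (v i.castSucc) (v i.succ)

/-- The realization of a segmented path: the concatenation of its segments. -/
def SegmentedPath.realization {X : CubeComplex.{u}} : ∀ {n : ℕ} {v : Fin (n + 1) → X.Vert},
    X.SegmentedPath v → X.EdgePath (v 0) (v (Fin.last n))
  | 0, _, _ => Quiver.Path.nil
  | n + 1, v, δ =>
    Quiver.Path.comp (realization (v := fun i : Fin (n + 1) => v i.castSucc) fun i => δ i.castSucc)
      (δ (Fin.last n))

/-- The segmented path `δ` is a path along the route: each segment lifts to the corresponding
complex of the route, as a path between the two marked vertices. -/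
def Route.IsAlong {X : CubeComplex.{u}} {n : ℕ} (R : X.Route n) (δ : X.SegmentedPath R.vert) :
    Prop :=
  ∀ i, ∃ η : (R.Y i).EdgePath (R.start i) (R.fin i),
    ((R.φ i).path η).cast (R.map_start i) (R.map_fin i) = δ i

/-- A closed route is essential if every path along it is essential. -/
def Route.Essential {X : CubeComplex.{u}} {n : ℕ} (R : X.Route n) : Prop :=
  ∀ δ : X.SegmentedPath R.vert, R.IsAlong δ → ¬ NullHomotopic (SegmentedPath.realization δ)

/-- `φ' : Y' → X'` is an elevation of the local isometry `φ : Y → X` to the cover `μ : X' → X`, by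
means of the cover `ν : Y' → Y`: we have `φ ν = μ φ'`, and a path in `Y'` closes up if and only if
its projections to `Y` and `X'` both close up. -/
structure IsElevation {X X' Y Y' : CubeComplex.{u}} (φ : Map Y X) (μ : Map X' X) (φ' : Map Y' X')
    (ν : Map Y' Y) : Prop where
  cover : ν.IsCover
  comm : ∀ {n : ℕ} (c : Y'.Cube n), φ (ν c) = μ (φ' c)
  closes_iff : ∀ {v w : Y'.Vert}, Y'.EdgePath v w → (v = w ↔ ν v = ν w ∧ φ' v = φ' w)

/-- The route `R'` in `X'` is an elevation of the route `R` in `X` to the cover `μ : X' → X`. -/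
def Route.IsElevation {X X' : CubeComplex.{u}} {n : ℕ} (R : X.Route n) (μ : Map X' X)
    (R' : X'.Route n) : Prop :=
  (∀ j, μ (R'.vert j) = R.vert j) ∧
  ∀ i, ∃ ν : Map (R'.Y i) (R.Y i), CubeComplex.IsElevation (R.φ i) μ (R'.φ i) ν ∧
    ν (R'.start i) = R.start i ∧ ν (R'.fin i) = R.fin i

end CubeComplex

/-! ## Separability -/

/-- A subset `S` of a group `G` is separable if every element outside `S` can be separated from `S`
in a finite quotient. -/
def IsSeparableSubset {G : Type u} [Group G] (S : Set G) : Prop :=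
  ∀ g : G, g ∉ S → ∃ (F : Type u) (_ : Group F) (_ : Finite F) (f : G →* F), f g ∉ f '' S

/-! A word lists the edges of an edge path. In a nonpositively curved complex, each homotopy class
of edge paths has a reduced word, which is unique up to shuffling edges across squares
(`Homotopic.shuf`). Local isometries preserve reduced words and lift shuffles, so they are
injective on universal covers (`Map.IsLocalIsometry.uMap_injective`), and a local isometry from a
connected complex to a simply connected one is an embedding
(`Map.IsLocalIsometry.injective_vert`). Hence convex subcomplexes of the universal cover contain
the reduced paths between their vertices.

The assumption that `X` is locally finite or virtually special enters through
`LocallyFiniteParallel`: finitely many edges are contained in a set `E` of edges that is closed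
under parallelism and has finitely many edges at each vertex. If `Y` is a convex subcomplex of the
universal cover, the vertices `z` that are joined to `Y` by edges of `E`, and for which the number
of edges that lead from `z` towards `Y` is the distance from `z` to `Y`, are the vertices of the
cubes with edges in `E` that meet `Y`. They span a convex subcomplex (`exists_thickening`).
Iterating this, a convex-cocompact subgroup acts cocompactly on a convex subcomplex that contains
any given finite set of vertices (`ConvexCocompact.exists_containing`).

Given this, products of subgroups and routes correspond to each other. From convex-cocompact
subgroups `K i` and an element `g`, one gets a finite route by dividing suitable convex
subcomplexes by the `K i`; the classes of the paths along it form the set `K₀ ⋯ K_m g⁻¹`. Closed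
elevations of this route are obtained from components of fibre products
(`exists_closed_elevation`), which gives `separable_of_route_separation`. Conversely, the
fundamental groups of the complexes of a finite route, conjugated by paths along the route, are
convex-cocompact subgroups of the fundamental group of `X`
(`Map.IsLocalIsometry.convexCocompact`), and a finite quotient in which their product is separated
from the element given by a path along the route yields the required cover
(`route_separation_of_separable`). -/

/-! ### Faces and squares -/

namespace FaceMap

theorem app_eq_xor {n : ℕ} (σ : FaceMap n n) (h : σ.dir = Function.Embedding.refl _)
    (a : Fin n → Bool) : σ.app a = fun j => xor (σ.base j) (a j) := by
  funext j
  have := app_dir σ a j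
  rw [h] at this
  exact this

theorem app_const_false {m n : ℕ} (σ : FaceMap m n) : (σ.app fun _ => false) = σ.base := by
  funext j
  by_cases hj : ∃ i, σ.dir i = j
  · obtain ⟨i, rfl⟩ := hj
    simp [app_dir]
  · exact app_of_forall_ne σ _ _ fun i hi => hj ⟨i, hi⟩

theorem edge_app_false {n : ℕ} (i : Fin n) (a : Fin n → Bool) :
    ((edge i a).app fun _ => false) = a :=
  app_const_false _

theorem edge_app_true {n : ℕ} (i : Fin n) (a : Fin n → Bool) :
    ((edge i a).app fun _ => true) = Function.update a i (!a i) := by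
  funext j
  by_cases hj : j = i
  · subst hj
    rw [Function.update_self]
    exact (app_dir (edge j a) (fun _ => true) 0).trans (Bool.xor_true _)
  · rw [app_of_forall_ne _ _ _ fun _ h => hj h.symm, Function.update_of_ne hj]
    rfl

theorem comp_edge {m n : ℕ} (σ : FaceMap m n) (i : Fin m) (a : Fin m → Bool) :
    σ.comp (edge i a) = edge (σ.dir i) (σ.app a) := by
  ext k
  · rfl
  · rfl

/-- A one-dimensional face is determined by its direction and its starting point. -/
theorem eq_edge {n : ℕ} (σ : FaceMap 1 n) : σ = edge (σ.dir 0) σ.base := by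
  ext k
  · rw [Subsingleton.elim k 0]; rfl
  · rfl

/-- The inclusion of the two-dimensional face through `a` in the directions `i` and `j`. -/
def square {n : ℕ} (i j : Fin n) (hij : i ≠ j) (a : Fin n → Bool) : FaceMap 2 n :=
  ⟨⟨![i, j], by
    intro k l h
    fin_cases k <;> fin_cases l <;> simp_all⟩, a⟩

theorem square_app {n : ℕ} (i j : Fin n) (hij : i ≠ j) (a : Fin n → Bool) (b : Fin 2 → Bool) :
    (square i j hij a).app b =
      Function.update (Function.update a i (xor (a i) (b 0))) j (xor (a j) (b 1)) := by
  funext k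
  by_cases hj : k = j
  · subst hj
    rw [Function.update_self]
    exact app_dir (square i k hij a) b 1
  · rw [Function.update_of_ne hj]
    by_cases hi : k = i
    · subst hi
      rw [Function.update_self]
      exact app_dir (square k j hij a) b 0
    · rw [Function.update_of_ne hi]
      refine app_of_forall_ne _ _ _ fun l => ?_
      fin_cases l
      · exact fun h => hi h.symm
      · exact fun h => hj h.symm

end FaceMap

namespace CubeComplex

variable {X Y Z : CubeComplex.{u}}

theorem edge_face {m n : ℕ} (σ : FaceMap m n) (c : X.Cube n) (i : Fin m) (a : Fin m → Bool) :
    X.edge (X.face σ c) i a = X.edge c (σ.dir i) (σ.app a) := by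
  rw [edge, edge, ← X.face_comp, FaceMap.comp_edge]

theorem edge_zero_false (e : X.Edge) : X.edge e 0 (fun _ => false) = e := by
  rw [edge]
  convert X.face_id e using 2
  ext k
  · rw [Subsingleton.elim k 0]; rfl
  · rfl

theorem rev_edge {n : ℕ} (c : X.Cube n) (i : Fin n) (a : Fin n → Bool) :
    X.rev (X.edge c i a) = X.edge c i (Function.update a i (!a i)) := by
  rw [← FaceMap.edge_app_true]
  exact edge_face (FaceMap.edge i a) c 0 _

theorem source_edge {n : ℕ} (c : X.Cube n) (i : Fin n) (a : Fin n → Bool) :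
    X.source (X.edge c i a) = X.vertex c a := by
  rw [source, edge, vertex_face, FaceMap.edge_app_false]

theorem target_edge {n : ℕ} (c : X.Cube n) (i : Fin n) (a : Fin n → Bool) :
    X.target (X.edge c i a) = X.vertex c (Function.update a i (!a i)) := by
  rw [target, edge, vertex_face, FaceMap.edge_app_true]

theorem vertex_zero (v : X.Vert) (a : Fin 0 → Bool) : X.vertex v a = v := by
  rw [vertex]
  convert X.face_id v using 2
  ext k
  · exact k.elim0
  · exact k.elim0

theorem origin_face {m n : ℕ} (σ : FaceMap m n) (c : X.Cube n) :
    X.origin (X.face σ c) = X.vertex c σ.base := by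
  rw [origin, vertex_face, FaceMap.app_const_false]

/-- `Sq a b c d` says that `a b` and `c d` are the two edge paths of length two joining a corner
of some square to the opposite corner. -/
def Sq (a b c d : X.Edge) : Prop :=
  ∃ s : X.Cube 2, a = X.edge s 0 ![false, false] ∧ b = X.edge s 1 ![true, false] ∧
    c = X.edge s 1 ![false, false] ∧ d = X.edge s 0 ![false, true]

theorem sq_of_cube {n : ℕ} (c : X.Cube n) {i j : Fin n} (hij : i ≠ j) (a : Fin n → Bool) :
    Sq (X.edge c i a) (X.edge c j (Function.update a i (!a i))) (X.edge c j a)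
      (X.edge c i (Function.update a j (!a j))) := by
  refine ⟨X.face (FaceMap.square i j hij a) c, ?_, ?_, ?_, ?_⟩ <;>
    rw [edge_face, FaceMap.square_app]
  · simp; rfl
  · have h : Function.update (Function.update a i (!a i)) j (a j) =
        Function.update a i (!a i) := by
      rw [Function.update_eq_self_iff, Function.update_of_ne hij.symm]
    simp [h]; rfl
  · simp; rfl
  · simp; rfl

theorem Sq.swap {a b c d : X.Edge} (h : Sq a b c d) : Sq c d a b := by
  obtain ⟨s, rfl, rfl, rfl, rfl⟩ := h
  convert sq_of_cube s (i := 1) (j := 0) (by decide) ![false, false] using 2 <;>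
    · funext k; fin_cases k <;> rfl

theorem Sq.rot {a b c d : X.Edge} (h : Sq a b c d) : Sq (X.rev a) c b (X.rev d) := by
  obtain ⟨s, rfl, rfl, rfl, rfl⟩ := h
  rw [rev_edge, rev_edge]
  convert sq_of_cube s (i := 0) (j := 1) (by decide) ![true, false] using 2 <;>
    · funext k; fin_cases k <;> rfl

/-- Rotation about the second corner. -/
theorem Sq.rot' {a b c d : X.Edge} (h : Sq a b c d) : Sq d (X.rev b) (X.rev c) a :=
  h.swap.rot.swap

/-- Both paths around a square can be reversed. -/
theorem Sq.reverse {a b c d : X.Edge} (h : Sq a b c d) :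
    Sq (X.rev b) (X.rev a) (X.rev d) (X.rev c) := by
  have h1 := h.rot.swap.rot
  exact h1

theorem Sq.source_eq {a b c d : X.Edge} (h : Sq a b c d) : X.source a = X.source c := by
  obtain ⟨s, rfl, rfl, rfl, rfl⟩ := h
  rw [source_edge, source_edge]

theorem Sq.target_left {a b c d : X.Edge} (h : Sq a b c d) : X.target a = X.source b := by
  have := h.rot.source_eq
  rwa [source_rev] at this

theorem Sq.target_right {a b c d : X.Edge} (h : Sq a b c d) : X.target c = X.source d :=
  h.swap.target_left

theorem Sq.target_eq {a b c d : X.Edge} (h : Sq a b c d) : X.target b = X.target d := by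
  have := h.reverse.source_eq
  rwa [source_rev, source_rev] at this

theorem axis_two_zero (s : X.Cube 2) : X.axis s 0 = X.edge s 0 ![false, false] := by
  rw [axis]; congr 1; funext k; fin_cases k <;> rfl

theorem axis_two_one (s : X.Cube 2) : X.axis s 1 = X.edge s 1 ![false, false] := by
  rw [axis]; congr 1; funext k; fin_cases k <;> rfl

theorem source_axis {n : ℕ} (c : X.Cube n) (i : Fin n) : X.source (X.axis c i) = X.origin c := by
  rw [axis, source_edge]; rfl

theorem NonpositivelyCurved.ne (hX : X.NonpositivelyCurved) {a b c d : X.Edge} (h : Sq a b c d) :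
    a ≠ c := by
  obtain ⟨s, rfl, rfl, rfl, rfl⟩ := h
  rw [← axis_two_zero, ← axis_two_one]
  exact fun h => absurd (hX.axis_injective s h) (by decide)

/-- A square is determined by the two edges at a corner. -/
theorem NonpositivelyCurved.unique (hX : X.NonpositivelyCurved) {a b c d b' d' : X.Edge}
    (h : Sq a b c d) (h' : Sq a b' c d') : b = b' ∧ d = d' := by
  obtain ⟨s, rfl, rfl, rfl, rfl⟩ := h
  obtain ⟨t, h1, rfl, h2, rfl⟩ := h'
  have hst : s = t := by
    apply hX.eq_of_axis_eq
    · rw [← source_axis s 0, ← source_axis t 0, axis_two_zero, axis_two_zero, h1]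
    · funext i
      fin_cases i
      · simpa [axis_two_zero] using h1
      · simpa [axis_two_one] using h2
  subst hst
  exact ⟨rfl, rfl⟩

/-- A square is determined by two consecutive edges of its boundary. -/
theorem NonpositivelyCurved.unique_left (hX : X.NonpositivelyCurved) {a b c d c' d' : X.Edge}
    (h : Sq a b c d) (h' : Sq a b c' d') : c = c' ∧ d = d' := by
  obtain ⟨h1, h2⟩ := hX.unique h.rot h'.rot
  exact ⟨h1, by rw [← X.rev_rev d, h2, X.rev_rev]⟩

/-- The flag condition for three edges: three squares that pairwise share an edge at a common
corner are contained in a 3-cube, whose other three squares are as stated. -/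
theorem NonpositivelyCurved.cube (hX : X.NonpositivelyCurved) {a b c ab ac ba bc ca cb : X.Edge}
    (h1 : Sq a ba b ab) (h2 : Sq a ca c ac) (h3 : Sq b cb c bc) :
    ∃ h m l : X.Edge, Sq ba h ca m ∧ Sq ab h cb l ∧ Sq ac m bc l := by
  have hab := hX.ne h1
  have hac := hX.ne h2
  have hbc := hX.ne h3
  have key : ∀ {p q r s : X.Edge}, Sq p q r s →
      ∃ s : X.Cube 2, X.axis s 0 = p ∧ X.axis s 1 = r := by
    rintro p q r s ⟨t, rfl, rfl, rfl, rfl⟩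
    exact ⟨t, axis_two_zero t, axis_two_one t⟩
  obtain ⟨t, -, ht⟩ := hX.flag (X.source a) (n := 3) ![a, b, c]
    (by
      intro i j h
      fin_cases i <;> fin_cases j <;> simp_all)
    (by
      intro i
      fin_cases i
      · rfl
      · exact h1.source_eq.symm
      · exact h2.source_eq.symm)
    (by
      intro i j hij
      fin_cases i <;> fin_cases j <;>
        first
        | exact absurd rfl hij
        | exact key h1
        | exact key h2
        | exact key h3
        | exact key h1.swap
        | exact key h2.swap
        | exact key h3.swap)
  have ea : a = X.edge t 0 ![false, false, false] := by
    rw [show a = X.axis t 0 by rw [ht]; rfl, axis]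
    congr 1; funext k; fin_cases k <;> rfl
  have eb : b = X.edge t 1 ![false, false, false] := by
    rw [show b = X.axis t 1 by rw [ht]; rfl, axis]
    congr 1; funext k; fin_cases k <;> rfl
  have ec : c = X.edge t 2 ![false, false, false] := by
    rw [show c = X.axis t 2 by rw [ht]; rfl, axis]
    congr 1; funext k; fin_cases k <;> rfl
  have upd : ∀ (i : Fin 3) (x y z : Bool), Function.update ![x, y, z] i (!(![x, y, z] i)) =
      ![if i = 0 then !x else x, if i = 1 then !y else y, if i = 2 then !z else z] := by
    decide
  have s1 := sq_of_cube t (i := 0) (j := 1) (by decide) ![false, false, false]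
  have s2 := sq_of_cube t (i := 0) (j := 2) (by decide) ![false, false, false]
  have s3 := sq_of_cube t (i := 1) (j := 2) (by decide) ![false, false, false]
  have s4 := sq_of_cube t (i := 1) (j := 2) (by decide) ![true, false, false]
  have s5 := sq_of_cube t (i := 0) (j := 2) (by decide) ![false, true, false]
  have s6 := sq_of_cube t (i := 0) (j := 1) (by decide) ![false, false, true]
  rw [upd, upd] at s1 s2 s3 s4 s5 s6
  simp only [Fin.isValue, reduceIte, Fin.reduceEq, Bool.not_false, Bool.not_true]
    at s1 s2 s3 s4 s5 s6
  rw [← ea, ← eb] at s1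
  rw [← ea, ← ec] at s2
  rw [← eb, ← ec] at s3
  obtain ⟨rfl, rfl⟩ := hX.unique h1 s1
  obtain ⟨rfl, rfl⟩ := hX.unique h2 s2
  obtain ⟨rfl, rfl⟩ := hX.unique h3 s3
  exact ⟨_, _, _, s4, s5, s6⟩

theorem Map.map_vertex (f : Map Y X) {n : ℕ} (c : Y.Cube n) (a : Fin n → Bool) :
    f (Y.vertex c a) = X.vertex (f c) a :=
  f.map_face _ _

theorem Map.map_origin (f : Map Y X) {n : ℕ} (c : Y.Cube n) : f (Y.origin c) = X.origin (f c) :=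
  f.map_face _ _

theorem Map.map_edge (f : Map Y X) {n : ℕ} (c : Y.Cube n) (i : Fin n) (a : Fin n → Bool) :
    f (Y.edge c i a) = X.edge (f c) i a :=
  f.map_face _ _

theorem Map.map_axis (f : Map Y X) {n : ℕ} (c : Y.Cube n) (i : Fin n) :
    f (Y.axis c i) = X.axis (f c) i :=
  f.map_face _ _

theorem Map.map_source (f : Map Y X) (e : Y.Edge) : f (Y.source e) = X.source (f e) :=
  f.map_face _ _

theorem Map.map_target (f : Map Y X) (e : Y.Edge) : f (Y.target e) = X.target (f e) :=
  f.map_face _ _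

theorem Map.map_rev (f : Map Y X) (e : Y.Edge) : f (Y.rev e) = X.rev (f e) :=
  f.map_face _ _

theorem Map.map_sq (f : Map Y X) {a b c d : Y.Edge} (h : Sq a b c d) :
    Sq (f a) (f b) (f c) (f d) := by
  obtain ⟨s, rfl, rfl, rfl, rfl⟩ := h
  exact ⟨f s, f.map_edge .., f.map_edge .., f.map_edge .., f.map_edge ..⟩

/-! ### Edge words up to shuffling across squares -/

/-- Shuffle equivalence of edge words: the equivalence relation generated by pushing a subword
of length two across a square. A word lists the edges of a path from the *last* edge to the first
one. The two constructors for nonempty words already exhaust the equivalence relation: this is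
transitivity, `Shuf.trans`, and it rests on the flag condition. -/
inductive Shuf : List X.Edge → List X.Edge → Prop
  | nil : Shuf [] []
  | cons (a : X.Edge) {p q : List X.Edge} : Shuf p q → Shuf (a :: p) (a :: q)
  | swap {a b c d : X.Edge} {p q r : List X.Edge} :
      Shuf p (c :: r) → Shuf q (d :: r) → Sq c a d b → Shuf (a :: p) (b :: q)

namespace Shuf

theorem refl : ∀ p : List X.Edge, Shuf p p
  | [] => .nil
  | a :: p => .cons a (refl p)

theorem symm {p q : List X.Edge} (h : Shuf p q) : Shuf q p := by
  induction h with
  | nil => exact .nil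
  | cons a _ ih => exact .cons a ih
  | swap h1 h2 hs => exact .swap h2 h1 hs.swap

theorem length_eq {p q : List X.Edge} (h : Shuf p q) : p.length = q.length := by
  induction h with
  | nil => rfl
  | cons a _ ih => simpa using ih
  | swap h1 h2 hs ih1 ih2 =>
    simp only [List.length_cons] at *
    omega

theorem of_sq {a b c d : X.Edge} (h : Sq a b c d) (r : List X.Edge) :
    Shuf (b :: a :: r) (d :: c :: r) :=
  .swap (refl _) (refl _) h

/-- Two squares through which the same last edge is pushed span a 3-cube together with a third
square, which completes the shuffle. -/
theorem trans (hX : X.NonpositivelyCurved) {p q r : List X.Edge} (h1 : Shuf p q)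
    (h2 : Shuf q r) : Shuf p r := by
  induction hn : p.length using Nat.strong_induction_on generalizing p q r with
  | _ n ih =>
  subst hn
  have ih' : ∀ {p' q' r' : List X.Edge}, p'.length < p.length → Shuf p' q' → Shuf q' r' →
      Shuf p' r' := fun hl h1 h2 => ih _ hl h1 h2 rfl
  clear ih
  cases h1 with
  | nil => exact h2
  | @cons a p1 p2 h1 =>
    cases h2 with
    | @cons _ _ p3 h2 => exact .cons a (ih' (by simp) h1 h2)
    | @swap _ b c d _ p3 s h2 h3 hs => exact .swap (ih' (by simp) h1 h2) h3 hs
  | @swap a b c d p1 p2 r h1 h2 hs =>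
    cases h2 with
    | @cons _ _ p3 h3 =>
      exact .swap h1 (ih' (by simp [← h3.length_eq, h1.length_eq, h2.length_eq]) h3.symm h2) hs
    | @swap _ b' c' d' _ p3 r' h3 h4 hs' =>
      have l1 := h1.length_eq
      have l2 := h2.length_eq
      have l3 := h3.length_eq
      have l4 := h4.length_eq
      simp only [List.length_cons] at l1 l2 l3 l4
      -- Both squares contain the edge `b`; compare the ways in which they are attached to `p2`.
      have h5 : Shuf (d :: r) (c' :: r') := ih' (by simp; omega) h2.symm h3
      cases h5 with
      | @cons _ _ _ h5 =>
        obtain ⟨rfl, rfl⟩ := hX.unique_left hs.swap hs'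
        exact .cons _ (ih' (by simp) h1
          (ih' (by simp; omega) (.cons _ h5) h4.symm))
      | @swap _ _ f g _ _ t h5 h6 hs'' =>
        -- The three squares at the end of `d` span a 3-cube.
        obtain ⟨h, m, l, s1, s2, s3⟩ := hX.cube hs''.reverse hs.swap.rot hs'.rot
        have s1' := s1.rot
        have s2' := s2.rot
        rw [X.rev_rev] at s1' s2'
        have s3' := s3.reverse
        rw [X.rev_rev, X.rev_rev] at s3'
        have l5 := h5.length_eq
        have l6 := h6.length_eq
        simp only [List.length_cons] at l5 l6
        refine .swap (c := X.rev m) (d := X.rev l) (r := h :: t) ?_ ?_ s3'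
        · exact ih' (by simp) h1 (ih' (by simp; omega) (.cons _ h5) (.of_sq s1' t))
        · have e1 : Shuf p3 (d' :: g :: t) := ih' (by simp; omega) h4 (.cons _ h6)
          exact ih' (by simp; omega) e1 (.of_sq s2' t)

theorem nil_left {q : List X.Edge} (h : Shuf [] q) : q = [] := by
  cases h; rfl

theorem tail_of_cons (hX : X.NonpositivelyCurved) {a : X.Edge} {p q : List X.Edge}
    (h : Shuf (a :: p) (a :: q)) : Shuf p q := by
  cases h with
  | cons _ h => exact h
  | swap h1 h2 hs => exact absurd rfl (hX.ne hs.reverse)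

/-- Two different edges in which shuffle equivalent words can end are two sides of a square. -/
theorem exists_sq {a b : X.Edge} {p q : List X.Edge} (h : Shuf (a :: p) (b :: q)) (hab : a ≠ b) :
    ∃ c d r, Shuf p (c :: r) ∧ Shuf q (d :: r) ∧ Sq c a d b := by
  cases h with
  | cons _ h => exact absurd rfl hab
  | swap h1 h2 hs => exact ⟨_, _, _, h1, h2, hs⟩

theorem forall_mem {E : Set X.Edge} (hE : ∀ a b c d, Sq a b c d → a ∈ E → b ∈ E → c ∈ E ∧ d ∈ E)
    {p q : List X.Edge} (h : Shuf p q) : (∀ e ∈ p, e ∈ E) ↔ ∀ e ∈ q, e ∈ E := by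
  induction h with
  | nil => rfl
  | cons a _ ih => simp [ih]
  | @swap a b c d p q r h1 h2 hs ih1 ih2 =>
    simp only [List.forall_mem_cons] at *
    rw [ih1, ih2]
    constructor
    · rintro ⟨ha, hc, hr⟩
      have := hE _ _ _ _ hs hc ha
      exact ⟨this.2, this.1, hr⟩
    · rintro ⟨ha, hc, hr⟩
      have := hE _ _ _ _ hs.swap hc ha
      exact ⟨this.2, this.1, hr⟩

end Shuf

/-! ### Reduced words -/

/-- A word is reduced if no shuffle equivalent word backtracks. -/
def Red : List X.Edge → Prop
  | [] => True
  | e :: p => Red p ∧ ∀ q, ¬ Shuf p (X.rev e :: q)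

theorem Red.shuf_iff (hX : X.NonpositivelyCurved) {p q : List X.Edge} (h : Shuf p q) :
    Red p ↔ Red q := by
  induction h with
  | nil => rfl
  | cons a h ih =>
    exact and_congr ih (forall_congr' fun r => not_congr
      ⟨fun hr => h.symm.trans hX hr, fun hr => h.trans hX hr⟩)
  | @swap a b c d p1 p2 r h1 h2 hs ih1 ih2 =>
    have aux : ∀ {a b c d : X.Edge} {p1 p2 : List X.Edge}, Shuf p1 (c :: r) → Shuf p2 (d :: r) →
        Sq c a d b → (Red p1 ↔ Red (c :: r)) → (Red p2 ↔ Red (d :: r)) → Red (a :: p1) →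
        Red (b :: p2) := by
      rintro a b c d p1 p2 h1 h2 hs ih1 ih2 ⟨hp1, hp2⟩
      have hr := ih1.1 hp1
      have hdr : Red (d :: r) := by
        refine ⟨hr.1, fun t ht => hp2 (b :: t) ?_⟩
        have e1 : Shuf (c :: r) (c :: X.rev d :: t) := .cons _ ht
        exact h1.trans hX (e1.trans hX (.of_sq hs.swap.rot t))
      refine ⟨ih2.2 hdr, fun t ht => ?_⟩
      have e1 : Shuf (d :: r) (X.rev b :: t) := h2.symm.trans hX ht
      have hne : d ≠ X.rev b := by
        have := hX.ne hs.swap.rot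
        intro h
        rw [h, X.rev_rev] at this
        exact this rfl
      obtain ⟨f, g, s, e2, e3, hs'⟩ := e1.exists_sq hne
      have hs'' := hs'.reverse
      rw [X.rev_rev] at hs''
      have e := (hX.unique hs'' hs.swap.rot).1
      apply hr.2 s
      rw [← e, X.rev_rev]
      exact e2
    exact ⟨aux h1 h2 hs ih1 ih2, aux h2 h1 hs.swap ih2 ih1⟩

theorem Red.of_shuf (hX : X.NonpositivelyCurved) {p q : List X.Edge} (h : Shuf p q) (hp : Red p) :
    Red q :=
  (Red.shuf_iff hX h).1 hp

theorem red_singleton (e : X.Edge) : Red [e] :=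
  ⟨trivial, fun q h => by cases h⟩

open Classical in
/-- Right multiplication of a word by an edge, with cancellation if the word can be shuffled so
that it ends in the reverse of that edge. -/
noncomputable def op (e : X.Edge) (r : List X.Edge) : List X.Edge :=
  if h : ∃ q, Shuf r (X.rev e :: q) then h.choose else e :: r

theorem op_of_shuf (hX : X.NonpositivelyCurved) {e : X.Edge} {r q : List X.Edge}
    (h : Shuf r (X.rev e :: q)) : Shuf (op e r) q := by
  have h' : ∃ q, Shuf r (X.rev e :: q) := ⟨q, h⟩
  rw [op, dif_pos h']
  exact (h'.choose_spec.symm.trans hX h).tail_of_cons hX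

theorem op_of_not {e : X.Edge} {r : List X.Edge} (h : ∀ q, ¬ Shuf r (X.rev e :: q)) :
    op e r = e :: r := by
  rw [op, dif_neg]
  exact fun ⟨q, hq⟩ => h q hq

theorem op_congr (hX : X.NonpositivelyCurved) {e : X.Edge} {r r' : List X.Edge} (h : Shuf r r') :
    Shuf (op e r) (op e r') := by
  by_cases hr : ∃ q, Shuf r (X.rev e :: q)
  · obtain ⟨q, hq⟩ := hr
    exact (op_of_shuf hX hq).trans hX (op_of_shuf hX (h.symm.trans hX hq)).symm
  · push Not at hr
    rw [op_of_not hr, op_of_not fun q hq => hr q (h.trans hX hq)]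
    exact .cons _ h

theorem Red.op (hX : X.NonpositivelyCurved) {e : X.Edge} {r : List X.Edge} (h : Red r) :
    Red (op e r) := by
  by_cases hr : ∃ q, Shuf r (X.rev e :: q)
  · obtain ⟨q, hq⟩ := hr
    exact Red.of_shuf hX (op_of_shuf hX hq).symm (Red.of_shuf hX hq h).1
  · push Not at hr
    rw [op_of_not hr]
    exact ⟨h, hr⟩

theorem op_rev_op (hX : X.NonpositivelyCurved) {e : X.Edge} {r : List X.Edge} (h : Red r) :
    Shuf (CubeComplex.op (X.rev e) (CubeComplex.op e r)) r := by
  by_cases hr : ∃ q, Shuf r (X.rev e :: q)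
  · obtain ⟨q, hq⟩ := hr
    have h1 := op_of_shuf hX hq
    refine (op_congr hX h1).trans hX ?_
    rw [op_of_not (Red.of_shuf hX hq h).2]
    exact hq.symm
  · push Not at hr
    rw [op_of_not hr]
    apply op_of_shuf hX
    rw [X.rev_rev]
    exact .refl _

/-- Multiplying along the two sides of a square gives the same result, up to shuffling. -/
theorem op_sq (hX : X.NonpositivelyCurved) {a b c d : X.Edge} (hs : Sq a b c d)
    {r : List X.Edge} (h : Red r) : Shuf (op b (op a r)) (op d (op c r)) := by
  have mixed : ∀ {a b c d : X.Edge} (hs : Sq a b c d), (∃ q, Shuf r (X.rev a :: q)) →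
      (∀ q, ¬ Shuf r (X.rev c :: q)) → Shuf (op b (op a r)) (op d (op c r)) := by
    rintro a b c d hs ⟨q, hq⟩ hc
    have hop : Shuf (op c r) (X.rev d :: b :: q) := by
      rw [op_of_not hc]
      exact Shuf.trans hX (.cons c hq) (.of_sq hs.rot q)
    have hred : Red (X.rev d :: b :: q) := .of_shuf hX hop (h.op hX)
    refine (op_congr hX (op_of_shuf hX hq)).trans hX ?_
    rw [op_of_not hred.1.2]
    exact (op_of_shuf hX hop).symm
  by_cases ha : ∃ q, Shuf r (X.rev a :: q)
  · by_cases hc : ∃ q, Shuf r (X.rev c :: q)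
    · obtain ⟨q, hq⟩ := ha
      obtain ⟨q', hq'⟩ := hc
      have hne : X.rev a ≠ X.rev c := fun h => hX.ne hs (by rw [← X.rev_rev a, h, X.rev_rev])
      obtain ⟨f, g, t, e1, e2, hs'⟩ := (hq.symm.trans hX hq').exists_sq hne
      have hs'' := hs'.reverse
      rw [X.rev_rev, X.rev_rev] at hs''
      obtain ⟨e3, e4⟩ := hX.unique hs'' hs
      have h1 : Shuf (op b (op a r)) t :=
        op_of_shuf hX ((op_of_shuf hX hq).trans hX (by rw [← e3, X.rev_rev]; exact e1))
      have h2 : Shuf (op d (op c r)) t :=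
        op_of_shuf hX ((op_of_shuf hX hq').trans hX (by rw [← e4, X.rev_rev]; exact e2))
      exact h1.trans hX h2.symm
    · push Not at hc
      exact mixed hs ha hc
  · push Not at ha
    by_cases hc : ∃ q, Shuf r (X.rev c :: q)
    · exact (mixed hs.swap hc ha).symm
    · push Not at hc
      have aux : ∀ {a b c d : X.Edge} (hs : Sq a b c d), (∀ q, ¬ Shuf r (X.rev c :: q)) →
          ∀ q, ¬ Shuf (a :: r) (X.rev b :: q) := by
        intro a b c d hs hc q hq
        have hne : a ≠ X.rev b := by
          have := hX.ne hs.rot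
          intro h
          rw [h, X.rev_rev] at this
          exact this rfl
        obtain ⟨f, g, t, e1, e2, hs'⟩ := hq.exists_sq hne
        have hs'' := hs'.reverse
        rw [X.rev_rev] at hs''
        have e := (hX.unique hs'' hs.rot).1
        apply hc t
        rw [← e, X.rev_rev]
        exact e1
      rw [op_of_not ha, op_of_not hc, op_of_not (aux hs hc), op_of_not (aux hs.swap ha)]
      exact .of_sq hs r

/-- Successive right multiplication of the word `r` by the edges of the word `l`. -/
noncomputable def ops (r l : List X.Edge) : List X.Edge :=
  l.foldr op r

theorem ops_cons (r l : List X.Edge) (e : X.Edge) : ops r (e :: l) = op e (ops r l) := rfl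

theorem ops_append (r l l' : List X.Edge) : ops r (l' ++ l) = ops (ops r l) l' :=
  List.foldr_append

theorem ops_congr (hX : X.NonpositivelyCurved) {r r' : List X.Edge} (h : Shuf r r') :
    ∀ l : List X.Edge, Shuf (ops r l) (ops r' l)
  | [] => h
  | _ :: l => op_congr hX (ops_congr hX h l)

theorem Red.ops (hX : X.NonpositivelyCurved) {r : List X.Edge} (h : Red r) :
    ∀ l : List X.Edge, Red (ops r l)
  | [] => h
  | _ :: l => (Red.ops hX h l).op hX

theorem Red.ops_nil_eq {l : List X.Edge} (h : Red l) : CubeComplex.ops [] l = l := by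
  induction l with
  | nil => rfl
  | cons e l ih => rw [ops_cons, ih h.1, op_of_not h.2]

theorem length_op (hX : X.NonpositivelyCurved) (e : X.Edge) (r : List X.Edge) :
    (op e r).length + 1 = r.length ∨ (op e r).length = r.length + 1 := by
  by_cases hr : ∃ q, Shuf r (X.rev e :: q)
  · obtain ⟨q, hq⟩ := hr
    left
    rw [(op_of_shuf hX hq).length_eq, hq.length_eq]
    rfl
  · push Not at hr
    right
    rw [op_of_not hr]
    rfl

theorem length_ops (hX : X.NonpositivelyCurved) (l : List X.Edge) :
    (ops [] l).length ≤ l.length ∧ (ops [] l).length % 2 = l.length % 2 := by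
  induction l with
  | nil => exact ⟨le_rfl, rfl⟩
  | cons e l ih =>
    have := length_op hX e (ops [] l)
    rw [ops_cons, List.length_cons]
    omega

/-- A word that reduces without loss of length is reduced. -/
theorem red_of_length_ops (hX : X.NonpositivelyCurved) {l : List X.Edge}
    (h : l.length ≤ (ops [] l).length) : Red l := by
  induction l with
  | nil => trivial
  | cons e l ih =>
    have h1 := length_op hX e (ops [] l)
    have h2 := (length_ops hX l).1
    rw [ops_cons, List.length_cons] at h
    have h3 := ih (by omega)
    refine ⟨h3, fun q hq => ?_⟩
    rw [h3.ops_nil_eq, (op_of_shuf hX hq).length_eq, hq.length_eq] at h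
    simp only [List.length_cons] at h
    omega

theorem op_forall_mem (hX : X.NonpositivelyCurved) {E : Set X.Edge}
    (hE : ∀ a b c d, Sq a b c d → a ∈ E → b ∈ E → c ∈ E ∧ d ∈ E) {l : List X.Edge}
    (h : ∀ e ∈ l, e ∈ E) : ∀ e ∈ ops [] l, e ∈ E := by
  induction l with
  | nil => exact h
  | cons a l ih =>
    rw [List.forall_mem_cons] at h
    rw [ops_cons]
    by_cases hr : ∃ q, Shuf (ops [] l) (X.rev a :: q)
    · obtain ⟨q, hq⟩ := hr
      have h1 := (hq.forall_mem hE).1 (ih h.2)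
      rw [List.forall_mem_cons] at h1
      exact ((op_of_shuf hX hq).forall_mem hE).2 h1.2
    · push Not at hr
      rw [op_of_not hr, List.forall_mem_cons]
      exact ⟨h.1, ih h.2⟩

/-! ### Homotopic paths have shuffle equivalent reductions -/

/-- The edge word of an edge path, from the last edge to the first one. -/
def word {v w : X.Vert} (p : X.EdgePath v w) : List X.Edge :=
  Quiver.Path.rec [] (fun _ e l => e.1 :: l) p

theorem word_cons {u v w : X.Vert} (p : X.EdgePath u v) (e : v ⟶ w) :
    word (p.cons e) = e.1 :: word p := rfl

theorem word_comp {u v w : X.Vert} (p : X.EdgePath u v) (q : X.EdgePath v w) :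
    word (p.comp q) = word q ++ word p := by
  induction q with
  | nil => rfl
  | cons q e ih => rw [Quiver.Path.comp_cons, word_cons, word_cons, ih, List.cons_append]

/-- Each generator of homotopy acts trivially on reduced words modulo shuffling, so multiplication
of reduced words by an edge path only depends on the homotopy class of the path. -/
theorem Homotopic.shuf_ops (hX : X.NonpositivelyCurved) {v w : X.Vert} {p q : X.EdgePath v w}
    (h : X.Homotopic p q) {r : List X.Edge} (hr : Red r) :
    Shuf (ops r (word p)) (ops r (word q)) := by
  induction h generalizing r with
  | refl p => exact .refl _
  | symm _ ih => exact (ih hr).symm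
  | trans _ _ ih1 ih2 => exact (ih1 hr).trans hX (ih2 hr)
  | comp _ _ ih1 ih2 =>
    rw [word_comp, word_comp, ops_append, ops_append]
    exact (ops_congr hX (ih1 hr) _).trans hX (ih2 (hr.ops hX _))
  | backtrack e => exact op_rev_op hX hr
  | square s a b c d ha hb hc hd => exact op_sq hX ⟨s, ha, hb, hc, hd⟩ hr

/-- Normal forms for homotopy classes: reduced paths are homotopic only if they differ by
shuffling. -/
theorem Homotopic.shuf (hX : X.NonpositivelyCurved) {v w : X.Vert} {p q : X.EdgePath v w}
    (h : X.Homotopic p q) (hp : Red (word p)) (hq : Red (word q)) : Shuf (word p) (word q) := by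
  have := h.shuf_ops hX (r := []) trivial
  rwa [hp.ops_nil_eq, hq.ops_nil_eq] at this

/-! ### Vertices of cubes -/

theorem card_update_true {n : ℕ} {a : Fin n → Bool} {i : Fin n} (hi : a i = false) :
    (Finset.univ.filter fun j => Function.update a i true j = true).card =
      (Finset.univ.filter fun j => a j = true).card + 1 := by
  have : (Finset.univ.filter fun j => Function.update a i true j = true) =
      insert i (Finset.univ.filter fun j => a j = true) := by
    ext j
    by_cases hj : j = i
    · subst hj; simp
    · simp [hj]
  rw [this, Finset.card_insert_of_notMem (by simp [hi])]

/-- Induction over the vertices of a cube, starting at the origin. -/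
theorem vertex_induction {n : ℕ} {P : (Fin n → Bool) → Prop} (h0 : P fun _ => false)
    (hs : ∀ a i, a i = false → P a → P (Function.update a i true)) (a : Fin n → Bool) : P a := by
  have key : ∀ s : Finset (Fin n), P fun i => decide (i ∈ s) := by
    intro s
    induction s using Finset.induction_on with
    | empty => simpa using h0
    | insert i s hi ih =>
      convert hs _ i (by simpa using hi) ih using 1
      funext j
      by_cases hj : j = i
      · subst hj; simp
      · simp [hj]
  convert key (Finset.univ.filter fun i => a i = true) using 1
  funext i
  simp

/-! ### Moving points along edges -/

/-- A set `V` over the vertices of `X` in which points can be moved along the edges of `X`,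
compatibly with reversal of edges and with squares. The two instances of interest are the vertices
of `X` themselves, and the vertices of the universal cover. -/
structure EdgeTransport (X : CubeComplex.{u}) (V : Type u) where
  proj : V → X.Vert
  step : V → X.Edge → V → Prop
  source : ∀ {P e Q}, step P e Q → X.source e = proj P
  target : ∀ {P e Q}, step P e Q → X.target e = proj Q
  exists_step : ∀ P e, X.source e = proj P → ∃ Q, step P e Q
  unique : ∀ {P e Q Q'}, step P e Q → step P e Q' → Q = Q'
  rev : ∀ {P e Q}, step P e Q → step Q (X.rev e) P
  sq : ∀ {a b c d P Q R}, Sq a b c d → step P a Q → step Q b R → ∃ Q', step P c Q' ∧ step Q' d R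

namespace EdgeTransport

variable {V : Type u} (T : X.EdgeTransport V)

/-- The word `l` leads from `P` to `Q`. -/
def Walk : V → List X.Edge → V → Prop
  | P, [], Q => P = Q
  | P, e :: l, R => ∃ Q, Walk P l Q ∧ T.step Q e R

variable {T}

theorem walk_nil (P : V) : T.Walk P [] P := rfl

theorem Walk.cons {P Q R : V} {l : List X.Edge} {e : X.Edge} (h : T.Walk P l Q)
    (he : T.step Q e R) : T.Walk P (e :: l) R := ⟨Q, h, he⟩

theorem Walk.single {Q R : V} {e : X.Edge} (he : T.step Q e R) : T.Walk Q [e] R := ⟨Q, rfl, he⟩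

theorem Walk.append {P Q : V} {l : List X.Edge} (h : T.Walk P l Q) :
    ∀ {l' : List X.Edge} {R : V}, T.Walk Q l' R → T.Walk P (l' ++ l) R
  | [], _, h' => by cases h'; exact h
  | _ :: _, _, ⟨_, h1, h2⟩ => ⟨_, h.append h1, h2⟩

theorem Walk.unique {P : V} : ∀ {l : List X.Edge} {Q Q' : V}, T.Walk P l Q → T.Walk P l Q' → Q = Q'
  | [], _, _, h, h' => Eq.trans (Eq.symm h) h'
  | _ :: _, _, _, ⟨_, h1, h2⟩, ⟨_, h3, h4⟩ => by
    cases h1.unique h3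
    exact T.unique h2 h4

theorem Walk.reverse {P : V} : ∀ {l : List X.Edge} {Q : V}, T.Walk P l Q →
    T.Walk Q (l.map X.rev).reverse P
  | [], _, h => Eq.symm h
  | _ :: _, _, ⟨_, h1, h2⟩ => by
    rw [List.map_cons, List.reverse_cons]
    exact (Walk.single (T.rev h2)).append h1.reverse

theorem Walk.shuf {P Q : V} {l l' : List X.Edge} (h : T.Walk P l Q) (hs : Shuf l l') :
    T.Walk P l' Q := by
  have key : ∀ {l l' : List X.Edge}, Shuf l l' → ∀ Q, T.Walk P l Q ↔ T.Walk P l' Q := by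
    intro l l' hs
    induction hs with
    | nil => exact fun _ => Iff.rfl
    | cons a _ ih => exact fun Q => exists_congr fun R => and_congr_left fun _ => ih R
    | @swap a b c d p q r h1 h2 hs ih1 ih2 =>
      intro Q
      constructor
      · rintro ⟨R, h3, h4⟩
        obtain ⟨S, h5, h6⟩ := (ih1 R).1 h3
        obtain ⟨R', h7, h8⟩ := T.sq hs h6 h4
        exact ⟨R', (ih2 R').2 ⟨S, h5, h7⟩, h8⟩
      · rintro ⟨R, h3, h4⟩
        obtain ⟨S, h5, h6⟩ := (ih2 R).1 h3
        obtain ⟨R', h7, h8⟩ := T.sq hs.swap h6 h4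
        exact ⟨R', (ih1 R').2 ⟨S, h5, h7⟩, h8⟩
  exact (key hs Q).1 h

theorem Walk.op (hX : X.NonpositivelyCurved) {P Q R : V} {l : List X.Edge} {e : X.Edge}
    (h : T.Walk P l Q) (he : T.step Q e R) : T.Walk P (op e l) R := by
  by_cases hr : ∃ q, Shuf l (X.rev e :: q)
  · obtain ⟨q, hq⟩ := hr
    obtain ⟨S, h1, h2⟩ := h.shuf hq
    have h3 := T.rev h2
    rw [X.rev_rev] at h3
    cases T.unique he h3
    exact h1.shuf (op_of_shuf hX hq).symm
  · push Not at hr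
    rw [op_of_not hr]
    exact h.cons he

theorem Walk.ops (hX : X.NonpositivelyCurved) {P : V} : ∀ {l : List X.Edge} {Q : V},
    T.Walk P l Q → T.Walk P (ops [] l) Q
  | [], _, h => h
  | _ :: _, _, ⟨_, h1, h2⟩ => (h1.ops hX).op hX h2

/-! ### Filling cubes -/

/-- Points that can be reached from `P` by moving monotonically along the edges of a cube. -/
inductive Reach (T : X.EdgeTransport V) {n : ℕ} (c : X.Cube n) (P : V) : (Fin n → Bool) → V → Prop
  | base : Reach T c P (fun _ => false) P
  | step {a : Fin n → Bool} {Q Q' : V} (i : Fin n) : Reach T c P a Q → a i = false →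
      T.step Q (X.edge c i a) Q' → Reach T c P (Function.update a i true) Q'

theorem Reach.proj_eq {n : ℕ} {c : X.Cube n} {P : V} (hP : T.proj P = X.origin c)
    {a : Fin n → Bool} {Q : V} (h : T.Reach c P a Q) : T.proj Q = X.vertex c a := by
  cases h with
  | base => exact hP
  | step i h1 h2 h3 => rw [← T.target h3, target_edge, h2, Bool.not_false]

theorem exists_reach {n : ℕ} (c : X.Cube n) (P : V) (hP : T.proj P = X.origin c) :
    ∀ (k : ℕ) (a : Fin n → Bool), (Finset.univ.filter fun i => a i = true).card = k →
      ∃ Q, T.Reach c P a Q := by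
  intro k
  induction k with
  | zero =>
    intro a ha
    rw [Finset.card_eq_zero, Finset.filter_eq_empty_iff] at ha
    obtain rfl : a = fun _ => false := by
      funext i
      simpa using ha (Finset.mem_univ i)
    exact ⟨P, .base⟩
  | succ k ih =>
    intro a ha
    obtain ⟨i, hi⟩ : (Finset.univ.filter fun i => a i = true).Nonempty := by
      rw [← Finset.card_pos]; omega
    rw [Finset.mem_filter] at hi
    have h2 : Function.update (Function.update a i false) i true = a := by
      rw [Function.update_idem, Function.update_eq_self_iff, hi.2]
    obtain ⟨Q, hQ⟩ := ih (Function.update a i false) (by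
      have : (Finset.univ.filter fun j => Function.update a i false j = true) =
          (Finset.univ.filter fun j => a j = true).erase i := by
        ext j
        by_cases hj : j = i
        · subst hj; simp
        · simp [hj]
      rw [this, Finset.card_erase_of_mem (by simpa using hi.2), ha]
      rfl)
    obtain ⟨Q', hQ'⟩ := T.exists_step Q (X.edge c i (Function.update a i false)) (by
      rw [source_edge, hQ.proj_eq hP])
    refine ⟨Q', ?_⟩
    rw [← h2]
    exact .step i hQ (Function.update_self ..) hQ'

theorem Reach.unique {n : ℕ} {c : X.Cube n} {P : V} (hP : T.proj P = X.origin c) :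
    ∀ (k : ℕ) {a : Fin n → Bool}, (Finset.univ.filter fun i => a i = true).card = k →
      ∀ {Q Q' : V}, T.Reach c P a Q → T.Reach c P a Q' → Q = Q' := by
  intro k
  induction k using Nat.strong_induction_on with
  | _ k ih =>
  intro a ha Q Q' h h'
  generalize hb : a = b at h'
  cases h with
  | base =>
    cases h' with
    | base => rfl
    | @step a' _ _ i _ _ _ =>
      have := congrFun hb i
      simp at this
  | @step a1 Q1 _ i h1 h2 h3 =>
    cases h' with
    | base =>
      have := congrFun hb i
      simp at this
    | @step a2 Q2 _ j h4 h5 h6 =>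
      have c1 := card_update_true h2
      by_cases hij : i = j
      · subst hij
        obtain rfl : a1 = a2 := by
          funext l
          by_cases hl : l = i
          · rw [hl, h2, h5]
          · have := congrFun hb l
            simpa [hl] using this
        cases ih _ (by omega) rfl h1 h4
        exact T.unique h3 h6
      · have hji : j ≠ i := fun h => hij h.symm
        -- The common predecessor, where both coordinates are still zero.
        let a0 := Function.update a1 j false
        have e1 : Function.update a0 j true = a1 := by
          have : a1 j = true := by
            have := congrFun hb j
            simpa [hji] using this
          rw [Function.update_idem, Function.update_eq_self_iff, this]
        have e2 : Function.update a0 i true = a2 := by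
          funext l
          by_cases hl : l = i
          · subst hl
            have := congrFun hb l
            simpa [hij] using this
          · rw [Function.update_of_ne hl]
            by_cases hl' : l = j
            · rw [hl', h5]
              exact Function.update_self ..
            · have := congrFun hb l
              simpa [a0, hl, hl'] using this
        have a0i : a0 i = false := by
          simp only [a0]
          rw [Function.update_of_ne hij, h2]
        have a0j : a0 j = false := Function.update_self ..
        have c2 := card_update_true a0j
        have c3 := card_update_true a0i
        rw [e1] at c2
        rw [e2] at c3
        obtain ⟨R, hR⟩ := exists_reach c P hP _ a0 rfl
        obtain ⟨R1, hR1⟩ := T.exists_step R (X.edge c j a0) (by rw [source_edge, hR.proj_eq hP])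
        obtain ⟨R2, hR2⟩ := T.exists_step R (X.edge c i a0) (by rw [source_edge, hR.proj_eq hP])
        have r1 := Reach.step j hR a0j hR1
        have r2 := Reach.step i hR a0i hR2
        rw [e1] at r1
        rw [e2] at r2
        cases ih _ (by omega) rfl h1 r1
        cases ih _ (by omega) rfl h4 r2
        have hs := sq_of_cube c hij a0
        rw [a0i, a0j, Bool.not_false, e1, e2] at hs
        obtain ⟨R', h7, h8⟩ := T.sq hs hR2 h6
        cases T.unique h7 hR1
        exact T.unique h3 h8

/-- A point over the origin of a cube extends uniquely to compatible points over all vertices of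
the cube. -/
theorem exists_fill {n : ℕ} (c : X.Cube n) (P : V) (hP : T.proj P = X.origin c) :
    ∃ pt : (Fin n → Bool) → V, pt (fun _ => false) = P ∧ (∀ a, T.proj (pt a) = X.vertex c a) ∧
      ∀ σ : FaceMap 1 n, T.step (pt (σ.app fun _ => false)) (X.face σ c)
        (pt (σ.app fun _ => true)) := by
  choose pt hpt using fun a => exists_reach c P hP _ a rfl
  have huniq : ∀ {a Q}, T.Reach c P a Q → pt a = Q := fun h => (hpt _).unique hP _ rfl h
  have hpos : ∀ (i : Fin n) (a : Fin n → Bool), a i = false →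
      T.step (pt a) (X.edge c i a) (pt (Function.update a i true)) := by
    intro i a hi
    obtain ⟨Q, hQ⟩ := T.exists_step (pt a) (X.edge c i a)
      (by rw [source_edge, (hpt a).proj_eq hP])
    rw [huniq (.step i (hpt a) hi hQ)]
    exact hQ
  refine ⟨pt, huniq .base, fun a => (hpt a).proj_eq hP, fun σ => ?_⟩
  rw [FaceMap.eq_edge σ, FaceMap.edge_app_false, FaceMap.edge_app_true]
  change T.step _ (X.edge c _ _) _
  generalize σ.dir 0 = i
  generalize σ.base = a
  by_cases hi : a i = false
  · rw [hi]
    exact hpos i a hi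
  · rw [Bool.not_eq_false] at hi
    have h1 := T.rev (hpos i (Function.update a i false) (Function.update_self ..))
    rw [rev_edge, Function.update_self, Function.update_idem, Function.update_idem, Bool.not_false,
      (Function.update_eq_self_iff (f := a)).2 hi.symm] at h1
    rw [hi]
    exact h1

theorem fill_unique {n : ℕ} {c : X.Cube n} {P : V} (hP : T.proj P = X.origin c)
    {pt pt' : (Fin n → Bool) → V} (h0 : pt (fun _ => false) = P) (h0' : pt' (fun _ => false) = P)
    (h : ∀ σ : FaceMap 1 n, T.step (pt (σ.app fun _ => false)) (X.face σ c)
      (pt (σ.app fun _ => true)))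
    (h' : ∀ σ : FaceMap 1 n, T.step (pt' (σ.app fun _ => false)) (X.face σ c)
      (pt' (σ.app fun _ => true))) : pt = pt' := by
  have key : ∀ {pt : (Fin n → Bool) → V}, pt (fun _ => false) = P →
      (∀ σ : FaceMap 1 n, T.step (pt (σ.app fun _ => false)) (X.face σ c)
        (pt (σ.app fun _ => true))) → ∀ {a Q}, T.Reach c P a Q → pt a = Q := by
    intro pt h0 h a Q hr
    induction hr with
    | base => exact h0
    | @step a Q Q' i h1 h2 h3 ih =>
      have := h (FaceMap.edge i a)
      rw [FaceMap.edge_app_false, FaceMap.edge_app_true, ih, h2] at this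
      exact T.unique this h3
  funext a
  obtain ⟨Q, hQ⟩ := exists_reach c P hP _ a rfl
  rw [key h0 h hQ, key h0' h' hQ]

end EdgeTransport

/-- Moving from vertex to vertex. -/
def vertTransport (X : CubeComplex.{u}) : X.EdgeTransport X.Vert where
  proj v := v
  step v e w := X.source e = v ∧ X.target e = w
  source h := h.1
  target h := h.2
  exists_step _ _ h := ⟨_, h, rfl⟩
  unique h h' := h.2.symm.trans h'.2
  rev h := ⟨(X.source_rev _).trans h.2, (X.target_rev _).trans h.1⟩
  sq hs h h' := ⟨_, ⟨hs.source_eq.symm.trans h.1, rfl⟩, hs.target_right.symm,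
    hs.target_eq.symm.trans h'.2⟩

namespace PathClass

theorem exists_rep {v w : X.Vert} (a : X.PathClass v w) : ∃ p : X.EdgePath v w, mk p = a :=
  Quotient.exists_rep a

theorem mk_comp {u v w : X.Vert} (p : X.EdgePath u v) (q : X.EdgePath v w) :
    mk (p.comp q) = (mk p).comp (mk q) := rfl

theorem comp_nil {v w : X.Vert} (a : X.PathClass v w) : a.comp (mk Quiver.Path.nil) = a := by
  obtain ⟨p, rfl⟩ := a.exists_rep
  rw [← mk_comp, Quiver.Path.comp_nil]

theorem mk_comp_reverse {v w : X.Vert} (p : X.EdgePath v w) :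
    (mk p).comp (mk p.reverse) = mk Quiver.Path.nil :=
  Quotient.sound (Homotopic.comp_reverse p)

theorem mk_reverse_comp {v w : X.Vert} (p : X.EdgePath v w) :
    (mk p.reverse).comp (mk p) = mk Quiver.Path.nil := by
  have := mk_comp_reverse p.reverse
  rwa [Quiver.Path.reverse_reverse] at this

theorem comp_left_cancel {u v w : X.Vert} {a : X.PathClass u v} {b c : X.PathClass v w}
    (h : a.comp b = a.comp c) : b = c := by
  obtain ⟨p, rfl⟩ := a.exists_rep
  have := congrArg (fun d => (mk p.reverse).comp d) h
  simpa only [← comp_assoc, mk_reverse_comp, nil_comp] using this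

theorem homotopic_of_mk_eq {v w : X.Vert} {p q : X.EdgePath v w} (h : mk p = mk q) :
    X.Homotopic p q :=
  Quotient.exact h

end PathClass

theorem reverse_hom_val {v w : X.Vert} (e : v ⟶ w) : (Quiver.reverse e).1 = X.rev e.1 := rfl

/-- Moving in the universal cover by appending edges. -/
def uTransport (X : CubeComplex.{u}) (x : X.Vert) : X.EdgeTransport (X.UVert x) where
  proj P := P.1
  step P e Q := P.Step e Q
  source := by
    rintro _ _ _ ⟨f, rfl, -⟩
    exact f.2.1
  target := by
    rintro _ _ _ ⟨f, rfl, -⟩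
    exact f.2.2
  exists_step := by
    rintro P e h
    exact ⟨⟨X.target e, P.2.comp (PathClass.mk (Quiver.Hom.toPath ⟨e, h, rfl⟩))⟩,
      ⟨e, h, rfl⟩, rfl, rfl⟩
  unique := by
    rintro ⟨v, P⟩ e ⟨w, Q⟩ ⟨w', Q'⟩ ⟨f, h1, h2⟩ ⟨f', h1', h2'⟩
    obtain rfl : w = w' := f.2.2.symm.trans ((congrArg _ (h1.trans h1'.symm)).trans f'.2.2)
    obtain rfl : f = f' := Subtype.ext (h1.trans h1'.symm)
    exact Sigma.ext rfl (heq_of_eq (h2.trans h2'.symm))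
  rev := by
    rintro ⟨v, P⟩ e ⟨w, Q⟩ ⟨f, h1, h2⟩
    refine ⟨Quiver.reverse f, by rw [reverse_hom_val, h1], ?_⟩
    simp only at h2 ⊢
    rw [h2, PathClass.comp_assoc]
    have : (PathClass.mk f.toPath).comp (PathClass.mk (Quiver.reverse f).toPath) =
        PathClass.mk Quiver.Path.nil := Quotient.sound (Homotopic.backtrack f)
    rw [this, PathClass.comp_nil]
  sq := by
    rintro a b c d ⟨v, P⟩ ⟨w, Q⟩ ⟨z, R⟩ hs ⟨f, h1, h2⟩ ⟨g, h3, h4⟩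
    simp only at f g h2 h4
    let f' : v ⟶ X.target c := ⟨c, hs.source_eq.symm.trans (by rw [← h1]; exact f.2.1), rfl⟩
    let g' : X.target c ⟶ z := ⟨d, hs.target_right.symm,
      hs.target_eq.symm.trans (by rw [← h3]; exact g.2.2)⟩
    refine ⟨⟨X.target c, P.comp (PathClass.mk f'.toPath)⟩, ⟨f', rfl, rfl⟩, ⟨g', rfl, ?_⟩⟩
    simp only
    rw [h4, h2, PathClass.comp_assoc, PathClass.comp_assoc]
    congr 1
    obtain ⟨s, rfl, rfl, rfl, rfl⟩ := hs
    exact Quotient.sound (Homotopic.square s f g f' g' h1 h3 rfl rfl)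

theorem walk_word {v w : X.Vert} (p : X.EdgePath v w) : X.vertTransport.Walk v (word p) w := by
  induction p with
  | nil => rfl
  | cons p e ih => exact ⟨_, ih, e.2⟩

theorem exists_path_of_walk {v w : X.Vert} {l : List X.Edge} (h : X.vertTransport.Walk v l w) :
    ∃ p : X.EdgePath v w, word p = l := by
  induction l generalizing w with
  | nil => cases h; exact ⟨.nil, rfl⟩
  | cons e l ih =>
    obtain ⟨z, h1, h2⟩ := h
    obtain ⟨p, rfl⟩ := ih h1
    exact ⟨p.cons ⟨e, h2⟩, rfl⟩

theorem uwalk_word {x v w : X.Vert} (c : X.PathClass x v) (p : X.EdgePath v w) :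
    (X.uTransport x).Walk ⟨v, c⟩ (word p) ⟨w, c.comp (PathClass.mk p)⟩ := by
  induction p with
  | nil =>
    rw [PathClass.comp_nil]
    rfl
  | cons p e ih =>
    exact ⟨_, ih, e, rfl, by rw [PathClass.comp_assoc]; rfl⟩

theorem exists_path_of_uwalk {x : X.Vert} {P Q : X.UVert x} {l : List X.Edge}
    (h : (X.uTransport x).Walk P l Q) :
    ∃ p : X.EdgePath P.1 Q.1, word p = l ∧ Q.2 = P.2.comp (PathClass.mk p) := by
  induction l generalizing Q with
  | nil => cases h; exact ⟨.nil, rfl, (PathClass.comp_nil _).symm⟩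
  | cons e l ih =>
    obtain ⟨R, h1, f, rfl, h2⟩ := h
    obtain ⟨p, rfl, h3⟩ := ih h1
    refine ⟨p.cons f, rfl, ?_⟩
    rw [h2, h3, PathClass.comp_assoc]
    rfl

/-- Between two points of the universal cover there is only one reduced word, up to shuffling. -/
theorem shuf_of_uwalk (hX : X.NonpositivelyCurved) {x : X.Vert} {P Q : X.UVert x}
    {l l' : List X.Edge} (h : (X.uTransport x).Walk P l Q) (h' : (X.uTransport x).Walk P l' Q)
    (hl : Red l) (hl' : Red l') : Shuf l l' := by
  obtain ⟨p, rfl, hp⟩ := exists_path_of_uwalk h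
  obtain ⟨q, rfl, hq⟩ := exists_path_of_uwalk h'
  exact (PathClass.homotopic_of_mk_eq
    (PathClass.comp_left_cancel (hp.symm.trans hq))).shuf hX hl hl'

/-- Every point of the universal cover can be reached from the base point. -/
theorem exists_uwalk {x : X.Vert} (P : X.UVert x) :
    ∃ l, (X.uTransport x).Walk ⟨x, PathClass.mk .nil⟩ l P := by
  obtain ⟨v, c⟩ := P
  obtain ⟨p, rfl⟩ := c.exists_rep
  have := uwalk_word (PathClass.mk (.nil : X.EdgePath x x)) p
  rw [PathClass.nil_comp] at this
  exact ⟨_, this⟩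

theorem EdgeTransport.Walk.map {V W : Type u} {T : Y.EdgeTransport V} {T' : X.EdgeTransport W}
    (f : Map Y X) (φ : V → W) (h : ∀ {P e Q}, T.step P e Q → T'.step (φ P) (f e) (φ Q)) {P : V} :
    ∀ {l : List Y.Edge} {Q : V}, T.Walk P l Q → T'.Walk (φ P) (l.map fun e => f e) (φ Q)
  | [], _, hl => congrArg φ hl
  | _ :: _, _, ⟨_, h1, h2⟩ => ⟨_, h1.map f φ h, h h2⟩

theorem walk_map (f : Map Y X) {v w : Y.Vert} {l : List Y.Edge} (h : Y.vertTransport.Walk v l w) :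
    X.vertTransport.Walk (f v) (l.map fun e => f e) (f w) :=
  h.map (T' := X.vertTransport) f (fun v => f v) fun {P e Q} he => ⟨by rw [← f.map_source, he.1], by
    rw [← f.map_target, he.2]⟩

theorem connected_iff : Y.Connected ↔
    Nonempty Y.Vert ∧ ∀ v w, ∃ l, Y.vertTransport.Walk v l w := by
  refine and_congr_right fun _ => forall_congr' fun v => forall_congr' fun w => ?_
  exact ⟨fun ⟨p⟩ => ⟨_, walk_word p⟩, fun ⟨l, hl⟩ => ⟨(exists_path_of_walk hl).choose⟩⟩

theorem word_path (f : Map Y X) {v w : Y.Vert} (p : Y.EdgePath v w) :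
    word (f.path p) = (word p).map fun e => f e := by
  induction p with
  | nil => rfl
  | cons p e ih => exact congrArg (f e.1 :: ·) ih

/-! ### Local isometries and reduced words -/

namespace Map.IsLocalIsometry

variable {f : Map Y X}

theorem edge_injective (hf : f.IsLocalIsometry) {e e' : Y.Edge} (h : Y.source e = Y.source e')
    (h' : f e = f e') : e = e' :=
  hf.link_injective e e' h h'

/-- Squares lift if two edges at a corner lift. -/
theorem lift_corner (hf : f.IsLocalIsometry) {a c : Y.Edge} {b' d' : X.Edge}
    (hac : Y.source a = Y.source c) (h : Sq (f a) b' (f c) d') :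
    ∃ b d, Sq a b c d ∧ f b = b' ∧ f d = d' := by
  obtain ⟨s, h1, rfl, h2, rfl⟩ := h
  obtain ⟨t, ht1, ht2⟩ := hf.link_full (Y.source a) s
    (by rw [← source_axis s 0, axis_two_zero, ← h1, f.map_source])
    (by
      intro i
      fin_cases i
      · exact ⟨a, rfl, by rw [h1]; exact (axis_two_zero s).symm⟩
      · exact ⟨c, hac.symm, by rw [h2]; exact (axis_two_one s).symm⟩)
  subst ht2
  have e1 : Y.edge t 0 ![false, false] = a := by
    apply hf.edge_injective
    · rw [← ht1, ← source_axis t 0, axis_two_zero]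
    · rw [f.map_edge, h1]
  have e2 : Y.edge t 1 ![false, false] = c := by
    apply hf.edge_injective
    · rw [← hac, ← ht1, ← source_axis t 1, axis_two_one]
    · rw [f.map_edge, h2]
  exact ⟨_, _, ⟨t, e1.symm, rfl, e2.symm, rfl⟩, f.map_edge .., f.map_edge ..⟩

theorem lift_sq (hf : f.IsLocalIsometry) {a b : Y.Edge} {c' d' : X.Edge}
    (hab : Y.target a = Y.source b) (h : Sq (f a) (f b) c' d') :
    ∃ c d, Sq a b c d ∧ f c = c' ∧ f d = d' := by
  have h1 := h.rot
  rw [← f.map_rev] at h1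
  obtain ⟨c, d, h2, h3, h4⟩ := hf.lift_corner ((Y.source_rev a).trans hab) h1
  have h5 := h2.rot
  rw [Y.rev_rev] at h5
  exact ⟨c, Y.rev d, h5, h3, by rw [f.map_rev, h4, X.rev_rev]⟩

theorem word_injective (hf : f.IsLocalIsometry) {v : Y.Vert} :
    ∀ {l l' : List Y.Edge} {w w' : Y.Vert}, Y.vertTransport.Walk v l w →
      Y.vertTransport.Walk v l' w' → (l.map fun e => f e) = l'.map (fun e => f e) → l = l'
  | [], [], _, _, _, _, _ => rfl
  | [], _ :: _, _, _, _, _, h => by simp at h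
  | _ :: _, [], _, _, _, _, h => by simp at h
  | e :: l, e' :: l', _, _, ⟨P, h1, h2⟩, ⟨Q, h3, h4⟩, h => by
    rw [List.map_cons, List.map_cons, List.cons.injEq] at h
    obtain rfl := hf.word_injective h1 h3 h.2
    cases h1.unique h3
    rw [hf.edge_injective (h2.1.trans h4.1.symm) h.1]

/-- Shuffles lift through local isometries. -/
theorem lift_shuf (hf : f.IsLocalIsometry) {v w : Y.Vert}
    {l : List Y.Edge} {m : List X.Edge} (hl : Y.vertTransport.Walk v l w)
    (h : Shuf (l.map fun e => f e) m) : ∃ l', Shuf l l' ∧ (l'.map fun e => f e) = m := by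
  induction hn : l.length using Nat.strong_induction_on generalizing l m w with
  | _ n ih =>
  subst hn
  cases l with
  | nil => cases h; exact ⟨[], .nil, rfl⟩
  | cons a p =>
    obtain ⟨z, h1, h2⟩ := hl
    rw [List.map_cons] at h
    cases h with
    | @cons _ _ m h =>
      obtain ⟨p', h3, h4⟩ := ih _ (by simp) h1 h rfl
      exact ⟨a :: p', .cons a h3, by rw [List.map_cons, h4]⟩
    | @swap _ b' c' d' _ q' r' h3 h4 hs =>
      obtain ⟨r0, h5, h6⟩ := ih _ (by simp) h1 h3 rfl
      cases r0 with
      | nil => simp at h6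
      | cons c r =>
        rw [List.map_cons, List.cons.injEq] at h6
        obtain ⟨rfl, rfl⟩ := h6
        have h7 := h1.shuf h5
        obtain ⟨z', h8, h9⟩ := h7
        obtain ⟨d, b, hs', rfl, rfl⟩ := hf.lift_sq (h9.2.trans h2.1.symm) hs
        have h10 : Y.vertTransport.Walk v (d :: r) (Y.target d) :=
          ⟨z', h8, hs'.source_eq.symm.trans h9.1, rfl⟩
        have len := h5.length_eq
        simp only [List.length_cons] at len
        have h4' : Shuf ((d :: r).map fun e => f e) q' := h4.symm
        obtain ⟨q, h11, rfl⟩ := ih _ (by simp [len]) h10 h4' rfl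
        exact ⟨b :: q, .swap h5 h11.symm hs', rfl⟩

/-- Local isometries preserve reduced words, since backtracking after a shuffle lifts. -/
theorem red_map (hX : X.NonpositivelyCurved) (hf : f.IsLocalIsometry) {v : Y.Vert} :
    ∀ {l : List Y.Edge} {w : Y.Vert}, Y.vertTransport.Walk v l w → Red l →
      Red (l.map fun e => f e)
  | [], _, _, _ => trivial
  | a :: l, _, ⟨z, h1, h2⟩, ⟨h3, h4⟩ => by
    refine ⟨hf.red_map hX h1 h3, fun q hq => ?_⟩
    obtain ⟨l', h5, h6⟩ := hf.lift_shuf h1 hq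
    cases l' with
    | nil => simp at h6
    | cons c r =>
      rw [List.map_cons, List.cons.injEq] at h6
      obtain ⟨s, -, h7⟩ := h1.shuf h5
      apply h4 r
      have : c = Y.rev a := by
        rw [← Y.rev_rev c]
        congr 1
        apply hf.edge_injective
        · rw [Y.source_rev, h7.2, h2.1]
        · rw [f.map_rev, h6.1, X.rev_rev]
      rwa [this] at h5

/-- Nonpositive curvature passes to the source of a local isometry. -/
theorem npc (hX : X.NonpositivelyCurved) (hf : f.IsLocalIsometry) : Y.NonpositivelyCurved where
  axis_injective c i j h := hX.axis_injective (f c) (by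
    rw [← f.map_axis, ← f.map_axis, h])
  eq_of_axis_eq c c' h h' := hf.link_injective c c' h (hX.eq_of_axis_eq _ _
    (by rw [← f.map_origin, ← f.map_origin, h])
    (by funext i; rw [← f.map_axis, ← f.map_axis, h']))
  flag v n e he hv hs := by
    obtain ⟨c, h1, h2⟩ := hX.flag (f v) (fun i => f (e i))
      (fun i j h => he (hf.edge_injective ((hv i).trans (hv j).symm) h))
      (fun i => by rw [← f.map_source, hv])
      (fun i j hij => by
        obtain ⟨s, h1, h2⟩ := hs i j hij
        exact ⟨f s, by rw [← f.map_axis, h1], by rw [← f.map_axis, h2]⟩)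
    obtain ⟨c', h3, h4⟩ := hf.link_full v c h1 fun i => ⟨e i, hv i, (congrFun h2 i).symm⟩
    refine ⟨c', h3, ?_⟩
    funext i
    apply hf.edge_injective
    · rw [source_axis, h3, hv]
    · rw [f.map_axis, h4, h2]

end Map.IsLocalIsometry

theorem Map.IsCover.isLocalIsometry {f : Map Y X} (hf : f.IsCover) : f.IsLocalIsometry where
  link_injective c c' h h' := by
    obtain ⟨d, -, hd⟩ := hf.lift (Y.origin c) (f c) (f.map_origin c).symm
    rw [hd c ⟨rfl, rfl⟩, hd c' ⟨h.symm, h'.symm⟩]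
  link_full y n c h _ := (hf.lift y c h).exists

/-! ### The effect of maps on path classes -/

theorem Map.path_comp (f : Map Y X) {u v w : Y.Vert} (p : Y.EdgePath u v) (q : Y.EdgePath v w) :
    f.path (p.comp q) = (f.path p).comp (f.path q) :=
  f.skel.mapPath_comp p q

theorem Map.homotopic (f : Map Y X) {v w : Y.Vert} {p q : Y.EdgePath v w} (h : Y.Homotopic p q) :
    X.Homotopic (f.path p) (f.path q) := by
  induction h with
  | refl p => exact .refl _
  | symm _ ih => exact .symm ih
  | trans _ _ ih1 ih2 => exact .trans ih1 ih2
  | comp _ _ ih1 ih2 =>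
    rw [f.path_comp, f.path_comp]
    exact .comp ih1 ih2
  | @backtrack v w e =>
    rw [f.path_comp]
    have h := Homotopic.backtrack (f.skel.map e)
    have e1 : Quiver.reverse (f.skel.map e) = f.skel.map (Quiver.reverse e) :=
      Subtype.ext (f.map_rev e.1).symm
    rw [e1] at h
    exact h
  | square s a b c d ha hb hc hd =>
    rw [f.path_comp, f.path_comp]
    refine Homotopic.square (f s) (f.skel.map a) (f.skel.map b) (f.skel.map c) (f.skel.map d)
      ?_ ?_ ?_ ?_ <;> rw [← f.map_edge]
    · exact congrArg (fun e => f e) ha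
    · exact congrArg (fun e => f e) hb
    · exact congrArg (fun e => f e) hc
    · exact congrArg (fun e => f e) hd

/-- The effect of a combinatorial map on homotopy classes of paths. -/
def Map.pathClass (f : Map Y X) {v w : Y.Vert} : Y.PathClass v w → X.PathClass (f v) (f w) :=
  Quotient.map f.path fun _ _ h => f.homotopic h

theorem Map.pathClass_mk (f : Map Y X) {v w : Y.Vert} (p : Y.EdgePath v w) :
    f.pathClass (.mk p) = .mk (f.path p) := rfl

theorem Map.pathClass_comp (f : Map Y X) {u v w : Y.Vert} (a : Y.PathClass u v)
    (b : Y.PathClass v w) : f.pathClass (a.comp b) = (f.pathClass a).comp (f.pathClass b) := by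
  obtain ⟨p, rfl⟩ := a.exists_rep
  obtain ⟨q, rfl⟩ := b.exists_rep
  rw [← PathClass.mk_comp, f.pathClass_mk, f.path_comp]
  rfl

/-- The effect of a combinatorial map on the vertices of universal covers. -/
def Map.uMap (f : Map Y X) (y : Y.Vert) (P : Y.UVert y) : X.UVert (f y) := ⟨f P.1, f.pathClass P.2⟩

theorem Map.uMap_step (f : Map Y X) {y : Y.Vert} {P Q : Y.UVert y} {e : Y.Edge}
    (h : P.Step e Q) : (f.uMap y P).Step (f e) (f.uMap y Q) := by
  obtain ⟨g, rfl, h⟩ := h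
  refine ⟨f.skel.map g, rfl, ?_⟩
  change f.pathClass Q.2 = _
  rw [h, f.pathClass_comp]
  rfl

theorem walk_of_uwalk {x : X.Vert} {P Q : X.UVert x} {l : List X.Edge}
    (h : (X.uTransport x).Walk P l Q) : X.vertTransport.Walk P.1 l Q.1 := by
  obtain ⟨p, rfl, -⟩ := exists_path_of_uwalk h
  exact walk_word p

/-- Local isometries are injective on universal covers, in particular on fundamental groups. -/
theorem Map.IsLocalIsometry.uMap_injective (hX : X.NonpositivelyCurved) {f : Map Y X}
    (hf : f.IsLocalIsometry) (y : Y.Vert) : Function.Injective (f.uMap y) := by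
  intro P P' h
  have hY := hf.npc hX
  obtain ⟨l, hl⟩ := exists_uwalk P
  obtain ⟨l', hl'⟩ := exists_uwalk P'
  have r := Red.ops hY (r := []) trivial l
  have r' := Red.ops hY (r := []) trivial l'
  have w := hl.ops hY
  have w' := hl'.ops hY
  have m := w.map (T' := X.uTransport (f y)) f (f.uMap y) f.uMap_step
  have m' := w'.map (T' := X.uTransport (f y)) f (f.uMap y) f.uMap_step
  rw [← h] at m'
  have hs := shuf_of_uwalk hX m m' (hf.red_map hX (walk_of_uwalk w) r)
    (hf.red_map hX (walk_of_uwalk w') r')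
  obtain ⟨l'', h1, h2⟩ := hf.lift_shuf (walk_of_uwalk w) hs
  have w'' := w.shuf h1
  rw [hf.word_injective (walk_of_uwalk w'') (walk_of_uwalk w') h2] at w''
  exact w''.unique w'

/-! ### Simply connected complexes -/

/-- Reduced words with the same endpoints agree up to shuffling. For nonpositively curved complexes,
this means that every component is simply connected. -/
def UniqueReduced (Z : CubeComplex.{u}) : Prop :=
  ∀ {v w : Z.Vert} {l l' : List Z.Edge}, Z.vertTransport.Walk v l w → Z.vertTransport.Walk v l' w →
    Red l → Red l' → Shuf l l'

/-- A local isometry of a connected complex to a simply connected one is injective: a reduced path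
between two vertices with the same image maps to a reduced closed path. -/
theorem Map.IsLocalIsometry.injective_vert (hX : X.NonpositivelyCurved) {f : Map Y X}
    (hf : f.IsLocalIsometry) (hY : Y.Connected) (h : X.UniqueReduced) {v w : Y.Vert}
    (hvw : f v = f w) : v = w := by
  obtain ⟨l, hl⟩ := (connected_iff.1 hY).2 v w
  have w1 := hl.ops (hf.npc hX)
  have r := Red.ops (hf.npc hX) (r := []) trivial l
  have w2 := walk_map f w1
  rw [← hvw] at w2
  have hs := h (EdgeTransport.walk_nil _) w2 trivial (hf.red_map hX w1 r)
  have h3 := hs.nil_left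
  rw [List.map_eq_nil_iff] at h3
  rw [h3] at w1
  exact w1

/-! ### The universal cover -/

section UniversalCover

variable {x : X.Vert}

/-- The covering projection of the universal cover. -/
def uproj (X : CubeComplex.{u}) (x : X.Vert) : Map (X.universalCover x) X where
  toFun c := c.cube
  map_face _ _ := rfl

/-- The path class that a vertex of the universal cover stands for. -/
def upt (v : (X.universalCover x).Vert) : X.UVert x := v.pt fun _ => false

/-- The vertex of the universal cover given by a path class. -/
def uvert (P : X.UVert x) : (X.universalCover x).Vert where
  cube := P.1
  pt _ := P
  pt_fst _ := (vertex_zero _ _).symm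
  step σ := (σ.dir 0).elim0

theorem upt_fst (v : (X.universalCover x).Vert) : (upt v).1 = X.uproj x v :=
  (v.pt_fst _).trans (vertex_zero _ _)

theorem uvert_upt (v : (X.universalCover x).Vert) : uvert (upt v) = v := by
  apply UCube.ext
  · exact upt_fst v
  · funext a
    exact congrArg v.pt (Subsingleton.elim _ _)

theorem upt_injective {v w : (X.universalCover x).Vert} (h : upt v = upt w) : v = w := by
  rw [← uvert_upt v, ← uvert_upt w, h]

theorem upt_vertex {n : ℕ} (c : (X.universalCover x).Cube n) (a : Fin n → Bool) :
    upt ((X.universalCover x).vertex c a) = c.pt a := by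
  change c.pt ((FaceMap.vertex a).app _) = _
  rw [FaceMap.app_const_false]
  rfl

theorem upt_origin {n : ℕ} (c : (X.universalCover x).Cube n) :
    upt ((X.universalCover x).origin c) = c.pt fun _ => false :=
  upt_vertex c _

theorem ustep_edge (e : (X.universalCover x).Edge) :
    (upt ((X.universalCover x).source e)).Step (X.uproj x e)
      (upt ((X.universalCover x).target e)) := by
  have h := e.step (FaceMap.id 1)
  rw [FaceMap.id_app, FaceMap.id_app, X.face_id] at h
  rw [source, target, upt_vertex, upt_vertex]
  exact h

theorem uwalk_of_walk {v w : (X.universalCover x).Vert} {l : List (X.universalCover x).Edge}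
    (h : (X.universalCover x).vertTransport.Walk v l w) :
    (X.uTransport x).Walk (upt v) (l.map fun e => X.uproj x e) (upt w) :=
  h.map (X.uproj x) upt fun {P e Q} he => by
    have := ustep_edge e
    rwa [he.1, he.2] at this

theorem uproj_lift (v : (X.universalCover x).Vert) {n : ℕ} (c : X.Cube n)
    (h : X.origin c = X.uproj x v) :
    ∃! c' : (X.universalCover x).Cube n, (X.universalCover x).origin c' = v ∧ X.uproj x c' = c := by
  have hP : (X.uTransport x).proj (upt v) = X.origin c := (upt_fst v).trans h.symm
  obtain ⟨pt, h0, h1, h2⟩ := (X.uTransport x).exists_fill c (upt v) hP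
  refine ⟨⟨c, pt, h1, h2⟩, ⟨upt_injective ((upt_origin _).trans h0), rfl⟩, ?_⟩
  · rintro c' ⟨h3, rfl⟩
    apply UCube.ext
    · rfl
    · refine (X.uTransport x).fill_unique hP ?_ h0 c'.step h2
      rw [← upt_origin, h3]

theorem exists_walk_of_uwalk {P Q : X.UVert x} {l : List X.Edge}
    (h : (X.uTransport x).Walk P l Q) : ∃ l' : List (X.universalCover x).Edge,
      (X.universalCover x).vertTransport.Walk (uvert P) l' (uvert Q) ∧
        (l'.map fun e => X.uproj x e) = l := by
  induction l generalizing Q with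
  | nil => cases h; exact ⟨[], rfl, rfl⟩
  | cons e l ih =>
    obtain ⟨R, h1, h2⟩ := h
    obtain ⟨l', h3, rfl⟩ := ih h1
    obtain ⟨e', ⟨h4, rfl⟩, -⟩ := uproj_lift (uvert R) e ((X.uTransport x).source h2)
    refine ⟨e' :: l', ⟨_, h3, h4, ?_⟩, rfl⟩
    have h5 := ustep_edge e'
    change (X.universalCover x).source e' = _ at h4
    rw [h4] at h5
    exact upt_injective ((X.uTransport x).unique h5 h2)

theorem universalCover_connected (x : X.Vert) : (X.universalCover x).Connected := by
  rw [connected_iff]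
  refine ⟨⟨uvert ⟨x, .mk .nil⟩⟩, ?_⟩
  have key : ∀ w, ∃ l, (X.universalCover x).vertTransport.Walk (uvert ⟨x, .mk .nil⟩) l w := by
    intro w
    obtain ⟨l, hl⟩ := exists_uwalk (upt w)
    obtain ⟨l', h, -⟩ := exists_walk_of_uwalk hl
    rw [uvert_upt] at h
    exact ⟨l', h⟩
  intro v w
  obtain ⟨l, hl⟩ := key v
  obtain ⟨l', hl'⟩ := key w
  exact ⟨_, hl.reverse.append hl'⟩

theorem uproj_isCover (hX : X.Connected) (x : X.Vert) : (X.uproj x).IsCover where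
  connected := universalCover_connected x
  surjective v := by
    obtain ⟨p⟩ := hX.2 x v
    exact ⟨uvert ⟨v, .mk p⟩, rfl⟩
  lift v _ c h := uproj_lift v c h

theorem uproj_isLocalIsometry (x : X.Vert) : (X.uproj x).IsLocalIsometry where
  link_injective c c' h h' := by
    obtain ⟨d, -, hd⟩ := uproj_lift ((X.universalCover x).origin c) (X.uproj x c)
      ((X.uproj x).map_origin c).symm
    rw [hd c ⟨rfl, rfl⟩, hd c' ⟨h.symm, h'.symm⟩]
  link_full y n c h _ := (uproj_lift y c h).exists

theorem universalCover_npc (hX : X.NonpositivelyCurved) (x : X.Vert) :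
    (X.universalCover x).NonpositivelyCurved :=
  (uproj_isLocalIsometry x).npc hX

theorem universalCover_uniqueReduced (hX : X.NonpositivelyCurved) (x : X.Vert) :
    (X.universalCover x).UniqueReduced := by
  intro v w l l' hl hl' r r'
  have hf := uproj_isLocalIsometry x
  obtain ⟨l'', h1, h2⟩ := hf.lift_shuf hl (shuf_of_uwalk hX (uwalk_of_walk hl)
    (uwalk_of_walk hl') (hf.red_map hX hl r) (hf.red_map hX hl' r'))
  rwa [hf.word_injective (hl.shuf h1) hl' h2] at h1

end UniversalCover

/-! ### The distance to a convex set of vertices -/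

/-- A set of vertices that contains all reduced paths between its points. -/
def GeodesicallyConvex (S : Set Z.Vert) : Prop :=
  ∀ {v w : Z.Vert} {l : List Z.Edge}, v ∈ S → w ∈ S → Z.vertTransport.Walk v l w → Red l →
    ∀ e ∈ l, Z.source e ∈ S ∧ Z.target e ∈ S

/-- The combinatorial distance of a vertex to a set of vertices. -/
noncomputable def distTo (S : Set Z.Vert) (z : Z.Vert) : ℕ :=
  sInf {n | ∃ v ∈ S, ∃ l, Z.vertTransport.Walk v l z ∧ l.length = n}

theorem distTo_le {S : Set Z.Vert} {v z : Z.Vert} (hv : v ∈ S) {l : List Z.Edge}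
    (h : Z.vertTransport.Walk v l z) : distTo S z ≤ l.length :=
  Nat.sInf_le ⟨v, hv, l, h, rfl⟩

theorem exists_distTo (hC : Z.Connected) {S : Set Z.Vert} (hS : S.Nonempty) (z : Z.Vert) :
    ∃ v ∈ S, ∃ l, Z.vertTransport.Walk v l z ∧ l.length = distTo S z := by
  apply Nat.sInf_mem (s := {n | ∃ v ∈ S, ∃ l, Z.vertTransport.Walk v l z ∧ l.length = n})
  obtain ⟨v, hv⟩ := hS
  obtain ⟨l, hl⟩ := (connected_iff.1 hC).2 v z
  exact ⟨_, v, hv, l, hl, rfl⟩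

theorem distTo_of_mem {S : Set Z.Vert} {z : Z.Vert} (h : z ∈ S) : distTo S z = 0 :=
  Nat.le_zero.1 (distTo_le h (EdgeTransport.walk_nil z))

theorem mem_of_distTo (hC : Z.Connected) {S : Set Z.Vert} (hS : S.Nonempty) {z : Z.Vert}
    (h : distTo S z = 0) : z ∈ S := by
  obtain ⟨v, hv, l, hl, hn⟩ := exists_distTo hC hS z
  rw [h, List.length_eq_zero_iff] at hn
  subst hn
  cases hl
  exact hv

theorem walk_edge (e : Z.Edge) : Z.vertTransport.step (Z.source e) e (Z.target e) := ⟨rfl, rfl⟩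

theorem distTo_target_le (hC : Z.Connected) {S : Set Z.Vert} (hS : S.Nonempty) (e : Z.Edge) :
    distTo S (Z.target e) ≤ distTo S (Z.source e) + 1 := by
  obtain ⟨v, hv, l, hl, hn⟩ := exists_distTo hC hS (Z.source e)
  rw [← hn]
  exact distTo_le hv (hl.cons (walk_edge e))

/-- The edge `e` leads away from `S`. -/
def Up (S : Set Z.Vert) (e : Z.Edge) : Prop := distTo S (Z.source e) < distTo S (Z.target e)

theorem Up.target_eq (hC : Z.Connected) {S : Set Z.Vert} (hS : S.Nonempty) {e : Z.Edge}
    (h : Up S e) : distTo S (Z.target e) = distTo S (Z.source e) + 1 :=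
  le_antisymm (distTo_target_le hC hS e) h

theorem up_rev {S : Set Z.Vert} {e : Z.Edge} :
    Up S (Z.rev e) ↔ distTo S (Z.target e) < distTo S (Z.source e) := by
  rw [Up, source_rev, target_rev]

section Gate

variable {S : Set Z.Vert}

theorem red_of_length_le (hZ : Z.NonpositivelyCurved) {v w : Z.Vert} {l : List Z.Edge}
    (hl : Z.vertTransport.Walk v l w)
    (h : ∀ m, Z.vertTransport.Walk v m w → l.length ≤ m.length) : Red l :=
  red_of_length_ops hZ (h _ (hl.ops hZ))

theorem Red.length_le (hZ : Z.NonpositivelyCurved) (hU : Z.UniqueReduced) {v w : Z.Vert}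
    {l m : List Z.Edge} (hr : Red l) (hl : Z.vertTransport.Walk v l w)
    (hm : Z.vertTransport.Walk v m w) : l.length ≤ m.length ∧ l.length % 2 = m.length % 2 := by
  have h := hU hl (hm.ops hZ) hr (Red.ops hZ (r := []) trivial m)
  rw [h.length_eq]
  exact length_ops hZ m

theorem length_map_rev (l : List Z.Edge) : (l.map Z.rev).reverse.length = l.length := by simp

/-- A shortest path to a convex set, followed by a reduced path in this set, is reduced. -/
theorem red_append_of_shortest (hZ : Z.NonpositivelyCurved) (hG : GeodesicallyConvex S)
    {z v v' : Z.Vert} {p r : List Z.Edge} (hv : v ∈ S) (hv' : v' ∈ S)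
    (hp : Z.vertTransport.Walk z p v) (hmin : p.length = distTo S z)
    (hr : Z.vertTransport.Walk v r v') (hred : Red r) : Red (r ++ p) := by
  have hp' : Red p := by
    refine red_of_length_le hZ hp fun m hm => ?_
    rw [hmin, ← length_map_rev m]
    exact distTo_le hv hm.reverse
  have hrS := hG hv hv' hr hred
  clear hv'
  -- Besides reducedness, show that an edge of `S` in which `r ++ p` can end is one in which `r` can
  -- end.
  suffices h : Red (r ++ p) ∧ ∀ e q, Z.source e ∈ S → Z.target e ∈ S → Shuf (r ++ p) (e :: q) →
      ∃ q', Shuf r (e :: q') from h.1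
  induction r generalizing v' with
  | nil =>
    refine ⟨hp', fun e q he _ hs => ?_⟩
    obtain ⟨w, h1, h2⟩ := hp.shuf hs
    have h3 := distTo_le (h2.1 ▸ he) h1.reverse
    have h4 := hs.length_eq
    rw [length_map_rev] at h3
    simp only [List.nil_append, List.length_cons] at h4
    omega
  | cons a r ih =>
    obtain ⟨w, h1, h2⟩ := hr
    obtain ⟨ih1, ih2⟩ := ih h1 hred.1 fun e he => hrS e (List.mem_cons_of_mem _ he)
    have ha := hrS a List.mem_cons_self
    refine ⟨⟨ih1, fun q hq => ?_⟩, fun e q he he' hs => ?_⟩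
    · obtain ⟨q', hq'⟩ := ih2 (Z.rev a) q (by rw [source_rev]; exact ha.2)
        (by rw [target_rev]; exact ha.1) hq
      exact hred.2 q' hq'
    · by_cases hae : a = e
      · subst hae
        exact ⟨r, .refl _⟩
      · obtain ⟨c, d, s, h3, h4, hsq⟩ := hs.exists_sq hae
        have hred2 : Red [Z.rev e, a] := by
          refine ⟨red_singleton a, fun q' h => hae ?_⟩
          rw [Z.rev_rev] at h
          have := h.symm
          cases this with
          | cons => rfl
          | swap _ h _ => cases h
        have hw : Z.vertTransport.Walk (Z.source a) [Z.rev e, a] (Z.source e) :=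
          ⟨Z.target a, .single (walk_edge a), by
            rw [source_rev]; exact hsq.target_eq.symm, target_rev _ _⟩
        have hsq' : Shuf [Z.rev e, a] [d, Z.rev c] := .of_sq hsq.rot.swap []
        have h5 := hG ha.1 he (hw.shuf hsq') (Red.of_shuf hZ hsq' hred2) (Z.rev c) (by simp)
        rw [source_rev, target_rev] at h5
        obtain ⟨q', h6⟩ := ih2 c s h5.2 h5.1 h3
        exact ⟨d :: q', Shuf.trans hZ (.cons a h6) (.of_sq hsq q')⟩

/-- The gate property: a path from `S` to `z` can be shortened to one through the gate of `z`. -/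
theorem length_through_gate (hZ : Z.NonpositivelyCurved) (hU : Z.UniqueReduced)
    (hG : GeodesicallyConvex S) {z v v' : Z.Vert} {p r m : List Z.Edge} (hv : v ∈ S) (hv' : v' ∈ S)
    (hp : Z.vertTransport.Walk v p z) (hmin : p.length = distTo S z)
    (hr : Z.vertTransport.Walk v r v') (hred : Red r) (hm : Z.vertTransport.Walk v' m z) :
    r.length + p.length ≤ m.length ∧ (r.length + p.length) % 2 = m.length % 2 := by
  have h := red_append_of_shortest hZ hG hv hv' hp.reverse ((length_map_rev p).trans hmin) hr hred
  have h2 := h.length_le hZ hU (hp.reverse.append hr) hm.reverse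
  rwa [List.length_append, length_map_rev, length_map_rev] at h2

end Gate

/-- `S` is a nonempty convex set of vertices of the CAT(0) cube complex `Z`, that is, `Z` is
nonpositively curved, connected and simply connected. -/
structure ConvexVerts (S : Set Z.Vert) : Prop where
  npc : Z.NonpositivelyCurved
  uniqueReduced : Z.UniqueReduced
  connected : Z.Connected
  nonempty : S.Nonempty
  convex : GeodesicallyConvex S

theorem exists_red_walk (hZ : Z.NonpositivelyCurved) (hC : Z.Connected) (v w : Z.Vert) :
    ∃ l, Z.vertTransport.Walk v l w ∧ Red l := by
  obtain ⟨l, hl⟩ := (connected_iff.1 hC).2 v w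
  exact ⟨_, hl.ops hZ, Red.ops hZ (r := []) trivial l⟩

namespace ConvexVerts

variable {S : Set Z.Vert}

/-- Two edges with the same target `z`, one of which comes from a point closer to `S` and the
other from a point at most as far from `S` as `z`, span a square. -/
theorem exists_sq (h : ConvexVerts S) {e f : Z.Edge} (he : ¬ Up S (Z.rev e)) (hf : Up S f)
    (hef : Z.target e = Z.target f) (hne : e ≠ f) : ∃ c c', Sq c e c' f ∧ Up S c := by
  obtain ⟨v, hv, p, hp, hpn⟩ := exists_distTo h.connected h.nonempty (Z.source f)
  obtain ⟨v', hv', q, hq, hqn⟩ := exists_distTo h.connected h.nonempty (Z.source e)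
  obtain ⟨r, hr, hrr⟩ := exists_red_walk h.npc h.connected v v'
  have hfp := hp.cons (walk_edge f)
  have heq := hq.cons (walk_edge e)
  rw [hef] at heq
  have hfn := hf.target_eq h.connected h.nonempty
  rw [up_rev, not_lt] at he
  have len : (f :: p).length = distTo S (Z.target f) := by rw [List.length_cons, hpn, hfn]
  have hg := fun {m} hm => length_through_gate h.npc h.uniqueReduced h.convex hv hv' hfp len hr hrr
    (m := m) hm
  -- The word `f p`, preceded by the inverse of `r`, is as short as `e q` by parity.
  have hw := hr.reverse.append hfp
  have hlen : (e :: q).length = r.length + (f :: p).length := by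
    have h1 := hg heq
    rw [hef] at he
    simp only [List.length_cons] at h1 ⊢
    omega
  have red1 : Red (e :: q) := red_of_length_le h.npc heq fun m hm => hlen ▸ (hg hm).1
  have red2 : Red ((f :: p) ++ (r.map Z.rev).reverse) := by
    refine red_of_length_le h.npc hw fun m hm => ?_
    rw [List.length_append, length_map_rev, add_comm]
    exact (hg hm).1
  obtain ⟨c, c', t, h1, -, hs⟩ := (h.uniqueReduced heq hw red1 red2).exists_sq hne
  refine ⟨c, c', hs, ?_⟩
  have h2 := h1.length_eq
  obtain ⟨w, h3, h4⟩ := hq.shuf h1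
  have h5 := distTo_le hv' h3
  rw [Up, h4.1, h4.2]
  rw [List.length_cons] at h2
  omega

theorem up_of_sq (h : ConvexVerts S) {a b c d : Z.Edge} (hs : Sq a b c d) (ha : Up S a) :
    Up S d := by
  have e1 := hs.source_eq
  have e2 := hs.target_left
  have e3 := hs.target_right
  have e4 := hs.target_eq
  have h1 := ha.target_eq h.connected h.nonempty
  by_cases hb : Up S b
  · have h2 := hb.target_eq h.connected h.nonempty
    have h3 := distTo_target_le h.connected h.nonempty c
    rw [Up, ← e3, ← e4]
    rw [e2] at h1
    rw [e1] at h1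
    omega
  · have hne : Z.rev b ≠ a := by
      have := h.npc.ne hs.rot
      intro h'
      apply this
      rw [← h', Z.rev_rev]
    obtain ⟨c1, c2, hs', hc1⟩ := h.exists_sq (e := Z.rev b) (by rwa [Z.rev_rev]) ha
      (by rw [target_rev, e2]) hne
    have hs2 := hs'.reverse
    rw [Z.rev_rev] at hs2
    obtain ⟨h3, -⟩ := h.npc.unique hs2 hs.rot.swap
    have h4 : c1 = d := by rw [← Z.rev_rev c1, h3, Z.rev_rev]
    rwa [h4] at hc1

theorem up_iff (h : ConvexVerts S) {a b c d : Z.Edge} (hs : Sq a b c d) : Up S a ↔ Up S d :=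
  ⟨h.up_of_sq hs, h.up_of_sq hs.rot'⟩

end ConvexVerts

/-! ### Thickening a convex set -/

/-- The edges that lead to `z` from a point closer to `S`. -/
def upEdges (S : Set Z.Vert) (z : Z.Vert) : Set Z.Edge := {e | Z.target e = z ∧ Up S e}

namespace ConvexVerts

variable {S : Set Z.Vert}

theorem encard_upEdges_le_succ (h : ConvexVerts S) {z : Z.Vert} {f : Z.Edge}
    (hf : f ∈ upEdges S z) :
    (upEdges S z).encard ≤ (upEdges S (Z.source f)).encard + 1 := by
  obtain ⟨rfl, hf⟩ := hf
  have key : ∀ e : Z.Edge, ∃ c : Z.Edge, e ∈ upEdges S (Z.target f) \ {f} →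
      c ∈ upEdges S (Z.source f) ∧ ∃ c', Sq c f c' e := by
    intro e
    by_cases he : e ∈ upEdges S (Z.target f) \ {f}
    · obtain ⟨⟨h1, h2⟩, h3⟩ := he
      have hfr : ¬ Up S (Z.rev f) := by rw [up_rev]; exact not_lt.2 (le_of_lt hf)
      obtain ⟨c, c', hs, hc⟩ := h.exists_sq hfr h2 h1.symm (fun h => h3 h.symm)
      exact ⟨c, fun _ => ⟨⟨hs.target_left, hc⟩, c', hs⟩⟩
    · exact ⟨e, fun h => absurd h he⟩
  choose φ hφ using key
  have h1 : (upEdges S (Z.target f) \ {f}).encard ≤ (upEdges S (Z.source f)).encard := by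
    refine Set.encard_le_encard_of_injOn (f := φ) (fun e he => (hφ e he).1)
      fun e he e' he' heq => ?_
    obtain ⟨c, hc⟩ := (hφ e he).2
    obtain ⟨c', hc'⟩ := (hφ e' he').2
    rw [← heq] at hc'
    exact (h.npc.unique_left hc hc').2
  calc (upEdges S (Z.target f)).encard
      ≤ (upEdges S (Z.target f) \ {f}).encard + ({f} : Set Z.Edge).encard :=
        Set.encard_le_encard_sdiff_add_encard _ _
    _ ≤ _ := by
        rw [Set.encard_singleton]
        gcongr

theorem encard_upEdges_le (h : ConvexVerts S) (z : Z.Vert) :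
    (upEdges S z).encard ≤ distTo S z := by
  induction hn : distTo S z using Nat.strong_induction_on generalizing z with
  | _ n ih =>
  subst hn
  rcases (upEdges S z).eq_empty_or_nonempty with he | ⟨f, hf⟩
  · simp [he]
  · refine (h.encard_upEdges_le_succ hf).trans ?_
    obtain ⟨rfl, hf⟩ := hf
    have := ih _ hf (Z.source f) rfl
    rw [hf.target_eq h.connected h.nonempty]
    push_cast
    gcongr

/-- The vertices `z` for which as many edges lead towards `S` as the distance of `z` to `S`
permits. They are the vertices of the cubes that meet `S`. -/
def _root_.CubeComplex.Thick (S : Set Z.Vert) (z : Z.Vert) : Prop :=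
  (distTo S z : ℕ∞) ≤ (upEdges S z).encard

theorem thick_source (h : ConvexVerts S) {e : Z.Edge} (he : Up S e) (ht : Thick S (Z.target e)) :
    Thick S (Z.source e) := by
  have h1 := ht.trans (h.encard_upEdges_le_succ ⟨rfl, he⟩)
  rw [he.target_eq h.connected h.nonempty] at h1
  push_cast at h1
  exact (ENat.add_le_add_iff_right (by simp)).1 h1

/-- If both ends of an edge are in the thickening and the edge does not lead towards `S`, then it
spans a square with each edge that leads towards `S`. -/
theorem exists_sq_of_thick (h : ConvexVerts S) {a e : Z.Edge} (ha : ¬ Up S (Z.rev a))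
    (h1 : Thick S (Z.target a)) (he : e ∈ upEdges S (Z.source a)) :
    ∃ c d, Sq e a c d := by
  by_cases hup : Up S a
  · have key : ∀ e' : Z.Edge, ∃ e : Z.Edge, e' ∈ upEdges S (Z.target a) \ {a} →
        e ∈ upEdges S (Z.source a) ∧ ∃ c, Sq e a c e' := by
      intro e'
      by_cases he : e' ∈ upEdges S (Z.target a) \ {a}
      · obtain ⟨⟨h1, h2⟩, h3⟩ := he
        obtain ⟨c, c', hs, hc⟩ := h.exists_sq ha h2 h1.symm (fun h => h3 h.symm)
        exact ⟨c, fun _ => ⟨⟨hs.target_left, hc⟩, c', hs⟩⟩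
      · exact ⟨e', fun h => absurd h he⟩
    choose φ hφ using key
    have hinj : Set.InjOn φ (upEdges S (Z.target a) \ {a}) := by
      intro e he e' he' heq
      obtain ⟨c, hc⟩ := (hφ e he).2
      obtain ⟨c', hc'⟩ := (hφ e' he').2
      rw [← heq] at hc'
      exact (h.npc.unique_left hc hc').2
    have hle : (upEdges S (Z.source a)).encard ≤ (φ '' (upEdges S (Z.target a) \ {a})).encard := by
      rw [hinj.encard_image]
      refine (h.encard_upEdges_le _).trans ?_
      have h2 := h1
      rw [Thick, hup.target_eq h.connected h.nonempty] at h2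
      have h3 := Set.encard_sdiff_add_encard_of_subset
        (Set.singleton_subset_iff.2 (show a ∈ upEdges S (Z.target a) from ⟨rfl, hup⟩))
      rw [← h3, Set.encard_singleton] at h2
      push_cast at h2
      exact (ENat.add_le_add_iff_right (by simp)).1 h2
    have hfin : (upEdges S (Z.source a)).Finite :=
      Set.finite_of_encard_le_coe (h.encard_upEdges_le _)
    have heq := hfin.eq_of_subset_of_encard_le'
      (s := φ '' (upEdges S (Z.target a) \ {a})) (by
        rintro _ ⟨e', he', rfl⟩
        exact (hφ e' he').1) hle
    rw [← heq] at he
    obtain ⟨e', he', rfl⟩ := he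
    obtain ⟨c, hc⟩ := (hφ e' he').2
    exact ⟨c, e', hc⟩
  · obtain ⟨c, c', hs, -⟩ := h.exists_sq (e := Z.rev a) (by rwa [Z.rev_rev]) he.2
      (by rw [target_rev, he.1]) (fun h' => ha (h' ▸ he.2))
    have h2 := hs.rot'
    rw [Z.rev_rev] at h2
    exact ⟨_, _, h2⟩

/-- The thickening of a convex set is locally convex. -/
theorem thick_of_sq (h : ConvexVerts S) {a b c d : Z.Edge} (hs : Sq a b c d)
    (h0 : Thick S (Z.source a)) (h1 : Thick S (Z.target a)) (h2 : Thick S (Z.target c)) :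
    Thick S (Z.target b) := by
  have hZ := h.npc
  have hS := h.nonempty
  have hC := h.connected
  have e1 := hs.source_eq
  have e2 := hs.target_left
  have e3 := hs.target_right
  have e4 := hs.target_eq
  by_cases ha : Up S (Z.rev a)
  · have h3 := h.thick_source (h.up_of_sq hs.rot ha) (by rwa [target_rev, ← e3])
    rwa [source_rev, ← e4] at h3
  by_cases hc : Up S (Z.rev c)
  · have h3 := h.thick_source (h.up_of_sq hs.swap.rot hc) (by rwa [target_rev, ← e2])
    rwa [source_rev] at h3
  have hd : Up S a ↔ Up S d := h.up_iff hs
  have hb : Up S c ↔ Up S b := h.up_iff hs.swap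
  -- Transport the edges that lead towards `S` across the 3-cubes spanned by them and the square.
  have key : ∀ e : Z.Edge, ∃ e3 : Z.Edge, e ∈ upEdges S (Z.source a) →
      e3 ∈ upEdges S (Z.target b) \ {b, d} ∧ ∃ g e1 g', Sq e a g e1 ∧ Sq e1 b g' e3 := by
    intro e
    by_cases he : e ∈ upEdges S (Z.source a)
    · obtain ⟨g1, f1, s1⟩ := h.exists_sq_of_thick ha h1 he
      obtain ⟨g2, f2, s2⟩ := h.exists_sq_of_thick hc h2 (by rwa [← e1])
      obtain ⟨k, m, l, -, s3, s4⟩ := hZ.cube s1.rot s2.rot hs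
      have s3' := s3.rot
      rw [Z.rev_rev] at s3'
      have s4' := s4.rot
      rw [Z.rev_rev] at s4'
      refine ⟨Z.rev l, fun _ => ⟨⟨⟨s3'.target_eq.symm, ?_⟩, ?_⟩, g1, f1, k, s1, s3'⟩⟩
      · exact h.up_of_sq s3' (h.up_of_sq s1 he.2)
      · rintro (h' | h')
        · exact hZ.ne s3'.reverse (by rw [← h'])
        · exact hZ.ne s4'.reverse (by rw [← h'])
    · exact ⟨e, fun h => absurd h he⟩
  choose φ hφ using key
  have hle : (upEdges S (Z.source a)).encard ≤ (upEdges S (Z.target b) \ {b, d}).encard := by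
    refine Set.encard_le_encard_of_injOn (f := φ) (fun e he => (hφ e he).1)
      fun e he e' he' heq => ?_
    obtain ⟨g, f, g', s1, s2⟩ := (hφ e he).2
    obtain ⟨k, f', k', s3, s4⟩ := (hφ e' he').2
    rw [← heq] at s4
    have h5 := (hZ.unique s2.reverse s4.reverse).1
    rw [show f' = f by rw [← Z.rev_rev f, h5, Z.rev_rev]] at s3
    have h6 := (hZ.unique s1.reverse s3.reverse).1
    rw [← Z.rev_rev e, h6, Z.rev_rev]
  have hle' := le_trans h0 hle
  have hsub : upEdges S (Z.target b) \ {b, d} ⊆ upEdges S (Z.target b) := Set.sdiff_subset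
  have hbd : b ≠ d := by
    intro h'
    exact hZ.ne hs.reverse (by rw [h'])
  unfold Thick
  by_cases hua : Up S a
  · have k1 := hua.target_eq hC hS
    have hda : d ∈ upEdges S (Z.target b) := ⟨e4.symm, hd.1 hua⟩
    have hdn : d ∉ upEdges S (Z.target b) \ {b, d} := fun h' => h'.2 (by simp)
    by_cases huc : Up S c
    · have hub := hb.1 huc
      have k2 := hub.target_eq hC hS
      have hbn : b ∉ insert d (upEdges S (Z.target b) \ {b, d}) := by
        rintro (h' | h')
        · exact hbd h'
        · exact h'.2 (by simp)
      have h7 : insert b (insert d (upEdges S (Z.target b) \ {b, d})) ⊆ upEdges S (Z.target b) :=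
        Set.insert_subset ⟨rfl, hub⟩ (Set.insert_subset hda hsub)
      refine le_trans ?_ (Set.encard_le_encard h7)
      rw [Set.encard_insert_of_notMem hbn, Set.encard_insert_of_notMem hdn, k2, ← e2, k1]
      push_cast
      gcongr
    · have k2 : distTo S (Z.target b) ≤ distTo S (Z.source b) := not_lt.1 (mt hb.2 huc)
      rw [← e2, k1] at k2
      refine le_trans ?_ (Set.encard_le_encard (Set.insert_subset hda hsub))
      rw [Set.encard_insert_of_notMem hdn]
      refine le_trans (Nat.cast_le.2 k2) ?_
      push_cast
      gcongr
  · have k1 : distTo S (Z.target a) ≤ distTo S (Z.source a) := not_lt.1 hua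
    by_cases huc : Up S c
    · have hub := hb.1 huc
      have k2 := hub.target_eq hC hS
      have hbn : b ∉ upEdges S (Z.target b) \ {b, d} := fun h' => h'.2 (by simp)
      refine le_trans ?_ (Set.encard_le_encard
        (Set.insert_subset (show b ∈ upEdges S (Z.target b) from ⟨rfl, hub⟩) hsub))
      rw [Set.encard_insert_of_notMem hbn, k2, ← e2]
      push_cast
      gcongr
      exact le_trans (Nat.cast_le.2 k1) hle'
    · have k2 : distTo S (Z.target b) ≤ distTo S (Z.source b) := not_lt.1 (mt hb.2 huc)
      rw [← e2] at k2
      exact le_trans (Nat.cast_le.2 (k2.trans k1)) (hle'.trans (Set.encard_le_encard hsub))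

end ConvexVerts

/-! ### Parallel closed families of edges -/

/-- A set of edges that is closed under reversal and under passing to the opposite edge of a square;
in other words, the edges dual to a set of hyperplanes. -/
structure ParallelClosed (E : Set Z.Edge) : Prop where
  rev : ∀ e ∈ E, Z.rev e ∈ E
  par : ∀ {a b c d}, Sq a b c d → a ∈ E → d ∈ E

namespace ParallelClosed

variable {E : Set Z.Edge}

theorem par' (hE : ParallelClosed E) {a b c d : Z.Edge} (h : Sq a b c d) (hb : b ∈ E) : c ∈ E :=
  hE.par h.swap.rot' hb

theorem forall_shuf (hE : ParallelClosed E) {p q : List Z.Edge} (h : Shuf p q) :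
    (∀ e ∈ p, e ∈ E) ↔ ∀ e ∈ q, e ∈ E :=
  h.forall_mem fun _ _ _ _ hs ha hb => ⟨hE.par' hs hb, hE.par hs ha⟩

theorem forall_ops (hZ : Z.NonpositivelyCurved) (hE : ParallelClosed E) {l : List Z.Edge}
    (h : ∀ e ∈ l, e ∈ E) : ∀ e ∈ ops [] l, e ∈ E :=
  op_forall_mem hZ (fun _ _ _ _ hs ha hb => ⟨hE.par' hs hb, hE.par hs ha⟩) h

theorem edge_mem (hE : ParallelClosed E) {n : ℕ} {c : Z.Cube n} (h : ∀ i, Z.axis c i ∈ E)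
    (i : Fin n) (a : Fin n → Bool) : Z.edge c i a ∈ E := by
  revert i
  refine vertex_induction (P := fun a => ∀ i, Z.edge c i a ∈ E) h (fun a j hj ih i => ?_) a
  by_cases hij : i = j
  · subst hij
    have := hE.rev _ (ih i)
    rwa [rev_edge, hj] at this
  · have := hE.par (sq_of_cube c hij a) (ih i)
    rwa [hj] at this

/-- If `E` has finitely many edges at a vertex `v`, then `v` is in finitely many cubes all of whose
edges are in `E`. -/
theorem finite_cubes (hZ : Z.NonpositivelyCurved) {v : Z.Vert}
    (hfin : {e ∈ E | Z.source e = v}.Finite) :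
    {c : Σ n, Z.Cube n | Z.origin c.2 = v ∧ ∀ i, Z.axis c.2 i ∈ E}.Finite := by
  have h1 : ∀ n : ℕ, {c : Z.Cube n | Z.origin c = v ∧ ∀ i, Z.axis c i ∈ E}.Finite := by
    intro n
    refine Set.Finite.of_injOn (f := fun c => Z.axis c)
      (t := {f : Fin n → Z.Edge | ∀ i, f i ∈ {e ∈ E | Z.source e = v}}) ?_ ?_
      (Set.Finite.pi' fun _ => hfin)
    · rintro c ⟨h1, h2⟩ i
      exact ⟨h2 i, by rw [source_axis, h1]⟩
    · rintro c ⟨h1, -⟩ c' ⟨h2, -⟩ h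
      exact hZ.eq_of_axis_eq c c' (h1.trans h2.symm) h
  refine ((Set.finite_Iic hfin.toFinset.card).biUnion fun n _ => (h1 n).image (Sigma.mk n)).subset
    ?_
  rintro ⟨n, c⟩ ⟨h2, h3⟩
  simp only [Set.mem_iUnion]
  refine ⟨n, ?_, c, ⟨h2, h3⟩, rfl⟩
  have := Finset.card_le_card_of_injOn (s := Finset.univ) (t := hfin.toFinset)
    (fun i => Z.axis c i) (fun i _ => by simpa using ⟨h3 i, (source_axis c i).trans h2⟩)
    (hZ.axis_injective c).injOn
  simpa using this

end ParallelClosed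

theorem edge_eq_or (e : Z.Edge) (i : Fin 1) (a : Fin 1 → Bool) :
    Z.edge e i a = e ∨ Z.edge e i a = Z.rev e := by
  obtain rfl := Subsingleton.elim i 0
  rcases h : a 0 with _ | _
  · left
    rw [show a = fun _ => false by funext j; rw [Subsingleton.elim j 0, h], edge_zero_false]
  · right
    rw [show a = fun _ => true by funext j; rw [Subsingleton.elim j 0, h]]
    rfl

theorem vertex_eq_or (e : Z.Edge) (a : Fin 1 → Bool) :
    Z.vertex e a = Z.source e ∨ Z.vertex e a = Z.target e := by
  rcases h : a 0 with _ | _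
  · left
    rw [show a = fun _ => false by funext j; rw [Subsingleton.elim j 0, h]]
    rfl
  · right
    rw [show a = fun _ => true by funext j; rw [Subsingleton.elim j 0, h]]
    rfl

/-! ### Subcomplexes -/

theorem Subcomplex.vertex_mem (Y : Z.Subcomplex) {n : ℕ} {c : Z.Cube n} (h : c ∈ Y.cubes n)
    (a : Fin n → Bool) : Z.vertex c a ∈ Y.cubes 0 :=
  Y.face_mem _ _ h

theorem Subcomplex.source_mem (Y : Z.Subcomplex) {e : Z.Edge} (h : e ∈ Y.cubes 1) :
    Z.source e ∈ Y.cubes 0 :=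
  Y.face_mem _ _ h

theorem Subcomplex.target_mem (Y : Z.Subcomplex) {e : Z.Edge} (h : e ∈ Y.cubes 1) :
    Z.target e ∈ Y.cubes 0 :=
  Y.face_mem _ _ h

theorem Subcomplex.lift_walk (Y : Z.Subcomplex) {v : Z.Vert} (hv : v ∈ Y.cubes 0) :
    ∀ {l : List Z.Edge} {w : Z.Vert}, Z.vertTransport.Walk v l w → (∀ e ∈ l, e ∈ Y.cubes 1) →
      ∃ hw : w ∈ Y.cubes 0, ∃ l', Y.toCubeComplex.vertTransport.Walk ⟨v, hv⟩ l' ⟨w, hw⟩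
  | [], _, h, _ => by cases h; exact ⟨hv, [], rfl⟩
  | e :: l, _, ⟨z, h1, h2⟩, h => by
    obtain ⟨hz, l', hl'⟩ := Y.lift_walk hv h1 fun e he => h e (List.mem_cons_of_mem _ he)
    have he := h e List.mem_cons_self
    exact ⟨h2.2 ▸ Y.target_mem he, ⟨e, he⟩ :: l', _, hl', Subtype.ext h2.1, Subtype.ext h2.2⟩

/-- The set of vertices of a convex subcomplex is convex, and the subcomplex contains the reduced
paths between its vertices. -/
theorem Subcomplex.IsConvex.mem_of_red (hZ : Z.NonpositivelyCurved) (hU : Z.UniqueReduced)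
    {Y : Z.Subcomplex} (hY : Y.IsConvex) {v w : Z.Vert} {l : List Z.Edge} (hv : v ∈ Y.cubes 0)
    (hw : w ∈ Y.cubes 0) (hl : Z.vertTransport.Walk v l w) (hr : Red l) :
    ∀ e ∈ l, e ∈ Y.cubes 1 := by
  obtain ⟨m, hm, hmr⟩ := exists_red_walk (hY.2.npc hZ) hY.1 ⟨v, hv⟩ ⟨w, hw⟩
  have hs := hU (walk_map Y.incl hm) hl (hY.2.red_map hZ hm hmr) hr
  obtain ⟨l', -, rfl⟩ := hY.2.lift_shuf hm hs
  intro e he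
  rw [List.mem_map] at he
  obtain ⟨e', -, rfl⟩ := he
  exact e'.2

theorem Subcomplex.IsConvex.convexVerts (hZ : Z.NonpositivelyCurved) (hU : Z.UniqueReduced)
    (hC : Z.Connected) {Y : Z.Subcomplex} (hY : Y.IsConvex) : ConvexVerts (Y.cubes 0) where
  npc := hZ
  uniqueReduced := hU
  connected := hC
  nonempty := by
    obtain ⟨v⟩ := hY.1.1
    exact ⟨v.1, v.2⟩
  convex := by
    intro v w l hv hw hl hr e he
    have := hY.mem_of_red hZ hU hv hw hl hr e he
    exact ⟨Y.source_mem this, Y.target_mem this⟩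

/-- The subcomplex of all cubes with edges in `E` and vertices in `W`. -/
def spanned (E : Set Z.Edge) (W : Set Z.Vert) : Z.Subcomplex where
  cubes n := {c | (∀ i a, Z.edge c i a ∈ E) ∧ ∀ a, Z.vertex c a ∈ W}
  face_mem σ c h := ⟨fun i a => by rw [edge_face]; exact h.1 _ _, fun a => by
    rw [vertex_face]; exact h.2 _⟩

theorem mem_spanned_vert {E : Set Z.Edge} {W : Set Z.Vert} {v : Z.Vert} :
    v ∈ (spanned E W).cubes 0 ↔ v ∈ W :=
  ⟨fun h => by simpa [vertex_zero] using h.2 fun _ => false,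
    fun h => ⟨fun i => i.elim0, fun a => by rwa [vertex_zero]⟩⟩

theorem mem_spanned_edge {E : Set Z.Edge} (hE : ParallelClosed E) {W : Set Z.Vert} {e : Z.Edge}
    (he : e ∈ E) (h1 : Z.source e ∈ W) (h2 : Z.target e ∈ W) : e ∈ (spanned E W).cubes 1 := by
  refine ⟨fun i a => ?_, fun a => ?_⟩
  · rcases edge_eq_or e i a with h | h <;> rw [h]
    · exact he
    · exact hE.rev e he
  · rcases vertex_eq_or e a with h | h <;> rwa [h]

/-- A full set of vertices spans a locally convex subcomplex as soon as it contains the fourth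
vertex of each square of which it contains three vertices. -/
theorem spanned_isLocalIsometry {E : Set Z.Edge} (hE : ParallelClosed E) {W : Set Z.Vert}
    (hW : ∀ {a b c d}, Sq a b c d → a ∈ E → c ∈ E → Z.source a ∈ W → Z.target a ∈ W →
      Z.target c ∈ W → Z.target b ∈ W) : (spanned E W).incl.IsLocalIsometry where
  link_injective c c' _ h := Subtype.ext h
  link_full := by
    rintro ⟨y, hy⟩ n c h0 hax
    have hax' : ∀ i, Z.axis c i ∈ (spanned E W).cubes 1 := by
      intro i
      obtain ⟨e, -, he⟩ := hax i
      rw [← he]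
      exact e.2
    have hcE : ∀ i a, Z.edge c i a ∈ E :=
      hE.edge_mem fun i => by
        have := (hax' i).1 0 fun _ => false
        rwa [edge_zero_false] at this
    have hcW : ∀ a : Fin n → Bool, Z.vertex c a ∈ W ∧
        ∀ i, a i = false → Z.vertex c (Function.update a i true) ∈ W := by
      refine vertex_induction ⟨?_, fun i _ => ?_⟩ fun a i hi ih => ⟨ih.2 i hi, fun j hj => ?_⟩
      · change Z.origin c ∈ W
        rw [h0]
        exact mem_spanned_vert.1 hy
      · have := mem_spanned_vert.1 ((spanned E W).target_mem (hax' i))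
        rwa [axis, target_edge] at this
      · have hij : i ≠ j := by
          rintro rfl
          simp at hj
        rw [Function.update_of_ne hij.symm] at hj
        have hs := sq_of_cube c hij a
        have := hW hs (hcE _ _) (hcE _ _) (by rw [source_edge]; exact ih.1)
          (by rw [target_edge, hi]; exact ih.2 i hi) (by rw [target_edge, hj]; exact ih.2 j hj)
        rwa [target_edge, Function.update_of_ne hij.symm, hi, hj] at this
    exact ⟨⟨c, hcE, fun a => (hcW a).1⟩, Subtype.ext h0, rfl⟩

/-! ### Thickening a convex subcomplex -/

/-- `z` can be reached from `S` along edges of `E`. -/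
def ReachedBy (S : Set Z.Vert) (E : Set Z.Edge) (z : Z.Vert) : Prop :=
  ∃ v ∈ S, ∃ l, Z.vertTransport.Walk v l z ∧ ∀ e ∈ l, e ∈ E

theorem ReachedBy.cons {S : Set Z.Vert} {E : Set Z.Edge} {e : Z.Edge}
    (h : ReachedBy S E (Z.source e)) (he : e ∈ E) : ReachedBy S E (Z.target e) := by
  obtain ⟨v, hv, l, hl, hlE⟩ := h
  exact ⟨v, hv, e :: l, hl.cons (walk_edge e), List.forall_mem_cons.2 ⟨he, hlE⟩⟩

theorem ReachedBy.cons_rev {S : Set Z.Vert} {E : Set Z.Edge} (hE : ParallelClosed E) {e : Z.Edge}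
    (h : ReachedBy S E (Z.target e)) (he : e ∈ E) : ReachedBy S E (Z.source e) := by
  have := ReachedBy.cons (e := Z.rev e) (by rwa [source_rev]) (hE.rev e he)
  rwa [target_rev] at this

namespace ConvexVerts

variable {S : Set Z.Vert} {E : Set Z.Edge}

theorem upEdges_subset (h : ConvexVerts S) (hE : ParallelClosed E) {z : Z.Vert}
    (hz : ReachedBy S E z) : upEdges S z ⊆ E := by
  rintro e ⟨rfl, he⟩
  obtain ⟨v, hv, l, hl, hlE⟩ := hz
  obtain ⟨v', hv', p, hp, hpn⟩ := exists_distTo h.connected h.nonempty (Z.source e)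
  obtain ⟨r, hr, hrr⟩ := exists_red_walk h.npc h.connected v' v
  have hep := hp.cons (walk_edge e)
  have hred := red_append_of_shortest h.npc h.convex hv' hv hep.reverse
    (by rw [length_map_rev, List.length_cons, hpn, he.target_eq h.connected h.nonempty]) hr hrr
  have hs := h.uniqueReduced (hl.reverse.ops h.npc) (hep.reverse.append hr)
    (Red.ops h.npc (r := []) trivial _) hred
  have h1 := (hE.forall_shuf hs).1 (hE.forall_ops h.npc (by
    intro e he
    rw [List.mem_reverse, List.mem_map] at he
    obtain ⟨e', he', rfl⟩ := he
    exact hE.rev _ (hlE e' he'))) (Z.rev e) (by simp)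
  have h2 := hE.rev _ h1
  rwa [Z.rev_rev] at h2

/-- The vertices of the thickening are the vertices of cubes that meet `S`. -/
theorem exists_cube_of_thick (h : ConvexVerts S) (hE : ParallelClosed E) {z : Z.Vert}
    (hz : ReachedBy S E z) (ht : Thick S z) :
    ∃ (n : ℕ) (c : Z.Cube n) (a : Fin n → Bool), Z.origin c ∈ S ∧ (∀ i, Z.axis c i ∈ E) ∧
      Z.vertex c a = z := by
  obtain ⟨t, ht1, ht2⟩ := Set.exists_subset_encard_eq ht
  have htf : t.Finite := Set.finite_of_encard_eq_coe ht2
  have hcard : htf.toFinset.card = distTo S z := by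
    rw [htf.encard_eq_coe_toFinset_card] at ht2
    exact_mod_cast ht2
  let g := htf.toFinset.equivFin.symm
  let e : Fin htf.toFinset.card → Z.Edge := fun i => (g i).1
  have he : ∀ i, e i ∈ upEdges S z := fun i => ht1 (htf.mem_toFinset.1 (g i).2)
  have hinj : Function.Injective e := fun i j hij => g.injective (Subtype.ext hij)
  obtain ⟨c, h0, hax⟩ := h.npc.flag z (fun i => Z.rev (e i))
    (fun i j hij => hinj (by
      have := congrArg Z.rev hij
      simpa only [Z.rev_rev] using this))
    (fun i => by rw [source_rev]; exact (he i).1)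
    (fun i j hij => by
      obtain ⟨c, c', hs, -⟩ := h.exists_sq (e := e i) (f := e j)
        (by rw [up_rev]; exact not_lt.2 (le_of_lt (he i).2)) (he j).2
        ((he i).1.trans (he j).1.symm) (fun h => hij (hinj h))
      obtain ⟨s, h1, -, h2, -⟩ := hs.reverse
      exact ⟨s, (axis_two_zero s).trans h1.symm, (axis_two_one s).trans h2.symm⟩)
  have hdown : ∀ a : Fin htf.toFinset.card → Bool,
      (∀ i, a i = false → Up S (Z.rev (Z.edge c i a))) ∧
        distTo S (Z.vertex c a) + (Finset.univ.filter fun i => a i = true).card ≤ distTo S z := by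
    refine vertex_induction ⟨fun i _ => ?_, ?_⟩ fun a i hi ih => ⟨fun j hj => ?_, ?_⟩
    · have := congrFun hax i
      change Up S (Z.rev (Z.axis c i))
      rw [this, Z.rev_rev]
      exact (he i).2
    · change distTo S (Z.origin c) + _ ≤ _
      simp [h0]
    · have hij : j ≠ i := by
        rintro rfl
        simp at hj
      rw [Function.update_of_ne hij] at hj
      have := h.up_of_sq (sq_of_cube c hij a).rot (ih.1 j hj)
      rwa [hi] at this
    · rw [card_update_true hi]
      have := ih.1 i hi
      rw [up_rev, target_edge, source_edge, hi, Bool.not_false] at this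
      have := ih.2
      omega
  have hopp : Z.vertex c (fun _ => true) ∈ S := by
    apply mem_of_distTo h.connected h.nonempty
    have := (hdown fun _ => true).2
    simp only [Finset.filter_true, Finset.card_univ, Fintype.card_fin] at this
    omega
  -- Move the origin of the cube to the opposite vertex.
  let σ : FaceMap htf.toFinset.card htf.toFinset.card := ⟨.refl _, fun _ => true⟩
  refine ⟨_, Z.face σ c, fun _ => true, ?_, fun i => ?_, ?_⟩
  · rwa [origin_face]
  · rw [axis, edge_face]
    refine hE.edge_mem (fun i => ?_) _ _
    rw [hax]
    exact hE.rev _ (h.upEdges_subset hE hz (he i))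
  · rw [vertex_face, FaceMap.app_eq_xor σ rfl, ← h0]
    rfl

theorem distTo_map_le (h : ConvexVerts S) (φ : Map Z Z) (hφ : ∀ v ∈ S, φ v ∈ S) (z : Z.Vert) :
    distTo S (φ z) ≤ distTo S z := by
  obtain ⟨v, hv, l, hl, hn⟩ := exists_distTo h.connected h.nonempty z
  rw [← hn]
  exact (distTo_le (hφ v hv) (walk_map φ hl)).trans_eq (List.length_map _)

theorem thick_map (h : ConvexVerts S) {φ ψ : Map Z Z} (hφψ : ∀ {n : ℕ} (c : Z.Cube n), ψ (φ c) = c)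
    (hφ : ∀ v ∈ S, φ v ∈ S) (hψ : ∀ v ∈ S, ψ v ∈ S) {z : Z.Vert} (hz : Thick S z) :
    Thick S (φ z) := by
  have hd : ∀ z, distTo S (φ z) = distTo S z := fun z => by
    refine le_antisymm (h.distTo_map_le φ hφ z) ?_
    have := h.distTo_map_le ψ hψ (φ z)
    rwa [hφψ] at this
  unfold Thick
  rw [hd]
  refine hz.trans (Set.encard_le_encard_of_injOn (f := fun e => φ e) ?_ ?_)
  · rintro e ⟨rfl, he⟩
    refine ⟨(φ.map_target e).symm, ?_⟩
    rwa [Up, ← φ.map_source, ← φ.map_target, hd, hd]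
  · intro e _ e' _ hee
    have := congrArg (fun e => ψ e) hee
    simpa only [hφψ] using this

end ConvexVerts

/-- A convex subcomplex with edges in a parallel closed family `E` is contained in a larger convex
subcomplex that contains all endpoints of edges in `E` that start in the given one. Its vertices are
vertices of cubes that have edges in `E` and meet the given subcomplex, and it is invariant under
the automorphisms that preserve the data. -/
theorem exists_thickening (hZ : Z.NonpositivelyCurved) (hU : Z.UniqueReduced) (hC : Z.Connected)
    {E : Set Z.Edge} (hE : ParallelClosed E) {Y : Z.Subcomplex} (hY : Y.IsConvex)
    (hYE : Y.cubes 1 ⊆ E) : ∃ Y' : Z.Subcomplex, Y'.IsConvex ∧ Y'.cubes 1 ⊆ E ∧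
      Y.cubes 0 ⊆ Y'.cubes 0 ∧ (∀ e ∈ E, Z.source e ∈ Y.cubes 0 → Z.target e ∈ Y'.cubes 0) ∧
      (∀ z ∈ Y'.cubes 0, ∃ (n : ℕ) (c : Z.Cube n) (a : Fin n → Bool), Z.origin c ∈ Y.cubes 0 ∧
        (∀ i, Z.axis c i ∈ E) ∧ Z.vertex c a = z) ∧
      ∀ φ ψ : Map Z Z, (∀ {n : ℕ} (c : Z.Cube n), ψ (φ c) = c) →
        (∀ v ∈ Y.cubes 0, φ v ∈ Y.cubes 0) →
        (∀ v ∈ Y.cubes 0, ψ v ∈ Y.cubes 0) → (∀ e ∈ E, φ e ∈ E) →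
        ∀ (n : ℕ), ∀ c ∈ Y'.cubes n, φ c ∈ Y'.cubes n := by
  have h := hY.convexVerts hZ hU hC
  let W : Set Z.Vert := {z | ReachedBy (Y.cubes 0) E z ∧ Thick (Y.cubes 0) z}
  have hSW : (Y.cubes 0) ⊆ W := fun v hv => ⟨⟨v, hv, [], rfl, by simp⟩, by
    rw [Thick, distTo_of_mem hv]
    simp⟩
  have hconn : (spanned E W).toCubeComplex.Connected := by
    have key : ∀ (k : ℕ) (z : Z.Vert), distTo (Y.cubes 0) z = k → ∀ hz : z ∈ W,
        ∃ v, ∃ hv : v ∈ (Y.cubes 0), ∃ l,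
        (spanned E W).toCubeComplex.vertTransport.Walk ⟨v, mem_spanned_vert.2 (hSW hv)⟩ l
          ⟨z, mem_spanned_vert.2 hz⟩ := by
      intro k
      induction k with
      | zero =>
        intro z hz hzW
        exact ⟨z, mem_of_distTo hC h.nonempty hz, [], rfl⟩
      | succ k ih =>
        intro z hz hzW
        have hne : (upEdges (Y.cubes 0) z).Nonempty := by
          rw [Set.nonempty_iff_ne_empty]
          intro h0
          have := hzW.2
          rw [Thick, h0, hz] at this
          simp at this
        obtain ⟨e, rfl, he⟩ := hne
        have heE : e ∈ E := h.upEdges_subset hE hzW.1 ⟨rfl, he⟩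
        have hsW : Z.source e ∈ W := ⟨hzW.1.cons_rev hE heE, h.thick_source he hzW.2⟩
        obtain ⟨v, hv, l, hl⟩ := ih (Z.source e)
          (by rw [he.target_eq hC h.nonempty] at hz; omega) hsW
        exact ⟨v, hv, ⟨e, mem_spanned_edge hE heE hsW hzW⟩ :: l, _, hl, rfl, rfl⟩
    rw [connected_iff]
    refine ⟨?_, ?_⟩
    · obtain ⟨v, hv⟩ := h.nonempty
      exact ⟨⟨v, mem_spanned_vert.2 (hSW hv)⟩⟩
    · rintro ⟨z, hz⟩ ⟨z', hz'⟩
      obtain ⟨v, hv, l, hl⟩ := key _ z rfl (mem_spanned_vert.1 hz)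
      obtain ⟨v', hv', l', hl'⟩ := key _ z' rfl (mem_spanned_vert.1 hz')
      obtain ⟨r, hr, hrr⟩ := exists_red_walk hZ hC v v'
      have hrY := hY.mem_of_red hZ hU hv hv' hr hrr
      obtain ⟨_, r', hr'⟩ := (spanned E W).lift_walk (mem_spanned_vert.2 (hSW hv)) hr
        fun e he => mem_spanned_edge hE (hYE (hrY e he)) (hSW (Y.source_mem (hrY e he)))
          (hSW (Y.target_mem (hrY e he)))
      exact ⟨_, hl.reverse.append (hr'.append hl')⟩
  refine ⟨spanned E W, ⟨hconn, spanned_isLocalIsometry hE ?_⟩, ?_, ?_, ?_, ?_, ?_⟩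
  · intro a b c d hs ha hc h0 h1 h2
    refine ⟨?_, h.thick_of_sq hs h0.2 h1.2 h2.2⟩
    exact ReachedBy.cons (hs.target_left ▸ h1.1) (hE.par hs.swap hc)
  · intro e he
    have := he.1 0 fun _ => false
    rwa [edge_zero_false] at this
  · exact fun v hv => mem_spanned_vert.2 (hSW hv)
  · intro e he hs
    refine mem_spanned_vert.2 ⟨(hSW hs).1.cons he, ?_⟩
    have h1 := distTo_target_le hC h.nonempty e
    rw [distTo_of_mem hs] at h1
    by_cases h2 : distTo (Y.cubes 0) (Z.target e) = 0
    · rw [Thick, h2]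
      simp
    · have h3 : distTo (Y.cubes 0) (Z.target e) = 1 := by omega
      have h4 : e ∈ upEdges (Y.cubes 0) (Z.target e) := ⟨rfl, by
        rw [Up, h3, distTo_of_mem hs]; simp⟩
      rw [Thick, h3]
      exact_mod_cast Set.one_le_encard_iff_nonempty.2 ⟨e, h4⟩
  · intro z hz
    have := mem_spanned_vert.1 hz
    exact h.exists_cube_of_thick hE this.1 this.2
  · intro φ ψ hφψ hφ hψ hφE n c hc
    refine ⟨fun i a => ?_, fun a => ?_⟩
    · rw [← φ.map_edge]
      exact hφE _ (hc.1 i a)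
    · rw [← φ.map_vertex]
      obtain ⟨⟨v, hv, l, hl, hlE⟩, ht⟩ := hc.2 a
      refine ⟨⟨φ v, hφ v hv, _, walk_map φ hl, ?_⟩, h.thick_map hφψ hφ hψ ht⟩
      intro e he
      rw [List.mem_map] at he
      obtain ⟨e', he', rfl⟩ := he
      exact hφE _ (hlE e' he')

/-! ### Locally finite families of parallel classes of edges -/

/-- Each finite set of edges is contained in a parallel closed set of edges that has only finitely
many edges at each vertex. -/
def LocallyFiniteParallel (X : CubeComplex.{u}) : Prop :=
  ∀ A : Set X.Edge, A.Finite → ∃ E : Set X.Edge, A ⊆ E ∧ ParallelClosed E ∧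
    ∀ v, {e ∈ E | X.source e = v}.Finite

theorem LocallyFinite.locallyFiniteParallel (h : X.LocallyFinite) : X.LocallyFiniteParallel := by
  intro A _
  refine ⟨Set.univ, Set.subset_univ _, ⟨fun _ _ => trivial, fun _ _ => trivial⟩, fun v => ?_⟩
  refine ((h v).preimage (f := Sigma.mk 1) sigma_mk_injective.injOn).subset ?_
  rintro e ⟨-, he⟩
  exact he

theorem salvetti_label_edge {V : Type u} {Γ : SimpleGraph V} {n : ℕ} (c : (salvetti Γ).Cube n)
    (i : Fin n) (a : Fin n → Bool) : ((salvetti Γ).edge c i a).label 0 = c.label i := rfl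

/-- In a special complex, parallel edges have the same label, and at each vertex there are at most
two edges with a given label. Hence one may take the edges whose lifts to the special cover all
have labels in a suitable finite set. -/
theorem VirtuallySpecial.locallyFiniteParallel (h : X.VirtuallySpecial) :
    X.LocallyFiniteParallel := by
  obtain ⟨X', f, ⟨hf, hfin⟩, V, Γ, s, hs⟩ := h
  intro A hA
  have hfl := hf.isLocalIsometry
  let lab : X'.Edge → V := fun e => (s e).label 0
  let L : Set V := ⋃ e ∈ A, lab '' {e' | f e' = e}
  have hL : L.Finite := by
    refine hA.biUnion fun e _ => Set.Finite.image _ ?_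
    refine Set.Finite.of_injOn (f := X'.source) (t := {y | f y = X.source e}) ?_ ?_
      (hfin (X.source e))
    · rintro e' rfl
      exact f.map_source e'
    · rintro e' h1 e'' h2 h3
      exact hfl.edge_injective h3 (h1.trans h2.symm)
  refine ⟨{e | ∀ e', f e' = e → lab e' ∈ L}, fun e he e' he' => ?_, ⟨?_, ?_⟩, fun v => ?_⟩
  · exact Set.mem_biUnion he ⟨e', he', rfl⟩
  · intro e he e' he'
    have := he (X'.rev e') (by rw [f.map_rev, he', X.rev_rev])
    have h1 : lab (X'.rev e') = lab e' := by
      simp only [lab, s.map_rev]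
      exact salvetti_label_edge _ _ _
    rwa [h1] at this
  · intro a b c d hsq ha d' hd'
    obtain ⟨t, h1, -, -, h2⟩ := hsq.rot'
    obtain ⟨t', ⟨h3, rfl⟩, -⟩ := hf.lift (X'.source d') t (by
      rw [f.map_source, hd', h1, ← axis_two_zero, source_axis])
    have h4 : X'.edge t' 0 ![false, false] = d' := by
      apply hfl.edge_injective
      · rw [← axis_two_zero, source_axis, h3]
      · rw [f.map_edge, hd', h1]
    have h5 := ha (X'.edge t' 0 ![false, true]) (by rw [f.map_edge, h2])
    have h6 : lab d' = lab (X'.edge t' 0 ![false, true]) := by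
      rw [← h4]
      simp only [lab, s.map_edge]
      rfl
    rwa [h6]
  · obtain ⟨y, rfl⟩ := hf.surjective v
    have h1 : {e' : X'.Edge | X'.source e' = y ∧ lab e' ∈ L}.Finite := by
      refine Set.Finite.of_injOn (f := fun e' => (lab e', (s e').back 0))
        (t := L ×ˢ (Set.univ : Set Bool)) ?_ ?_ (hL.prod Set.finite_univ)
      · rintro e' ⟨-, h1⟩
        exact ⟨h1, trivial⟩
      · rintro e' ⟨h1, -⟩ e'' ⟨h2, -⟩ h3
        rw [Prod.mk.injEq] at h3
        apply hs.edge_injective (h1.trans h2.symm)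
        apply SalvettiCube.ext <;> funext i <;> rw [Subsingleton.elim i 0]
        · exact h3.1
        · exact h3.2
    refine (h1.image fun e' => f e').subset ?_
    rintro e ⟨he, hv⟩
    obtain ⟨e', ⟨h2, h3⟩, -⟩ := hf.lift y e hv
    exact ⟨e', ⟨h2, he e' h3⟩, h3⟩

theorem ParallelClosed.preimage {E : Set X.Edge} (hE : ParallelClosed E) (f : Map Y X) :
    ParallelClosed {e : Y.Edge | f e ∈ E} where
  rev e he := by
    change f (Y.rev e) ∈ E
    rw [f.map_rev]
    exact hE.rev _ he
  par hs ha := hE.par (f.map_sq hs) ha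

theorem Map.IsLocalIsometry.finite_preimage {f : Map Y X} (hf : f.IsLocalIsometry) {E : Set X.Edge}
    (v : Y.Vert) (h : {e ∈ E | X.source e = f v}.Finite) :
    {e ∈ {e : Y.Edge | f e ∈ E} | Y.source e = v}.Finite := by
  refine Set.Finite.of_injOn (f := fun e => f e) ?_ ?_ h
  · rintro e ⟨he, rfl⟩
    exact ⟨he, (f.map_source e).symm⟩
  · rintro e ⟨-, h1⟩ e' ⟨-, h2⟩ h3
    exact hf.edge_injective (h1.trans h2.symm) h3

/-! ### Enlarging cocompact convex subcomplexes -/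

/-- The deck action on points of the universal cover. -/
instance (X : CubeComplex.{u}) (x : X.Vert) : MulAction (X.PathClass x x) (X.UVert x) where
  smul g P := ⟨P.1, g.comp P.2⟩
  one_smul _ := Sigma.ext rfl (heq_of_eq (PathClass.nil_comp _))
  mul_smul _ _ _ := Sigma.ext rfl (heq_of_eq (PathClass.comp_assoc _ _ _))

section Deck

variable {x : X.Vert}

/-- The deck transformation of an element of the fundamental group. -/
def deck (g : X.Pi1 x) : Map (X.universalCover x) (X.universalCover x) where
  toFun c := g • c
  map_face _ _ := rfl

theorem upt_smul (g : X.Pi1 x) (v : (X.universalCover x).Vert) :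
    upt (g • v) = g • upt v := rfl

theorem vertex_smul (g : X.Pi1 x) {n : ℕ} (c : (X.universalCover x).Cube n) (a : Fin n → Bool) :
    (X.universalCover x).vertex (g • c) a = g • (X.universalCover x).vertex c a := rfl

theorem origin_smul (g : X.Pi1 x) {n : ℕ} (c : (X.universalCover x).Cube n) :
    (X.universalCover x).origin (g • c) = g • (X.universalCover x).origin c := rfl

/-- The subcomplex `Y` of the universal cover is convex and invariant under `K`. -/
structure InvariantConvex (K : Subgroup (X.Pi1 x)) (Y : (X.universalCover x).Subcomplex) :
    Prop where
  convex : Y.IsConvex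
  smul_mem : ∀ k ∈ K, ∀ (n : ℕ), ∀ c ∈ Y.cubes n, k • c ∈ Y.cubes n

/-- A set of vertices of the universal cover is contained in finitely many orbits of `K`. -/
def FiniteOrbits (K : Subgroup (X.Pi1 x)) (S : Set (X.universalCover x).Vert) : Prop :=
  ∃ F : Set (X.universalCover x).Vert, F.Finite ∧ ∀ v ∈ S, ∃ k ∈ K, ∃ w ∈ F, v = k • w

/-- The thickening of an invariant cocompact convex subcomplex is again invariant and cocompact,
as only finitely many cubes with edges in `E` start at a given vertex. -/
theorem InvariantConvex.exists_thickening (hX : X.NonpositivelyCurved) {K : Subgroup (X.Pi1 x)}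
    {E : Set X.Edge} (hE : ParallelClosed E) (hfin : ∀ v, {e ∈ E | X.source e = v}.Finite)
    {Y : (X.universalCover x).Subcomplex} (hY : InvariantConvex K Y)
    (hYE : ∀ e ∈ Y.cubes 1, X.uproj x e ∈ E) (hYF : FiniteOrbits K (Y.cubes 0)) :
    ∃ Y' : (X.universalCover x).Subcomplex, InvariantConvex K Y' ∧
      (∀ e ∈ Y'.cubes 1, X.uproj x e ∈ E) ∧ FiniteOrbits K (Y'.cubes 0) ∧
      Y.cubes 0 ⊆ Y'.cubes 0 ∧ ∀ e, X.uproj x e ∈ E → (X.universalCover x).source e ∈ Y.cubes 0 →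
        (X.universalCover x).target e ∈ Y'.cubes 0 := by
  have hZ := universalCover_npc hX x
  obtain ⟨Y', h1, h2, h3, h4, h5, h6⟩ := CubeComplex.exists_thickening hZ
    (universalCover_uniqueReduced hX x) (universalCover_connected x) (hE.preimage (X.uproj x))
    hY.convex hYE
  refine ⟨Y', ⟨h1, fun k hk => ?_⟩, h2, ?_, h3, h4⟩
  · exact h6 (deck k) (deck k⁻¹) (fun c => inv_smul_smul k c) (hY.smul_mem k hk 0)
      (hY.smul_mem k⁻¹ (K.inv_mem hk) 0) (fun e he => he)
  · obtain ⟨F, hF, hFK⟩ := hYF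
    refine ⟨⋃ v ∈ F, ⋃ c ∈ {c : Σ n, (X.universalCover x).Cube n |
      (X.universalCover x).origin c.2 = v ∧ ∀ i, X.uproj x ((X.universalCover x).axis c.2 i) ∈ E},
      Set.range fun a => (X.universalCover x).vertex c.2 a, ?_, ?_⟩
    · refine hF.biUnion fun v _ => Set.Finite.biUnion ?_ fun c _ => Set.finite_range _
      exact ParallelClosed.finite_cubes hZ
        ((uproj_isLocalIsometry x).finite_preimage v (hfin _))
    · intro z hz
      obtain ⟨n, c, a, hc, hax, rfl⟩ := h5 z hz
      obtain ⟨k, hk, w, hw, hkw⟩ := hFK _ hc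
      refine ⟨k, hk, (X.universalCover x).vertex (k⁻¹ • c) a, ?_, ?_⟩
      · refine Set.mem_biUnion hw (Set.mem_biUnion (x := ⟨n, k⁻¹ • c⟩) ⟨?_, hax⟩ ⟨a, rfl⟩)
        change (X.universalCover x).origin (k⁻¹ • c) = w
        rw [origin_smul, hkw, inv_smul_smul]
      · rw [vertex_smul, smul_inv_smul]

/-- Reaching a given vertex by repeated thickening. -/
theorem InvariantConvex.exists_enlargement (hX : X.NonpositivelyCurved) {K : Subgroup (X.Pi1 x)}
    {E : Set X.Edge} (hE : ParallelClosed E) (hfin : ∀ v, {e ∈ E | X.source e = v}.Finite)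
    {Y : (X.universalCover x).Subcomplex} (hY : InvariantConvex K Y)
    (hYE : ∀ e ∈ Y.cubes 1, X.uproj x e ∈ E) (hYF : FiniteOrbits K (Y.cubes 0))
    {v : (X.universalCover x).Vert} (hv : v ∈ Y.cubes 0) :
    ∀ {l : List (X.universalCover x).Edge} {w : (X.universalCover x).Vert},
      (X.universalCover x).vertTransport.Walk v l w → (∀ e ∈ l, X.uproj x e ∈ E) →
      ∃ Y' : (X.universalCover x).Subcomplex, InvariantConvex K Y' ∧
        (∀ e ∈ Y'.cubes 1, X.uproj x e ∈ E) ∧ FiniteOrbits K (Y'.cubes 0) ∧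
        Y.cubes 0 ⊆ Y'.cubes 0 ∧ w ∈ Y'.cubes 0
  | [], _, h, _ => by cases h; exact ⟨Y, hY, hYE, hYF, subset_rfl, hv⟩
  | e :: l, _, ⟨z, h1, h2⟩, h => by
    obtain ⟨Y1, h3, h4, h5, h6, h7⟩ := hY.exists_enlargement hX hE hfin hYE hYF hv h1
      fun e he => h e (List.mem_cons_of_mem _ he)
    obtain ⟨Y2, h8, h9, h10, h11, h12⟩ := h3.exists_thickening hX hE hfin h4 h5
    refine ⟨Y2, h8, h9, h10, h6.trans h11, ?_⟩
    have := h12 e (h e List.mem_cons_self) (by rw [h2.1]; exact h7)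
    rwa [h2.2] at this

theorem ConvexCocompact.exists_invariantConvex {K : Subgroup (X.Pi1 x)} (hK : ConvexCocompact K) :
    ∃ Y, InvariantConvex K Y ∧ FiniteOrbits K (Y.cubes 0) ∧
      ((fun e => X.uproj x e) '' Y.cubes 1).Finite := by
  obtain ⟨Y, hY, hK, F, hF, hFK⟩ := hK
  refine ⟨Y, ⟨hY, hK⟩, ⟨Sigma.mk 0 ⁻¹' F, hF.preimage sigma_mk_injective.injOn, fun v hv => ?_⟩, ?_⟩
  · obtain ⟨k, hk, d, hd, h⟩ := hFK 0 v hv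
    exact ⟨k, hk, d, hd, h⟩
  · have h1 : (Sigma.mk 1 ⁻¹' F).Finite := hF.preimage sigma_mk_injective.injOn
    refine (h1.image fun e => X.uproj x e).subset ?_
    rintro _ ⟨e, he, rfl⟩
    obtain ⟨k, hk, d, hd, rfl⟩ := hFK 1 e he
    exact ⟨d, hd, rfl⟩

/-- A convex-cocompact subgroup acts cocompactly on a convex subcomplex that contains a given finite
set of vertices. This is where the assumption that `X` is locally finite or virtually special is
needed. -/
theorem ConvexCocompact.exists_containing (hX : X.NonpositivelyCurved)
    (hXE : X.LocallyFiniteParallel) {K : Subgroup (X.Pi1 x)} (hK : ConvexCocompact K)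
    {A : Set (X.universalCover x).Vert} (hA : A.Finite) :
    ∃ Y : (X.universalCover x).Subcomplex, InvariantConvex K Y ∧ A ⊆ Y.cubes 0 ∧
      ∃ F : Set (Σ n, (X.universalCover x).Cube n), F.Finite ∧
        ∀ (n : ℕ), ∀ c ∈ Y.cubes n, ∃ k ∈ K, ∃ d : (X.universalCover x).Cube n,
          ⟨n, d⟩ ∈ F ∧ c = k • d := by
  obtain ⟨Y, hY, hYF, hYfin⟩ := hK.exists_invariantConvex
  obtain ⟨⟨v, hv⟩⟩ := hY.convex.1.1
  choose l hl using fun w => (connected_iff.1 (universalCover_connected x)).2 v w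
  obtain ⟨E, hAE, hE, hfin⟩ := hXE
    ((fun e => X.uproj x e) '' Y.cubes 1 ∪ ⋃ w ∈ A, {e | e ∈ (l w).map fun e => X.uproj x e})
    (hYfin.union (hA.biUnion fun w _ => List.finite_toSet _))
  have hYE : ∀ e ∈ Y.cubes 1, X.uproj x e ∈ E := fun e he => hAE (Or.inl ⟨e, he, rfl⟩)
  have hlE : ∀ w ∈ A, ∀ e ∈ l w, X.uproj x e ∈ E := fun w hw e he =>
    hAE (Or.inr (Set.mem_biUnion hw (List.mem_map_of_mem he)))
  have key : ∃ Y' : (X.universalCover x).Subcomplex, InvariantConvex K Y' ∧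
      (∀ e ∈ Y'.cubes 1, X.uproj x e ∈ E) ∧ FiniteOrbits K (Y'.cubes 0) ∧
      Y.cubes 0 ⊆ Y'.cubes 0 ∧ A ⊆ Y'.cubes 0 := by
    clear hAE
    induction A, hA using Set.Finite.induction_on with
    | empty => exact ⟨Y, hY, hYE, hYF, subset_rfl, Set.empty_subset _⟩
    | @insert w A _ _ ih =>
      obtain ⟨Y1, h1, h2, h3, h4, h5⟩ := ih fun w hw => hlE w (Set.mem_insert_of_mem _ hw)
      obtain ⟨Y2, h6, h7, h8, h9, h10⟩ := h1.exists_enlargement hX hE hfin h2 h3 (h4 hv) (hl w)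
        (hlE w (Set.mem_insert _ _))
      exact ⟨Y2, h6, h7, h8, h4.trans h9, Set.insert_subset h10 (h5.trans h9)⟩
  obtain ⟨Y', h1, h2, ⟨F, hF, hFK⟩, -, h4⟩ := key
  refine ⟨Y', h1, h4, ⋃ v ∈ F, {c : Σ n, (X.universalCover x).Cube n |
      (X.universalCover x).origin c.2 = v ∧ ∀ i, X.uproj x ((X.universalCover x).axis c.2 i) ∈ E},
      ?_, ?_⟩
  · exact hF.biUnion fun v _ => ParallelClosed.finite_cubes (universalCover_npc hX x)
      ((uproj_isLocalIsometry x).finite_preimage v (hfin _))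
  · intro n c hc
    obtain ⟨k, hk, w, hw, hkw⟩ := hFK _ (Y'.vertex_mem hc fun _ => false)
    refine ⟨k, hk, k⁻¹ • c, Set.mem_biUnion hw ⟨?_, fun i => ?_⟩, (smul_inv_smul k c).symm⟩
    · change (X.universalCover x).origin (k⁻¹ • c) = w
      rw [origin_smul, origin, hkw, inv_smul_smul]
    · have h5 := Y'.face_mem (FaceMap.edge i fun _ => false) c hc
      exact h2 ((X.universalCover x).axis c i) h5

end Deck

/-- Composition of combinatorial maps. -/
def Map.comp (g : Map Y X) (f : Map Z Y) : Map Z X where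
  toFun c := g (f c)
  map_face σ c := (congrArg (fun c => g c) (f.map_face σ c)).trans (g.map_face σ (f c))

theorem Map.IsLocalIsometry.comp {g : Map Y X} {f : Map Z Y} (hg : g.IsLocalIsometry)
    (hf : f.IsLocalIsometry) : (g.comp f).IsLocalIsometry where
  link_injective c c' h h' := hf.link_injective c c' h
    (hg.link_injective _ _ (by rw [← f.map_origin, ← f.map_origin, h]) h')
  link_full y n c h h' := by
    obtain ⟨d, h1, rfl⟩ := hg.link_full (f y) c h fun i => by
      obtain ⟨e, he, he'⟩ := h' i
      exact ⟨f e, by rw [← f.map_source, he], he'⟩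
    obtain ⟨d', h2, rfl⟩ := hf.link_full y d h1 fun i => by
      obtain ⟨e, he, he'⟩ := h' i
      refine ⟨e, he, hg.edge_injective ?_ ?_⟩
      · rw [← f.map_source, he, source_axis, h1]
      · rw [g.map_axis]
        exact he'
    exact ⟨d', h2, rfl⟩

/-! ### Lifting paths -/

/-- Edges can be lifted, with prescribed initial vertex. -/
def Map.LiftsEdges (f : Map Y X) : Prop :=
  ∀ (y : Y.Vert) (e : X.Edge), X.source e = f y → ∃ e' : Y.Edge, Y.source e' = y ∧ f e' = e

theorem Map.IsCover.liftsEdges {f : Map Y X} (hf : f.IsCover) : f.LiftsEdges :=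
  fun y e h => (hf.lift y e h).exists

theorem Map.LiftsEdges.walk {f : Map Y X} (hf : f.LiftsEdges) {v : Y.Vert} :
    ∀ {l : List X.Edge} {w : X.Vert}, X.vertTransport.Walk (f v) l w →
      ∃ l' w', Y.vertTransport.Walk v l' w' ∧ (l'.map fun e => f e) = l ∧ f w' = w
  | [], _, h => ⟨[], v, rfl, rfl, h⟩
  | e :: l, _, ⟨z, h1, h2⟩ => by
    obtain ⟨l', w', h3, rfl, rfl⟩ := hf.walk h1
    obtain ⟨e', rfl, rfl⟩ := hf w' e h2.1
    exact ⟨e' :: l', _, h3.cons (walk_edge e'), rfl, by rw [f.map_target, h2.2]⟩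

theorem Map.LiftsEdges.surjective {f : Map Y X} (hf : f.LiftsEdges) (hX : X.Connected)
    (hY : Nonempty Y.Vert) (x : X.Vert) : ∃ y : Y.Vert, f y = x := by
  obtain ⟨v⟩ := hY
  obtain ⟨l, hl⟩ := (connected_iff.1 hX).2 (f v) x
  obtain ⟨-, w, -, -, h⟩ := hf.walk hl
  exact ⟨w, h⟩

/-- Covers induce surjections of universal covers. -/
theorem Map.LiftsEdges.uMap_surjective {f : Map Y X} (hf : f.LiftsEdges) (y : Y.Vert) :
    Function.Surjective (f.uMap y) := by
  intro Q
  obtain ⟨l, hl⟩ := exists_uwalk Q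
  obtain ⟨l', w, h1, rfl, h2⟩ := hf.walk (walk_of_uwalk hl)
  obtain ⟨p, rfl⟩ := exists_path_of_walk h1
  have h3 := uwalk_word (PathClass.mk (.nil : Y.EdgePath y y)) p
  rw [PathClass.nil_comp] at h3
  have h4 := h3.map (T' := X.uTransport (f y)) f (f.uMap y) f.uMap_step
  exact ⟨_, EdgeTransport.Walk.unique h4 hl⟩

/-! ### Quotients -/

/-- An equivalence relation on the cubes of `Z`, preserved by `p : Z → X`, like the orbit relation
of a group of deck transformations. -/
structure DeckCongruence (p : Map Z X) where
  rel : ∀ n : ℕ, Setoid (Z.Cube n)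
  face : ∀ {m n : ℕ} (σ : FaceMap m n) {c d : Z.Cube n}, (rel n).r c d →
    (rel m).r (Z.face σ c) (Z.face σ d)
  map_eq : ∀ {n : ℕ} {c d : Z.Cube n}, (rel n).r c d → p c = p d
  exists_origin : ∀ {n : ℕ} {c : Z.Cube n} {v : Z.Vert}, (rel 0).r (Z.origin c) v →
    ∃ c' : Z.Cube n, (rel n).r c c' ∧ Z.origin c' = v

namespace DeckCongruence

variable {p : Map Z X} (r : DeckCongruence p)

/-- The quotient complex. -/
def quotient : CubeComplex.{u} where
  Cube n := Quotient (r.rel n)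
  face {m n} σ := Quotient.map (Z.face σ) fun _ _ h => r.face σ h
  face_id c := by
    induction c using Quotient.inductionOn with | _ c =>
    exact congrArg (Quotient.mk _) (Z.face_id c)
  face_comp σ τ c := by
    induction c using Quotient.inductionOn with | _ c =>
    exact congrArg (Quotient.mk _) (Z.face_comp σ τ c)
  free σ c h := by
    induction c using Quotient.inductionOn with | _ c =>
    refine X.free σ (p c) ?_
    rw [← p.map_face]
    exact r.map_eq (Quotient.exact h)

/-- The projection to the quotient. -/
def toQuotient : Map Z r.quotient where
  toFun {n} c := Quotient.mk (r.rel n) c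
  map_face _ _ := rfl

/-- The map from the quotient. -/
def desc : Map r.quotient X where
  toFun {n} := Quotient.lift (fun c : Z.Cube n => p c) fun _ _ h => r.map_eq h
  map_face σ c := by
    induction c using Quotient.inductionOn with | _ c =>
    exact p.map_face σ c

theorem exists_rep {n : ℕ} (c : r.quotient.Cube n) : ∃ d : Z.Cube n, r.toQuotient d = c :=
  Quotient.exists_rep c

theorem exists_rep_origin {n : ℕ} {c : r.quotient.Cube n} {v : Z.Vert}
    (h : r.quotient.origin c = r.toQuotient v) :
    ∃ d : Z.Cube n, r.toQuotient d = c ∧ Z.origin d = v := by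
  obtain ⟨d, rfl⟩ := r.exists_rep c
  rw [← r.toQuotient.map_origin] at h
  obtain ⟨d', h1, h2⟩ := r.exists_origin (Quotient.exact h)
  exact ⟨d', (Quotient.sound h1).symm, h2⟩

theorem liftsEdges : r.toQuotient.LiftsEdges := fun _ _ h =>
  let ⟨d, h1, h2⟩ := r.exists_rep_origin h
  ⟨d, h2, h1⟩

theorem connected (hZ : Z.Connected) : r.quotient.Connected := by
  rw [connected_iff] at hZ ⊢
  refine ⟨hZ.1.map fun v => r.toQuotient v, fun v w => ?_⟩
  obtain ⟨v, rfl⟩ := r.exists_rep v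
  obtain ⟨w, rfl⟩ := r.exists_rep w
  obtain ⟨l, hl⟩ := hZ.2 v w
  exact ⟨_, walk_map r.toQuotient hl⟩

theorem desc_isLocalIsometry (hp : p.IsLocalIsometry) : r.desc.IsLocalIsometry where
  link_injective c c' h h' := by
    obtain ⟨d, rfl⟩ := r.exists_rep c
    rw [← r.toQuotient.map_origin] at h
    obtain ⟨d', rfl, h2⟩ := r.exists_rep_origin h.symm
    rw [hp.link_injective d d' h2.symm h']
  link_full y n c h h' := by
    obtain ⟨y, rfl⟩ := r.exists_rep y
    obtain ⟨d, h1, rfl⟩ := hp.link_full y c h fun i => by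
      obtain ⟨e, h1, h2⟩ := h' i
      obtain ⟨e', rfl, h3⟩ := r.exists_rep_origin h1
      exact ⟨e', h3, h2⟩
    exact ⟨r.toQuotient d, by rw [← r.toQuotient.map_origin, h1], rfl⟩

theorem desc_isCover (hp : p.IsCover) : r.desc.IsCover where
  connected := r.connected hp.connected
  surjective x := by
    obtain ⟨y, hy⟩ := hp.surjective x
    exact ⟨r.toQuotient y, hy⟩
  lift y n c h := by
    obtain ⟨y, rfl⟩ := r.exists_rep y
    obtain ⟨d, ⟨h1, h2⟩, -⟩ := hp.lift y c h
    refine ⟨r.toQuotient d, ⟨by rw [← r.toQuotient.map_origin, h1], h2⟩, fun d' ⟨h3, h4⟩ => ?_⟩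
    refine (r.desc_isLocalIsometry hp.isLocalIsometry).link_injective _ _ ?_ (h4.trans h2.symm)
    rw [h3, ← r.toQuotient.map_origin, h1]

theorem isFinite {F : Set (Σ n, Z.Cube n)} (hF : F.Finite)
    (h : ∀ (n : ℕ) (c : Z.Cube n), ∃ d : Z.Cube n, ⟨n, d⟩ ∈ F ∧ (r.rel n).r c d) :
    r.quotient.IsFinite := by
  have := hF.to_subtype
  refine Finite.of_surjective (α := F) (fun c => ⟨c.1.1, r.toQuotient c.1.2⟩) ?_
  rintro ⟨n, c⟩
  obtain ⟨c, rfl⟩ := r.exists_rep c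
  obtain ⟨d, hd, h1⟩ := h n c
  refine ⟨⟨⟨n, d⟩, hd⟩, ?_⟩
  exact Sigma.ext rfl (heq_of_eq (Quotient.sound h1).symm)

end DeckCongruence

/-- The orbit relation of a group `K` acting on a complex over `X`. -/
def orbitCongruence (p : Map Z X) (K : Type u) [Group K] [∀ n, MulAction K (Z.Cube n)]
    (hface : ∀ {m n : ℕ} (k : K) (σ : FaceMap m n) (c : Z.Cube n),
      Z.face σ (k • c) = k • Z.face σ c)
    (hp : ∀ {n : ℕ} (k : K) (c : Z.Cube n), p (k • c) = p c) : DeckCongruence p where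
  rel n := MulAction.orbitRel K (Z.Cube n)
  face := by
    rintro m n σ c d ⟨k, rfl⟩
    exact ⟨k, (hface k σ d).symm⟩
  map_eq := by
    rintro n c d ⟨k, rfl⟩
    exact hp k d
  exists_origin := by
    rintro n c v ⟨k, hk⟩
    refine ⟨k⁻¹ • c, ⟨k, smul_inv_smul k c⟩, ?_⟩
    rw [origin, vertex, hface, inv_smul_eq_iff]
    exact hk.symm

/-! ### Fibre products -/

section FiberProduct

variable {X' : CubeComplex.{u}} (f : Map Y X) (μ : Map X' X)

/-- The fibre product of two complexes over `X`. -/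
def fiberProduct : CubeComplex.{u} where
  Cube n := {q : Y.Cube n × X'.Cube n // f q.1 = μ q.2}
  face σ q := ⟨(Y.face σ q.1.1, X'.face σ q.1.2),
    (f.map_face σ _).trans ((congrArg (X.face σ) q.2).trans (μ.map_face σ _).symm)⟩
  face_id _ := Subtype.ext (Prod.ext (Y.face_id _) (X'.face_id _))
  face_comp _ _ _ := Subtype.ext (Prod.ext (Y.face_comp _ _ _) (X'.face_comp _ _ _))
  free σ q h := Y.free σ q.1.1 (congrArg (fun q => q.1.1) h)

/-- The first projection of the fibre product. -/
def fiberFst : Map (fiberProduct f μ) Y where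
  toFun q := q.1.1
  map_face _ _ := rfl

/-- The second projection of the fibre product. -/
def fiberSnd : Map (fiberProduct f μ) X' where
  toFun q := q.1.2
  map_face _ _ := rfl

variable {f μ}

theorem fiber_comm {n : ℕ} (q : (fiberProduct f μ).Cube n) :
    f (fiberFst f μ q) = μ (fiberSnd f μ q) := q.2

theorem fiber_ext {n : ℕ} {q q' : (fiberProduct f μ).Cube n}
    (h : fiberFst f μ q = fiberFst f μ q') (h' : fiberSnd f μ q = fiberSnd f μ q') : q = q' :=
  Subtype.ext (Prod.ext h h')

theorem fiberFst_lift (hμ : μ.IsCover) (v : (fiberProduct f μ).Vert) {n : ℕ} (c : Y.Cube n)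
    (h : Y.origin c = fiberFst f μ v) :
    ∃! q : (fiberProduct f μ).Cube n, (fiberProduct f μ).origin q = v ∧ fiberFst f μ q = c := by
  obtain ⟨d, ⟨h1, h2⟩, h3⟩ := hμ.lift (fiberSnd f μ v) (f c) (by
    rw [← f.map_origin, h, fiber_comm])
  refine ⟨⟨(c, d), h2.symm⟩, ⟨fiber_ext ?_ ?_, rfl⟩, ?_⟩
  · exact h
  · exact h1
  · rintro q ⟨rfl, rfl⟩
    exact fiber_ext rfl (h3 _ ⟨((fiberSnd f μ).map_origin q).symm, (fiber_comm q).symm⟩)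

theorem fiberSnd_isLocalIsometry (hf : f.IsLocalIsometry) :
    (fiberSnd f μ).IsLocalIsometry where
  link_injective q q' h h' := by
    refine fiber_ext (hf.link_injective _ _ ?_ ?_) h'
    · rw [← (fiberFst f μ).map_origin, ← (fiberFst f μ).map_origin, h]
    · rw [fiber_comm, fiber_comm, h']
  link_full v n c h h' := by
    obtain ⟨d, h1, h2⟩ := hf.link_full (fiberFst f μ v) (μ c)
      (by rw [fiber_comm, ← μ.map_origin, h])
      (fun i => by
        obtain ⟨e, rfl, h2⟩ := h' i
        exact ⟨fiberFst f μ e, ((fiberFst f μ).map_source e).symm, by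
          rw [fiber_comm, h2, μ.map_axis]⟩)
    exact ⟨⟨(d, c), h2⟩, fiber_ext h1 h, rfl⟩

end FiberProduct

/-! ### Components -/

theorem exists_walk_vertex {n : ℕ} (c : Z.Cube n) (a : Fin n → Bool) :
    ∃ l, Z.vertTransport.Walk (Z.origin c) l (Z.vertex c a) := by
  refine vertex_induction (P := fun a => ∃ l, Z.vertTransport.Walk (Z.origin c) l (Z.vertex c a))
    ⟨[], rfl⟩ (fun a i hi ih => ?_) a
  obtain ⟨l, hl⟩ := ih
  exact ⟨Z.edge c i a :: l, _, hl, source_edge c i a, by rw [target_edge, hi]; rfl⟩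

/-- The component of a vertex. -/
def component (v : Z.Vert) : Z.Subcomplex where
  cubes _ := {c | ∃ l, Z.vertTransport.Walk v l (Z.origin c)}
  face_mem σ c h := by
    obtain ⟨l, hl⟩ := h
    obtain ⟨l', hl'⟩ := exists_walk_vertex c σ.base
    refine ⟨l' ++ l, ?_⟩
    rw [origin_face]
    exact hl.append hl'

theorem mem_component_vert {v w : Z.Vert} :
    w ∈ (component v).cubes 0 ↔ ∃ l, Z.vertTransport.Walk v l w := by
  change (∃ l, Z.vertTransport.Walk v l (Z.vertex w _)) ↔ _
  rw [vertex_zero]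

theorem component_self (v : Z.Vert) : v ∈ (component v).cubes 0 := mem_component_vert.2 ⟨[], rfl⟩

theorem mem_component {v : Z.Vert} {n : ℕ} {c : Z.Cube n}
    (h : Z.origin c ∈ (component v).cubes 0) : c ∈ (component v).cubes n :=
  mem_component_vert.1 h

theorem walk_mem_component {v : Z.Vert} : ∀ {l : List Z.Edge} {w : Z.Vert},
    Z.vertTransport.Walk v l w → ∀ e ∈ l, e ∈ (component v).cubes 1
  | [], _, _ => by simp
  | e :: l, _, ⟨z, h1, h2⟩ => by
    rw [List.forall_mem_cons]
    refine ⟨⟨l, ?_⟩, walk_mem_component h1⟩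
    change Z.vertTransport.Walk v l (Z.source e)
    rw [h2.1]
    exact h1

theorem component_connected (v : Z.Vert) : (component v).toCubeComplex.Connected := by
  rw [connected_iff]
  refine ⟨⟨⟨v, component_self v⟩⟩, fun w w' => ?_⟩
  obtain ⟨l, hl⟩ := mem_component_vert.1 w.2
  obtain ⟨l', hl'⟩ := mem_component_vert.1 w'.2
  obtain ⟨_, m, hm⟩ := (component v).lift_walk (component_self v) hl (walk_mem_component hl)
  obtain ⟨_, m', hm'⟩ := (component v).lift_walk (component_self v) hl' (walk_mem_component hl')
  exact ⟨_, hm.reverse.append hm'⟩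

theorem component_isLocalIsometry (v : Z.Vert) : (component v).incl.IsLocalIsometry where
  link_injective _ _ _ h := Subtype.ext h
  link_full y _ c h _ := ⟨⟨c, mem_component (by
    have := y.2
    rwa [show Z.origin c = y.1 from h])⟩, Subtype.ext h, rfl⟩

/-! ### Elevations as components of fibre products -/

section Elevation

variable {X' : CubeComplex.{u}} {f : Map Y X} {μ : Map X' X}

/-- Over a cover `μ`, the components of the fibre product are covers of the first factor. -/
theorem fiberFst_component_isCover (hμ : μ.IsCover) (hY : Y.Connected)
    (v : (fiberProduct f μ).Vert) :
    ((fiberFst f μ).comp (component v).incl).IsCover := by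
  have hlift : ∀ (y : (component v).toCubeComplex.Vert) {n : ℕ} (c : Y.Cube n),
      Y.origin c = (fiberFst f μ).comp (component v).incl y →
      ∃! c' : (component v).toCubeComplex.Cube n, (component v).toCubeComplex.origin c' = y ∧
        (fiberFst f μ).comp (component v).incl c' = c := by
    intro y n c h
    obtain ⟨q, ⟨h1, h2⟩, h3⟩ := fiberFst_lift hμ y.1 c h
    refine ⟨⟨q, mem_component (h1 ▸ y.2)⟩, ⟨Subtype.ext h1, h2⟩, fun q' ⟨h4, h5⟩ => ?_⟩
    exact Subtype.ext (h3 q'.1 ⟨congrArg Subtype.val h4, h5⟩)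
  refine ⟨component_connected v, ?_, hlift⟩
  exact Map.LiftsEdges.surjective (fun y e h => (hlift y e h).exists) hY ⟨⟨v, component_self v⟩⟩

theorem isElevation_component (hμ : μ.IsCover) (hY : Y.Connected) (v : (fiberProduct f μ).Vert) :
    IsElevation f μ ((fiberSnd f μ).comp (component v).incl)
      ((fiberFst f μ).comp (component v).incl) where
  cover := fiberFst_component_isCover hμ hY v
  comm c := fiber_comm c.1
  closes_iff {w w'} _ := by
    refine ⟨fun h => by rw [h]; exact ⟨rfl, rfl⟩, fun ⟨h1, h2⟩ => Subtype.ext (fiber_ext h1 h2)⟩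

end Elevation

/-! ### The subgroup of a pointed cover -/

/-- The homomorphism of fundamental groups induced by a combinatorial map. -/
def Map.pi1 (f : Map Y X) (y : Y.Vert) : Y.Pi1 y →* X.Pi1 (f y) where
  toFun := f.pathClass
  map_one' := rfl
  map_mul' a b := f.pathClass_comp a b

theorem comp_reverse_eq_mul_inv {v w : X.Vert} (a : X.PathClass v w) (q : X.EdgePath v w)
    (h : w = v) {g g' : X.Pi1 v} (hg : (⟨w, a⟩ : X.UVert v) = ⟨v, g⟩)
    (hg' : (⟨w, .mk q⟩ : X.UVert v) = ⟨v, g'⟩) : a.comp (.mk q.reverse) = g * g'⁻¹ := by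
  subst h
  obtain rfl := eq_of_heq (Sigma.mk.inj hg).2
  obtain rfl := eq_of_heq (Sigma.mk.inj hg').2
  rfl

theorem path_reverse (f : Map Y X) {v w : Y.Vert} (p : Y.EdgePath v w) :
    f.path p.reverse = (f.path p).reverse := by
  induction p with
  | nil => rfl
  | cons p e ih =>
    have h1 : (p.cons e).reverse = (Quiver.reverse e).toPath.comp p.reverse := rfl
    have h2 : (f.path (p.cons e)).reverse =
      (Quiver.reverse (f.skel.map e)).toPath.comp (f.path p).reverse := rfl
    rw [h1, h2, f.path_comp, ih]
    have e1 : f.skel.map (Quiver.reverse e) = Quiver.reverse (f.skel.map e) :=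
      Subtype.ext (f.map_rev e.1)
    rw [← e1]
    rfl

/-- The subgroup of a finite cover has finite index. -/
theorem Map.IsFiniteCover.finiteIndex {μ : Map Y X} (hμ : μ.IsFiniteCover) (y : Y.Vert) :
    (μ.pi1 y).range.FiniteIndex := by
  have hs := hμ.1.liftsEdges.uMap_surjective y
  choose L hL using fun g : X.Pi1 (μ y) => hs ⟨μ y, g⟩
  have hfib : ∀ g, μ (L g).1 = μ y := fun g => congrArg Sigma.fst (hL g)
  have := (hμ.2 (μ y)).to_subtype
  have key : ∀ g g', (L g).1 = (L g').1 → g * g'⁻¹ ∈ (μ.pi1 y).range := by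
    intro g g' h
    have h1 := hL g
    have h2 := hL g'
    have h3 := hfib g
    generalize L g = P at *
    generalize L g' = P' at *
    obtain ⟨z, a⟩ := P
    obtain ⟨z', b⟩ := P'
    obtain rfl : z = z' := h
    obtain ⟨q, rfl⟩ := b.exists_rep
    refine ⟨a.comp (.mk q.reverse), ?_⟩
    change μ.pathClass _ = _
    rw [μ.pathClass_comp, μ.pathClass_mk, path_reverse]
    exact comp_reverse_eq_mul_inv _ _ h3 h1 h2
  have hfin : Finite (X.Pi1 (μ y) ⧸ (μ.pi1 y).range) := by
    refine Finite.of_injective (β := {z : Y.Vert | μ z = μ y})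
      (fun q => ⟨(L q.out⁻¹).1, hfib _⟩) fun q q' h => ?_
    have h1 := key _ _ (congrArg Subtype.val h)
    rw [inv_inv, ← QuotientGroup.eq, QuotientGroup.out_eq', QuotientGroup.out_eq'] at h1
    exact h1
  exact Subgroup.finiteIndex_of_finite_quotient

/-- Suppose that the vertices of a route all agree, that some path along it has segments in the
classes `c i`, and that the product of these classes lifts to a closed path at `z`. Then the route
has a closed elevation that starts at `z`. -/
theorem exists_closed_elevation {X' : CubeComplex.{u}} {μ : Map X' X} (hX : X.NonpositivelyCurved)
    (hμ : μ.IsCover) (z : X'.Vert) {n : ℕ} (R : X.Route n) (hR : ∀ j, R.vert j = μ z)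
    (c : Fin n → X.Pi1 (μ z)) (hc : ∀ i, ∃ l : List (R.Y i).Edge,
      (R.Y i).vertTransport.Walk (R.start i) l (R.fin i) ∧ ∃ p : X.EdgePath (μ z) (μ z),
        (word p = l.map fun e => R.φ i e) ∧ PathClass.mk p = c i)
    (hprod : (List.ofFn c).prod ∈ (μ.pi1 z).range) :
    ∃ R' : X'.Route n, R.IsElevation μ R' ∧ R'.Closed := by
  have hinj := hμ.isLocalIsometry.uMap_injective hX z
  choose L hL using hμ.liftsEdges.uMap_surjective z
  let P : Fin (n + 1) → X'.UVert z := fun j => L ⟨μ z, Fin.partialProd c j⟩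
  have hP : ∀ j, μ.uMap z (P j) = ⟨μ z, Fin.partialProd c j⟩ := fun j => hL _
  have hfib : ∀ j, μ (P j).1 = μ z := fun j => congrArg Sigma.fst (hP j)
  have hclosed : (P 0).1 = (P (Fin.last n)).1 := by
    obtain ⟨s, hs⟩ := hprod
    have h0 : P 0 = ⟨z, .mk .nil⟩ := hinj (by
      rw [hP, Fin.partialProd_zero]
      rfl)
    have h1 : P (Fin.last n) = ⟨z, s⟩ := hinj (by
      rw [hP]
      have : Fin.partialProd c (Fin.last n) = (List.ofFn c).prod := by
        rw [Fin.partialProd, Fin.val_last, List.take_of_length_le (by simp)]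
      rw [this, ← hs]
      rfl)
    rw [h0, h1]
  let v0 : ∀ i, (fiberProduct (R.φ i) μ).Vert := fun i => ⟨(R.start i, (P i.castSucc).1), by
    rw [R.map_start, hR, hfib]⟩
  have hend : ∀ i, ∃ w : (component (v0 i)).toCubeComplex.Vert,
      fiberFst (R.φ i) μ w.1 = R.fin i ∧ fiberSnd (R.φ i) μ w.1 = (P i.succ).1 := by
    intro i
    obtain ⟨l, hl, p, hp, hpc⟩ := hc i
    have hlift : (fiberFst (R.φ i) μ).LiftsEdges := fun v e h => (fiberFst_lift hμ v e h).exists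
    obtain ⟨l', w, h1, rfl, h2⟩ := hlift.walk (v := v0 i) hl
    refine ⟨⟨w, mem_component_vert.2 ⟨l', h1⟩⟩, h2, ?_⟩
    obtain ⟨r, hr⟩ := exists_path_of_walk (walk_map (fiberSnd (R.φ i) μ) h1)
    have h3 := (uwalk_word (P i.castSucc).2 r).map (T' := X.uTransport (μ z)) μ (μ.uMap z)
      μ.uMap_step
    have h4 := uwalk_word (Fin.partialProd c i.castSucc) p
    have e1 : ((word r).map fun e => μ e) = word p := by
      rw [hr, hp, List.map_map, List.map_map]
      exact List.map_congr_left fun e _ => (fiber_comm e).symm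
    have e2 : μ.uMap z ⟨(fiberSnd (R.φ i) μ) (v0 i), (P i.castSucc).2⟩ =
      ⟨μ z, Fin.partialProd c i.castSucc⟩ := hP _
    have h3' : (X.uTransport (μ z)).Walk ⟨μ z, Fin.partialProd c i.castSucc⟩ (word p)
        (μ.uMap z ⟨fiberSnd (R.φ i) μ w, (P i.castSucc).2.comp (.mk r)⟩) := e1 ▸ e2 ▸ h3
    have h5 := h3'.unique h4
    have h6 : (⟨μ z, (Fin.partialProd c i.castSucc).comp (PathClass.mk p)⟩ : X.UVert (μ z)) =
        ⟨μ z, Fin.partialProd c i.succ⟩ := by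
      rw [Fin.partialProd_succ, hpc]
      rfl
    rw [h6, ← hP] at h5
    exact congrArg Sigma.fst (hinj h5)
  choose w hw1 hw2 using hend
  have hloc : ∀ i, ((fiberSnd (R.φ i) μ).comp (component (v0 i)).incl).IsLocalIsometry := fun i =>
    (fiberSnd_isLocalIsometry (R.isom i)).comp (component_isLocalIsometry _)
  have hX' := hμ.isLocalIsometry.npc hX
  refine ⟨{ vert := fun j => (P j).1
            Y := fun i => (component (v0 i)).toCubeComplex
            connected := fun i => component_connected _
            npc := fun i => (hloc i).npc hX'
            φ := fun i => (fiberSnd (R.φ i) μ).comp (component (v0 i)).incl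
            isom := hloc
            start := fun i => ⟨v0 i, component_self _⟩
            fin := w
            map_start := fun i => rfl
            map_fin := hw2 }, ⟨fun j => (hfib j).trans (hR j).symm, fun i => ?_⟩, hclosed⟩
  exact ⟨_, isElevation_component hμ (R.connected i) (v0 i), rfl, hw1 i⟩

/-! ### From routes to products of subgroups -/

theorem mk_realization {x : X.Vert} : ∀ {n : ℕ} (δ : X.SegmentedPath fun _ : Fin (n + 1) => x),
    (PathClass.mk (SegmentedPath.realization δ) : X.Pi1 x) =
      (List.ofFn fun i => (PathClass.mk (δ i) : X.Pi1 x)).prod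
  | 0, _ => rfl
  | n + 1, δ => by
    rw [List.ofFn_succ', List.concat_eq_append, List.prod_append, List.prod_singleton,
      ← mk_realization fun i : Fin n => δ i.castSucc]
    rfl

theorem prod_ofFn_mul_last {G : Type*} [Group G] {m : ℕ} (k : Fin (m + 1) → G) (g : G) :
    (List.ofFn fun i => k i * if i = Fin.last m then g else 1).prod = (List.ofFn k).prod * g := by
  rw [List.ofFn_succ', List.ofFn_succ' k]
  simp [List.prod_append, mul_assoc, (Fin.castSucc_lt_last _).ne]

theorem word_cast {v w v' w' : X.Vert} (p : X.EdgePath v w) (hv : v = v') (hw : w = w') :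
    word (p.cast hv hw) = word p := by
  subst hv hw
  rfl

/-- The action of `K` on the cubes of an invariant subcomplex. -/
@[reducible]
noncomputable def InvariantConvex.mulAction {x : X.Vert} {K : Subgroup (X.Pi1 x)}
    {Y : (X.universalCover x).Subcomplex} (hY : InvariantConvex K Y) (n : ℕ) :
    MulAction K (Y.toCubeComplex.Cube n) where
  smul k c := ⟨k.1 • c.1, hY.smul_mem k.1 k.2 n c.1 c.2⟩
  one_smul c := Subtype.ext (one_smul _ c.1)
  mul_smul k k' c := Subtype.ext (mul_smul k.1 k'.1 c.1)

/-- The orbit relation on an invariant subcomplex of the universal cover. -/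
noncomputable def InvariantConvex.congruence {x : X.Vert} {K : Subgroup (X.Pi1 x)}
    {Y : (X.universalCover x).Subcomplex} (hY : InvariantConvex K Y) :
    DeckCongruence ((X.uproj x).comp Y.incl) :=
  letI := hY.mulAction
  orbitCongruence _ K (fun _ _ _ => rfl) (fun _ _ => rfl)

theorem InvariantConvex.congruence_rel {x : X.Vert} {K : Subgroup (X.Pi1 x)}
    {Y : (X.universalCover x).Subcomplex} (hY : InvariantConvex K Y) {n : ℕ}
    {c d : Y.toCubeComplex.Cube n} :
    (hY.congruence.rel n).r c d ↔ ∃ k ∈ K, c.1 = k • d.1 :=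
  ⟨fun ⟨k, hk⟩ => ⟨k.1, k.2, (congrArg Subtype.val hk).symm⟩,
    fun ⟨k, hk, h⟩ => ⟨⟨k, hk⟩, Subtype.ext h.symm⟩⟩

/-- If closed elevations can be avoided then products of convex-cocompact subgroups are separable.
For `g ∉ K₀ ⋯ K_m`, the route consists of the quotients by `K i` of convex cocompact subcomplexes
that contain the base point, and in the last case also its translate by `g⁻¹`. The paths along
this route represent the elements of `K₀ ⋯ K_m g⁻¹`, so it is essential. A finite cover without
closed elevation then shows that `K₀ ⋯ K_m g⁻¹` does not meet the normal core of a subgroup of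
finite index. -/
theorem separable_of_route_separation (hX : X.NonpositivelyCurved) (hXE : X.LocallyFiniteParallel)
    (x : X.Vert) (m : ℕ)
    (h : ∀ R : X.Route (m + 1), R.IsFinite → R.Closed → R.Essential →
      ∃ (X' : CubeComplex.{u}) (μ : CubeComplex.Map X' X), μ.IsFiniteCover ∧
        ∀ R' : X'.Route (m + 1), R.IsElevation μ R' → ¬ R'.Closed)
    (K : Fin (m + 1) → Subgroup (X.Pi1 x)) (hK : ∀ i, ConvexCocompact (K i)) :
    IsSeparableSubset (List.ofFn fun i => (K i : Set (X.Pi1 x))).prod := by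
  intro g hg
  have hg' : ∀ k : Fin (m + 1) → X.Pi1 x, (∀ i, k i ∈ K i) → (List.ofFn k).prod ≠ g := by
    rintro k hk rfl
    exact hg (Set.mem_prod_list_ofFn.2 ⟨fun i => ⟨k i, hk i⟩, rfl⟩)
  -- The last complex of the route ends at the translate of the base point by `g⁻¹`.
  let t : Fin (m + 1) → X.Pi1 x := fun i => if i = Fin.last m then g⁻¹ else 1
  let b : (X.universalCover x).Vert := uvert ⟨x, .mk .nil⟩
  choose Y hY hbY F hF hFK using fun i => (hK i).exists_containing hX hXE
    (A := {b, t i • b}) (Set.toFinite _)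
  have hb : ∀ i, b ∈ (Y i).cubes 0 := fun i => hbY i (by simp)
  have htb : ∀ i, t i • b ∈ (Y i).cubes 0 := fun i => hbY i (by simp)
  have hloc : ∀ i, ((X.uproj x).comp (Y i).incl).IsLocalIsometry := fun i =>
    (uproj_isLocalIsometry x).comp (hY i).convex.2
  have hupt : ∀ g' : X.Pi1 x, upt (g' • b) = ⟨x, g'⟩ := fun g' => by
    rw [upt_smul]
    exact congrArg (Sigma.mk x) (PathClass.comp_nil g')
  let R : X.Route (m + 1) :=
    { vert := fun _ => x
      Y := fun i => (hY i).congruence.quotient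
      connected := fun i => (hY i).congruence.connected (hY i).convex.1
      npc := fun i => ((hY i).congruence.desc_isLocalIsometry (hloc i)).npc hX
      φ := fun i => (hY i).congruence.desc
      isom := fun i => (hY i).congruence.desc_isLocalIsometry (hloc i)
      start := fun i => (hY i).congruence.toQuotient ⟨b, hb i⟩
      fin := fun i => (hY i).congruence.toQuotient ⟨t i • b, htb i⟩
      map_start := fun i => rfl
      map_fin := fun i => rfl }
  have hRfin : R.IsFinite := by
    intro i
    refine (hY i).congruence.isFinite (F := (fun c : Σ n, (Y i).toCubeComplex.Cube n =>
      (⟨c.1, c.2.1⟩ : Σ n, (X.universalCover x).Cube n)) ⁻¹' F i) ?_ ?_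
    · refine (hF i).preimage ?_
      rintro ⟨n, c, hc⟩ - ⟨n', c', hc'⟩ - h
      obtain ⟨rfl, h⟩ := Sigma.mk.inj h
      obtain rfl := eq_of_heq h
      rfl
    · intro n c
      obtain ⟨k, hk, d, hd, hcd⟩ := hFK i n c.1 c.2
      have hdY : d ∈ (Y i).cubes n := by
        have := (hY i).smul_mem k⁻¹ ((K i).inv_mem hk) n c.1 c.2
        rwa [hcd, inv_smul_smul] at this
      exact ⟨⟨d, hdY⟩, hd, (hY i).congruence_rel.2 ⟨k, hk, hcd⟩⟩
  have hRess : R.Essential := by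
    intro δ hδ hnull
    have key : ∀ i, ∃ k ∈ K i, (PathClass.mk (δ i) : X.Pi1 x) = k * t i := by
      intro i
      obtain ⟨η, hη⟩ := hδ i
      obtain ⟨l, w, h1, h2, h3⟩ := (hY i).congruence.liftsEdges.walk (v := ⟨b, hb i⟩) (walk_word η)
      obtain ⟨k, hk, hw⟩ := (hY i).congruence_rel.1 (Quotient.exact h3)
      have h4 := uwalk_of_walk (walk_map (Y i).incl h1)
      have h5 := uwalk_word (PathClass.mk (.nil : X.EdgePath x x)) (δ i)
      have e1 : word (δ i) =
          (l.map fun e => (Y i).incl e).map fun e => X.uproj x e := by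
        rw [← hη, word_cast, word_path, ← h2, List.map_map, List.map_map]
        rfl
      rw [e1] at h5
      have h6 := EdgeTransport.Walk.unique h5 h4
      have e2 : (Y i).incl w = (k * t i) • b := hw.trans (mul_smul k (t i) b).symm
      rw [e2, hupt, PathClass.nil_comp] at h6
      exact ⟨k, hk, eq_of_heq (Sigma.mk.inj h6).2⟩
    choose k hk hδk using key
    obtain ⟨_, hn⟩ := hnull
    have h1 : (PathClass.mk (SegmentedPath.realization δ) : X.Pi1 x) = 1 := Quotient.sound hn
    have h2 := mk_realization δ
    rw [h1] at h2
    simp only [hδk] at h2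
    rw [prod_ofFn_mul_last, eq_comm, mul_inv_eq_one] at h2
    exact hg' k hk h2
  obtain ⟨X', μ, hμ, hno⟩ := h R hRfin rfl hRess
  obtain ⟨z, hz⟩ := hμ.1.surjective x
  subst hz
  have := hμ.finiteIndex z
  refine ⟨X.Pi1 (μ z) ⧸ (μ.pi1 z).range.normalCore, inferInstance, inferInstance,
    QuotientGroup.mk' _, ?_⟩
  rintro ⟨g', hg1, hg2⟩
  obtain ⟨k, rfl⟩ := Set.mem_prod_list_ofFn.1 hg1
  have hmem : (List.ofFn fun i => (k i : X.Pi1 (μ z))).prod * g⁻¹ ∈ (μ.pi1 z).range := by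
    apply Subgroup.normalCore_le
    rw [← QuotientGroup.eq_one_iff, QuotientGroup.mk_mul, QuotientGroup.mk_inv, mul_inv_eq_one]
    exact hg2
  have hwalk : ∀ i, ∃ l : List (R.Y i).Edge,
      (R.Y i).vertTransport.Walk (R.start i) l (R.fin i) ∧ ∃ p : X.EdgePath (μ z) (μ z),
        (word p = l.map fun e => R.φ i e) ∧ PathClass.mk p = (k i : X.Pi1 (μ z)) * t i := by
    intro i
    have hend : ((k i : X.Pi1 (μ z)) • t i • b) ∈ (Y i).cubes 0 :=
      (hY i).smul_mem _ (k i).2 0 _ (htb i)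
    obtain ⟨l, hl⟩ := (connected_iff.1 (hY i).convex.1).2 ⟨b, hb i⟩ ⟨_, hend⟩
    have h1 := walk_map (hY i).congruence.toQuotient hl
    have e1 : (hY i).congruence.toQuotient ⟨_, hend⟩ = R.fin i :=
      Quotient.sound ((hY i).congruence_rel.2 ⟨k i, (k i).2, rfl⟩)
    rw [e1] at h1
    refine ⟨_, h1, ?_⟩
    have h2 := uwalk_of_walk (walk_map (Y i).incl hl)
    have e2 : (Y i).incl (⟨_, hend⟩ : (Y i).toCubeComplex.Vert) =
      ((k i : X.Pi1 (μ z)) * t i) • b := (mul_smul _ (t i) b).symm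
    rw [e2, hupt] at h2
    obtain ⟨p, hp1, hp2⟩ := exists_path_of_uwalk h2
    refine ⟨p, ?_, ?_⟩
    · exact hp1.trans (by rw [List.map_map, List.map_map]; rfl)
    · exact (PathClass.nil_comp _).symm.trans hp2.symm
  obtain ⟨R', h1, h2⟩ := exists_closed_elevation hX hμ.1 z R (fun _ => rfl)
    (fun i => (k i : X.Pi1 (μ z)) * t i) hwalk
    ((prod_ofFn_mul_last (fun i => (k i : X.Pi1 (μ z))) g⁻¹).symm ▸ hmem)
  exact hno R' h1 h2

/-! ### Convex-cocompact subgroups from finite complexes -/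

theorem Map.IsLocalIsometry.of_comp {g : Map Y X} {f : Map Z Y} (hg : g.IsLocalIsometry)
    (hgf : (g.comp f).IsLocalIsometry) : f.IsLocalIsometry where
  link_injective c c' h h' := hgf.link_injective c c' h (congrArg (fun c => g c) h')
  link_full y n c h h' := by
    obtain ⟨d, h1, h2⟩ := hgf.link_full y (g c) (by rw [← g.map_origin, h]; rfl) fun i => by
      obtain ⟨e, he, he'⟩ := h' i
      exact ⟨e, he, by rw [← g.map_axis, ← he']; rfl⟩
    refine ⟨d, h1, hg.link_injective _ _ ?_ h2⟩
    rw [← f.map_origin, h1, h]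

/-- The image of a combinatorial map. -/
def Map.range (f : Map Y X) : X.Subcomplex where
  cubes _ := Set.range fun c => f c
  face_mem := by
    rintro m n σ _ ⟨c, rfl⟩
    exact ⟨Y.face σ c, f.map_face σ c⟩

/-- A combinatorial map as a map to its image. -/
def Map.toRange (f : Map Y X) : Map Y f.range.toCubeComplex where
  toFun c := ⟨f c, c, rfl⟩
  map_face σ c := Subtype.ext (f.map_face σ c)

theorem Map.IsLocalIsometry.range_isConvex {f : Map Y X} (hf : f.IsLocalIsometry)
    (hinj : ∀ v w : Y.Vert, f v = f w → v = w) (hY : Y.Connected) : f.range.IsConvex := by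
  constructor
  · rw [connected_iff] at hY ⊢
    refine ⟨hY.1.map fun v => f.toRange v, ?_⟩
    rintro ⟨_, v, rfl⟩ ⟨_, w, rfl⟩
    obtain ⟨l, hl⟩ := hY.2 v w
    exact ⟨_, walk_map f.toRange hl⟩
  · refine ⟨fun _ _ _ h => Subtype.ext h, ?_⟩
    rintro ⟨_, v, rfl⟩ n c hc hax
    obtain ⟨c', h1, rfl⟩ := hf.link_full v c hc fun i => by
      obtain ⟨⟨_, e, rfl⟩, h1, h2⟩ := hax i
      refine ⟨e, hinj _ _ ?_, h2⟩
      rw [f.map_source]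
      exact congrArg Subtype.val h1
    exact ⟨⟨_, c', rfl⟩, Subtype.ext hc, rfl⟩

section Translate

variable {x : X.Vert}

theorem exists_smul_eq {P Q : X.UVert x} (h : P.1 = Q.1) : ∃ g : X.Pi1 x, Q = g • P := by
  obtain ⟨v, a⟩ := P
  obtain ⟨w, b⟩ := Q
  obtain rfl : v = w := h
  obtain ⟨p, rfl⟩ := a.exists_rep
  refine ⟨b.comp (.mk p.reverse), Sigma.ext rfl (heq_of_eq ?_)⟩
  change b = PathClass.comp (b.comp (.mk p.reverse)) (.mk p)
  rw [PathClass.comp_assoc, PathClass.mk_reverse_comp, PathClass.comp_nil]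

theorem smul_left_cancel_point {g h : X.Pi1 x} {P : X.UVert x} (e : g • P = h • P) : g = h := by
  obtain ⟨v, a⟩ := P
  have h1 : g.comp a = h.comp a := eq_of_heq (Sigma.mk.inj e).2
  obtain ⟨p, rfl⟩ := a.exists_rep
  have h2 := congrArg (fun c => PathClass.comp c (.mk p.reverse)) h1
  simpa only [PathClass.comp_assoc, PathClass.mk_comp_reverse, PathClass.comp_nil] using h2

theorem uwalk_smul (g : X.Pi1 x) {P Q : X.UVert x} {l : List X.Edge}
    (h : (X.uTransport x).Walk P l Q) : (X.uTransport x).Walk (g • P) l (g • Q) := by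
  obtain ⟨p, rfl, hQ⟩ := exists_path_of_uwalk h
  have h1 := uwalk_word (g • P).2 p
  convert h1 using 1
  refine congrArg (Sigma.mk Q.1) ?_
  rw [hQ]
  exact (PathClass.comp_assoc _ _ _).symm

theorem exists_uwalk_of_walk {P : X.UVert x} {l : List X.Edge} {w : X.Vert}
    (h : X.vertTransport.Walk P.1 l w) : ∃ Q, (X.uTransport x).Walk P l Q ∧ Q.1 = w := by
  obtain ⟨p, rfl⟩ := exists_path_of_walk h
  exact ⟨_, uwalk_word P.2 p, rfl⟩

/-- The map of universal covers induced by `f : Y → X`, where `γ` is a path from the base point of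
`X` to the image of the base point of `Y`. -/
noncomputable def Map.univ (f : Map Y X) {y : Y.Vert} (γ : X.PathClass x (f y)) :
    Map (Y.universalCover y) (X.universalCover x) where
  toFun c :=
    { cube := f c.cube
      pt := fun a => ⟨f (c.pt a).1, γ.comp (f.pathClass (c.pt a).2)⟩
      pt_fst := fun a => (congrArg (fun v => f v) (c.pt_fst a)).trans (f.map_vertex _ _)
      step := fun σ => by
        obtain ⟨g, hg, h⟩ := f.uMap_step (c.step σ)
        refine ⟨g, hg.trans (f.map_face σ c.cube), ?_⟩
        rw [PathClass.comp_assoc]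
        exact congrArg γ.comp h }
  map_face σ c := UCube.ext (f.map_face σ c.cube) rfl

/-- The image of the fundamental group of `Y` under `f : Y → X`, where base points are joined by
the path `γ`. -/
def Map.conjRange (f : Map Y X) {y : Y.Vert} (γ : X.PathClass x (f y)) : Subgroup (X.Pi1 x) where
  carrier := {g | ∃ ω : Y.Pi1 y, g.comp γ = γ.comp (f.pathClass ω)}
  one_mem' := ⟨1, (PathClass.nil_comp γ).trans (PathClass.comp_nil γ).symm⟩
  mul_mem' := by
    rintro g g' ⟨ω, h⟩ ⟨ω', h'⟩
    refine ⟨ω.comp ω', ?_⟩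
    change PathClass.comp (g.comp g') γ = _
    rw [PathClass.comp_assoc, h', ← PathClass.comp_assoc, h, PathClass.comp_assoc, f.pathClass_comp]
  inv_mem' := by
    rintro g ⟨ω, h⟩
    refine ⟨ω⁻¹, PathClass.comp_left_cancel (a := g) ?_⟩
    have h1 : PathClass.comp g g⁻¹ = .mk .nil := mul_inv_cancel g
    have h2 : PathClass.comp ω ω⁻¹ = .mk .nil := mul_inv_cancel ω
    rw [← PathClass.comp_assoc, ← PathClass.comp_assoc, h1, h, PathClass.comp_assoc,
      ← f.pathClass_comp, h2, PathClass.nil_comp]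
    exact (PathClass.comp_nil γ).symm

theorem Map.mem_conjRange {f : Map Y X} {y : Y.Vert} {γ : X.PathClass x (f y)} {g : X.Pi1 x} :
    g ∈ f.conjRange γ ↔ ∃ l, Y.vertTransport.Walk y l y ∧
      (X.uTransport x).Walk ⟨f y, γ⟩ (l.map fun e => f e) (g • ⟨f y, γ⟩) := by
  constructor
  · rintro ⟨ω, h⟩
    obtain ⟨p, rfl⟩ := ω.exists_rep
    refine ⟨_, walk_word p, ?_⟩
    have h1 := uwalk_word γ (f.path p)
    rw [word_path] at h1
    convert h1 using 1
    exact congrArg (Sigma.mk (f y)) h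
  · rintro ⟨l, hl, h⟩
    obtain ⟨p, rfl⟩ := exists_path_of_walk hl
    have h1 := uwalk_word γ (f.path p)
    rw [word_path] at h1
    exact ⟨.mk p, eq_of_heq (Sigma.mk.inj (EdgeTransport.Walk.unique h h1)).2⟩

theorem Map.univ_smul (f : Map Y X) {y : Y.Vert} {γ : X.PathClass x (f y)} {g : X.Pi1 x}
    {ω : Y.Pi1 y} (h : g.comp γ = γ.comp (f.pathClass ω)) {n : ℕ}
    (c : (Y.universalCover y).Cube n) : f.univ γ (ω • c) = g • f.univ γ c := by
  apply UCube.ext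
  · rfl
  · funext a
    refine congrArg (Sigma.mk _) ?_
    change γ.comp (f.pathClass (ω.comp (c.pt a).2)) = g.comp (γ.comp (f.pathClass (c.pt a).2))
    rw [← PathClass.comp_assoc, h, f.pathClass_comp, PathClass.comp_assoc]

/-- Lifts of a cube to the universal cover differ by deck transformations. -/
theorem exists_smul_eq_of_uproj_eq {n : ℕ} {c d : (X.universalCover x).Cube n}
    (h : X.uproj x c = X.uproj x d) : ∃ g : X.Pi1 x, d = g • c := by
  have h1 : (upt ((X.universalCover x).origin c)).1 = (upt ((X.universalCover x).origin d)).1 := by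
    rw [upt_fst, upt_fst, (X.uproj x).map_origin, (X.uproj x).map_origin, h]
  obtain ⟨g, hg⟩ := exists_smul_eq h1
  refine ⟨g, (uproj_isLocalIsometry x).link_injective d (g • c) ?_ h.symm⟩
  apply upt_injective
  rw [hg, origin_smul]
  rfl

/-- The fundamental groups of finite complexes with a local isometry to `X` are convex-cocompact. -/
theorem Map.IsLocalIsometry.convexCocompact (hX : X.NonpositivelyCurved) {f : Map Y X}
    (hf : f.IsLocalIsometry) (hY : Y.Connected) (hfin : Y.IsFinite) {y : Y.Vert}
    (γ : X.PathClass x (f y)) : ConvexCocompact (f.conjRange γ) := by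
  have hloc : (f.univ γ).IsLocalIsometry := by
    refine (uproj_isLocalIsometry x).of_comp ?_
    exact hf.comp (uproj_isLocalIsometry y)
  have hcov := uproj_isCover hY y
  choose L hL using fun c : Σ n, Y.Cube n => show ∃ d : (Y.universalCover y).Cube c.1,
      Y.uproj y d = c.2 by
    obtain ⟨v, hv⟩ := hcov.surjective (Y.origin c.2)
    obtain ⟨d, ⟨-, h⟩, -⟩ := hcov.lift v c.2 hv.symm
    exact ⟨d, h⟩
  refine ⟨(f.univ γ).range, hloc.range_isConvex (fun v w h => ?_) (universalCover_connected y), ?_,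
    Set.range fun c : Σ n, Y.Cube n => ⟨c.1, f.univ γ (L c)⟩, ?_, ?_⟩
  · exact hloc.injective_vert (universalCover_npc hX x) (universalCover_connected y)
      (universalCover_uniqueReduced hX x) h
  · rintro k ⟨ω, h⟩ n _ ⟨c, rfl⟩
    exact ⟨ω • c, f.univ_smul h c⟩
  · have : Finite (Σ n, Y.Cube n) := hfin
    exact Set.finite_range _
  · rintro n _ ⟨c, rfl⟩
    obtain ⟨ω, h⟩ := exists_smul_eq_of_uproj_eq (hL ⟨n, Y.uproj y c⟩)
    obtain ⟨g, hg⟩ := exists_smul_eq (P := (⟨f y, γ⟩ : X.UVert x))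
      (Q := ⟨f y, γ.comp (f.pathClass ω)⟩) rfl
    have hg' : g.comp γ = γ.comp (f.pathClass ω) := (eq_of_heq (Sigma.mk.inj hg).2).symm
    refine ⟨g, ⟨ω, hg'⟩, _, ⟨⟨n, Y.uproj y c⟩, rfl⟩, ?_⟩
    rw [← f.univ_smul hg', ← h]

/-! ### From products of subgroups to routes -/

/-- Lifts of the vertices of a route to the universal cover, joined by lifts of given words. -/
theorem exists_uwalk_sequence {n : ℕ} (v : Fin (n + 1) → X.Vert) (l : Fin n → List X.Edge)
    (hl : ∀ i, X.vertTransport.Walk (v i.castSucc) (l i) (v i.succ)) (P : X.UVert x)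
    (hP : P.1 = v 0) : ∃ Γ : Fin (n + 1) → X.UVert x, (∀ j, (Γ j).1 = v j) ∧
      ∀ i, (X.uTransport x).Walk (Γ i.castSucc) (l i) (Γ i.succ) := by
  have hs : ∀ (i : Fin n) (Q : {Q : X.UVert x // Q.1 = v i.castSucc}),
      ∃ Q' : {Q : X.UVert x // Q.1 = v i.succ}, (X.uTransport x).Walk Q.1 (l i) Q'.1 := by
    rintro i ⟨Q, hQ⟩
    have h1 := hl i
    rw [← hQ] at h1
    obtain ⟨Q', h2, h3⟩ := exists_uwalk_of_walk h1
    exact ⟨⟨Q', h3⟩, h2⟩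
  choose s hs using hs
  let Γ : ∀ j : Fin (n + 1), {Q : X.UVert x // Q.1 = v j} :=
    Fin.induction ⟨P, hP⟩ s
  exact ⟨fun j => (Γ j).1, fun j => (Γ j).2, fun i => hs i (Γ i.castSucc)⟩

theorem word_realization_succ {n : ℕ} {v : Fin (n + 2) → X.Vert} (δ : X.SegmentedPath v) :
    word (SegmentedPath.realization δ) = word (δ (Fin.last n)) ++
      word (SegmentedPath.realization (v := fun i : Fin (n + 1) => v i.castSucc)
        fun i => δ i.castSucc) :=
  word_comp _ _

theorem word_realization_map (f : Map Y X) : ∀ {n : ℕ} {v : Fin (n + 1) → X.Vert}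
    {v' : Fin (n + 1) → Y.Vert} (δ : X.SegmentedPath v) (δ' : Y.SegmentedPath v'),
    (∀ i, word (δ i) = (word (δ' i)).map fun e => f e) →
      word (SegmentedPath.realization δ) = (word (SegmentedPath.realization δ')).map fun e => f e
  | 0, _, _, _, _, _ => rfl
  | n + 1, v, v', δ, δ', h => by
    rw [word_realization_succ, word_realization_succ, List.map_append, h]
    exact congrArg _ (word_realization_map f (v := fun i : Fin (n + 1) => v i.castSucc)
      (v' := fun i : Fin (n + 1) => v' i.castSucc) (fun i => δ i.castSucc)
      (fun i => δ' i.castSucc) fun i => h i.castSucc)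

/-- If the segments of a path lead from `Γ i` to translates of `Γ (i + 1)`, then the whole path
leads from the first point to the translate of the last one by the product of the translating
elements. -/
theorem uwalk_realization : ∀ {n : ℕ} {v : Fin (n + 1) → X.Vert} (δ : X.SegmentedPath v)
    (Γ : Fin (n + 1) → X.UVert x) (k : Fin n → X.Pi1 x),
    (∀ i, (X.uTransport x).Walk (Γ i.castSucc) (word (δ i)) (k i • Γ i.succ)) →
      (X.uTransport x).Walk (Γ 0) (word (SegmentedPath.realization δ))
        ((List.ofFn k).prod • Γ (Fin.last n))
  | 0, _, _, Γ, _, _ => (one_smul _ (Γ 0)).symm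
  | n + 1, v, δ, Γ, k, h => by
    have h1 := uwalk_realization (v := fun i : Fin (n + 1) => v i.castSucc)
      (fun i => δ i.castSucc) (fun i => Γ i.castSucc) (fun i => k i.castSucc)
      fun i => h i.castSucc
    have h2 := uwalk_smul (List.ofFn fun i => k i.castSucc).prod (h (Fin.last n))
    rw [List.ofFn_succ', List.concat_eq_append, List.prod_append, List.prod_singleton, mul_smul,
      word_realization_succ]
    exact EdgeTransport.Walk.append h1 h2

theorem nullHomotopic_of_uwalk {v w : X.Vert} {p : X.EdgePath v w} {P : X.UVert x} (hP : P.1 = v)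
    (h : (X.uTransport x).Walk P (word p) P) : NullHomotopic p := by
  obtain ⟨_, c⟩ := P
  subst hP
  have h1 := EdgeTransport.Walk.unique h (uwalk_word c p)
  obtain ⟨h2, h3⟩ := Sigma.mk.inj h1
  subst h2
  refine ⟨rfl, PathClass.homotopic_of_mk_eq (PathClass.comp_left_cancel (a := c) ?_)⟩
  exact (eq_of_heq h3).symm.trans (PathClass.comp_nil c).symm

/-- The cover that belongs to the kernel of a homomorphism to a finite group. -/
theorem orbitCover_isFiniteCover (hconn : X.Connected) {F : Type u} [Group F] [Finite F]
    (θ : X.Pi1 x →* F) : (orbitCongruence (X.uproj x) θ.ker (fun _ _ _ => rfl)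
      (fun _ _ => rfl)).desc.IsFiniteCover := by
  have hcov := uproj_isCover hconn x
  refine ⟨DeckCongruence.desc_isCover _ hcov, fun v => ?_⟩
  obtain ⟨V, rfl⟩ := hcov.surjective v
  refine (Set.finite_range fun a : F => (orbitCongruence (X.uproj x) θ.ker (fun _ _ _ => rfl)
      (fun _ _ => rfl)).toQuotient (Function.invFun θ a • V)).subset fun w hw => ?_
  obtain ⟨W, rfl⟩ := DeckCongruence.exists_rep _ w
  obtain ⟨g, rfl⟩ := exists_smul_eq_of_uproj_eq (c := V) (d := W) hw.symm
  refine ⟨θ g, Quotient.sound ⟨⟨Function.invFun θ (θ g) * g⁻¹, ?_⟩, ?_⟩⟩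
  · rw [MonoidHom.mem_ker, map_mul, map_inv, Function.invFun_eq (f := θ) ⟨g, rfl⟩, mul_inv_cancel]
  · change (Function.invFun θ (θ g) * g⁻¹) • g • V = _
    rw [mul_smul, inv_smul_smul]

/-- If products of convex-cocompact subgroups are separable then closed elevations can be avoided.
Lift the vertices of the route to points `Γ j` of the universal cover, such that consecutive
points are joined by a path along the route. Then the end points of lifts at `Γ i` of paths along
the `i`-th complex are the translates of `Γ (i + 1)` by the elements of a convex-cocompact
subgroup `K i`. As the route is closed, `Γ 0` is the translate of the last point by some `t`, and
`t` is not in the product of the `K i` as the route is essential. If the homomorphism `θ`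
separates `t` from this product, then the cover given by its kernel is as required. -/
theorem route_separation_of_separable (hconn : X.Connected) (hX : X.NonpositivelyCurved)
    (x : X.Vert) (n : ℕ)
    (h : ∀ K : Fin n → Subgroup (X.Pi1 x), (∀ i, CubeComplex.ConvexCocompact (K i)) →
      IsSeparableSubset (List.ofFn fun i => (K i : Set (X.Pi1 x))).prod)
    (R : X.Route n) (hfin : R.IsFinite) (hclosed : R.Closed) (hess : R.Essential) :
    ∃ (X' : CubeComplex.{u}) (μ : CubeComplex.Map X' X), μ.IsFiniteCover ∧
      ∀ R' : X'.Route n, R.IsElevation μ R' → ¬ R'.Closed := by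
  choose a ha using fun i => (connected_iff.1 (R.connected i)).2 (R.start i) (R.fin i)
  obtain ⟨β⟩ := hconn.2 x (R.vert 0)
  obtain ⟨Γ, hΓ, hwalk⟩ := exists_uwalk_sequence (x := x) R.vert
    (fun i => (a i).map fun e => R.φ i e)
    (fun i => by
      have := walk_map (R.φ i) (ha i)
      rwa [R.map_start, R.map_fin] at this) ⟨_, .mk β⟩ rfl
  have hγ : ∀ i, ∃ γ : X.PathClass x (R.φ i (R.start i)), Γ i.castSucc = ⟨_, γ⟩ := by
    intro i
    have h1 : (Γ i.castSucc).1 = R.φ i (R.start i) := by rw [hΓ, R.map_start]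
    generalize Γ i.castSucc = P at h1
    obtain ⟨v, c⟩ := P
    subst h1
    exact ⟨c, rfl⟩
  choose γ hγ using hγ
  obtain ⟨t, ht⟩ := exists_smul_eq (P := Γ (Fin.last n)) (Q := Γ 0) (by
    rw [hΓ, hΓ]
    exact hclosed.symm)
  have hmem : ∀ (i : Fin n) (k : X.Pi1 x), k ∈ (R.φ i).conjRange (γ i) ↔ ∃ m,
      (R.Y i).vertTransport.Walk (R.start i) m (R.fin i) ∧
        (X.uTransport x).Walk (Γ i.castSucc) (m.map fun e => R.φ i e) (k • Γ i.succ) := by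
    intro i k
    rw [Map.mem_conjRange, ← hγ]
    have hk := uwalk_smul k (hwalk i)
    constructor
    · rintro ⟨l, h1, h2⟩
      refine ⟨a i ++ l, h1.append (ha i), ?_⟩
      rw [List.map_append]
      exact h2.append hk
    · rintro ⟨m, h1, h2⟩
      refine ⟨((a i).map (R.Y i).rev).reverse ++ m, h1.append (ha i).reverse, ?_⟩
      rw [List.map_append]
      have := hk.reverse
      refine h2.append ?_
      convert this using 1
      rw [List.map_reverse, List.map_map, List.map_map]
      exact congrArg _ (List.map_congr_left fun e _ => (R.φ i).map_rev e)
  -- A choice of segments along the route determines a product of elements of the subgroups.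
  have halong : ∀ (k : Fin n → X.Pi1 x) (m : ∀ i, List (R.Y i).Edge),
      (∀ i, (R.Y i).vertTransport.Walk (R.start i) (m i) (R.fin i)) →
      (∀ i, (X.uTransport x).Walk (Γ i.castSucc) ((m i).map fun e => R.φ i e) (k i • Γ i.succ)) →
      ∃ δ : X.SegmentedPath R.vert, R.IsAlong δ ∧
        (∀ i, word (δ i) = (m i).map fun e => R.φ i e) ∧
        (X.uTransport x).Walk (Γ 0) (word (SegmentedPath.realization δ))
          ((List.ofFn k).prod • Γ (Fin.last n)) := by
    intro k m h1 h2
    choose η hη using fun i => exists_path_of_walk (h1 i)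
    let δ : X.SegmentedPath R.vert := fun i =>
      ((R.φ i).path (η i)).cast (R.map_start i) (R.map_fin i)
    have hδ : ∀ i, word (δ i) = (m i).map fun e => R.φ i e := fun i => by
      rw [word_cast, word_path, hη]
    refine ⟨δ, fun i => ⟨η i, rfl⟩, hδ, uwalk_realization δ Γ k fun i => ?_⟩
    rw [hδ]
    exact h2 i
  have hnot : t ∉ (List.ofFn fun i => ((R.φ i).conjRange (γ i) : Set (X.Pi1 x))).prod := by
    intro hmem'
    obtain ⟨k, hk⟩ := Set.mem_prod_list_ofFn.1 hmem'
    choose m hm1 hm2 using fun i => (hmem i (k i)).1 (k i).2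
    obtain ⟨δ, h1, -, h2⟩ := halong _ m hm1 hm2
    rw [hk, ← ht] at h2
    exact hess δ h1 (nullHomotopic_of_uwalk (hΓ 0) h2)
  obtain ⟨F, _, _, θ, hθ⟩ := h _ (fun i => (R.isom i).convexCocompact hX (R.connected i) (hfin i)
    (γ i)) t hnot
  let r := orbitCongruence (X.uproj x) θ.ker (fun _ _ _ => rfl) (fun _ _ => rfl)
  refine ⟨r.quotient, r.desc, orbitCover_isFiniteCover hconn θ, fun R' ⟨hR1, hR2⟩ hR'c => hθ ?_⟩
  choose ν hν hνs hνf using hR2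
  choose b hb using fun i => (connected_iff.1 (R'.connected i)).2 (R'.start i) (R'.fin i)
  have hm : ∀ i, (R.Y i).vertTransport.Walk (R.start i) ((b i).map fun e => ν i e) (R.fin i) := by
    intro i
    have := walk_map (ν i) (hb i)
    rwa [hνs, hνf] at this
  have hk : ∀ i, ∃ k : X.Pi1 x, (X.uTransport x).Walk (Γ i.castSucc)
      (((b i).map fun e => ν i e).map fun e => R.φ i e) (k • Γ i.succ) := by
    intro i
    have h1 := walk_map (R.φ i) (hm i)
    rw [R.map_start, R.map_fin, ← hΓ] at h1
    obtain ⟨Q, h2, h3⟩ := exists_uwalk_of_walk h1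
    obtain ⟨k, rfl⟩ := exists_smul_eq ((hΓ i.succ).trans h3.symm)
    exact ⟨k, h2⟩
  choose k hk using hk
  obtain ⟨δ, -, hδ, hprod⟩ := halong k _ hm hk
  choose η hη using fun i => exists_path_of_walk (hb i)
  let δ' : r.quotient.SegmentedPath R'.vert := fun i =>
    ((R'.φ i).path (η i)).cast (R'.map_start i) (R'.map_fin i)
  have hδ' : word (SegmentedPath.realization δ) =
      (word (SegmentedPath.realization δ')).map fun e => r.desc e := by
    refine word_realization_map r.desc δ δ' fun i => ?_
    rw [hδ, word_cast, word_path, hη, List.map_map, List.map_map]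
    exact List.map_congr_left fun e _ => (hν i).comm e
  obtain ⟨V, hV⟩ := r.exists_rep (R'.vert 0)
  have h1 := walk_word (SegmentedPath.realization δ')
  generalize word (SegmentedPath.realization δ') = L at h1 hδ'
  rw [← hR'c, ← hV] at h1
  obtain ⟨l, W, h2, h3, h4⟩ := r.liftsEdges.walk h1
  obtain ⟨⟨d, hd⟩, hdW⟩ := Quotient.exact h4
  replace hdW : d • V = W := hdW
  obtain ⟨s, hs⟩ := exists_smul_eq (P := upt V) (Q := Γ 0) (by
    rw [hΓ, ← hR1, ← hV, upt_fst]
    rfl)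
  have h5 := uwalk_smul s (uwalk_of_walk h2)
  have h6 : (l.map fun e => X.uproj x e) = word (SegmentedPath.realization δ) := by
    rw [hδ', ← h3, List.map_map]
    rfl
  rw [h6, ← hs] at h5
  have h7 := EdgeTransport.Walk.unique hprod h5
  have h8 : (List.ofFn k).prod = s * d * s⁻¹ * t := by
    refine smul_left_cancel_point (P := Γ (Fin.last n)) ?_
    rw [h7, mul_smul, ← ht, hs, ← hdW, upt_smul, mul_smul, inv_smul_smul, mul_smul]
  refine ⟨(List.ofFn k).prod, Set.mem_prod_list_ofFn.2
    ⟨fun i => ⟨k i, (hmem i (k i)).2 ⟨_, hm i, hk i⟩⟩, rfl⟩, ?_⟩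
  rw [h8, map_mul, map_mul, map_mul, MonoidHom.mem_ker.1 hd, mul_one, map_inv, mul_inv_cancel,
    one_mul]

end Translate

end CubeComplex

theorem proposition4p10 (X : CubeComplex.{u}) (hconn : X.Connected) (hX : X.NonpositivelyCurved)
    (h : X.LocallyFinite ∨ X.VirtuallySpecial) (x : X.Vert) (n : ℕ) (hn : 1 ≤ n) :
    (∀ R : X.Route n, R.IsFinite → R.Closed → R.Essential →
      ∃ (X' : CubeComplex.{u}) (μ : CubeComplex.Map X' X), μ.IsFiniteCover ∧
        ∀ R' : X'.Route n, R.IsElevation μ R' → ¬ R'.Closed) ↔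
    (∀ K : Fin n → Subgroup (X.Pi1 x), (∀ i, CubeComplex.ConvexCocompact (K i)) →
      IsSeparableSubset (List.ofFn fun i => (K i : Set (X.Pi1 x))).prod) := by
  have hXE : X.LocallyFiniteParallel := h.elim CubeComplex.LocallyFinite.locallyFiniteParallel
    CubeComplex.VirtuallySpecial.locallyFiniteParallel
  obtain ⟨m, rfl⟩ := Nat.exists_eq_add_of_le' hn
  exact ⟨fun h => CubeComplex.separable_of_route_separation hX hXE x m h,
    fun h => CubeComplex.route_separation_of_separable hconn hX x (m + 1) h⟩
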